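/- Let $(M,g)$ be a smooth surface with a smooth Riemannian metric. For an open set $V\subset M$ we use the following terms. * A *3-web* on $V$ assigns to each $x\in V$ a set $W_x$ of three distinct lines in $T_xM$ such that locally $W_x$ consists of the tangent lines of three pairwise transverse smooth foliations, given as level curves of smooth submersions. It is *geodesic* if its leaves are (unparametrized) geodesics of $g$. It is *hexagonal* if for every $p\in V$ every sufficiently small triangle of leaves with vertex $p$ can be completed to a curvilinear hexagon whose sides are leaves and whose three large diagonals are the leaves through $p$. * A *cubic first integral* on $V$ is a function $I$ on $T^*V$ that in local coordinates is a homogeneous cubic polynomial in the momenta with coefficients smooth in the point, and satisfies $\{I,H\}=0$ for the Hamiltonian $H=\tfrac12 g^{ij}p_ip_j$ of the geodesic flow. It has *three distinct real roots* on $V$ if for every $x\in V$ it vanishes on exactly three lines of $T_x^*M$. Its *zero directions* at $x$ are the lines spanned by those $\xi\in T_xM\setminus\{0\}$ with $I(g(\xi,\cdot))=0$. **Theorem.** 1. For every $p\in M$: some open neighbourhood of $p$ carries a hexagonal geodesic 3-web if and only if on some open neighbourhood of $p$ the geodesic flow admits a cubic first integral with three distinct real roots. 2. Let $V\subset M$ be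 open and let $I$ be a cubic first integral on $V$ with three distinct real roots. Then the zero directions of $I$ form a hexagonal geodesic 3-web on $V$. 3. Let $W$ be a hexagonal geodesic 3-web on an open set $V\subset M$. Then every $p\in V$ has an open neighbourhood $V'\subset V$ on which there is a cubic first integral with three distinct real roots whose zero directions at each $x\in V'$ are the web directions $W_x$. 4. Let $(u,v)$ be local coordinates on an open set $V\subset M$ in which $g=E\,du^2+2F\,du\,dv+G\,dv^2$, let $(p,q)$ be the momenta conjugate to $(u,v)$, and suppose that the web $du\,dv\,(du+dv)=0$ is geodesic. Then $$I=\frac{(Gp-Fq)\,(Eq-Fp)\,\bigl((G-F)p+(E-F)q\bigr)}{(EG-F^2)^2}$$ is a cubic first integral on $V$ with three distinct real roots, and its zero directions are the directions of this web. -/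

import Mathlib

open scoped Manifold ContDiff Bundle

noncomputable section

namespace GeodesicWeb

/-- The model plane `ℝ²`. -/
abbrev Plane : Type := EuclideanSpace ℝ (Fin 2)

/-- The `i`-th coordinate vector of the plane. -/
abbrev basisVec (i : Fin 2) : Plane := EuclideanSpace.single i (1 : ℝ)

/-- The partial derivative `∂f/∂yⁱ` at the point `y`. -/
def partialDeriv (f : Plane → ℝ) (i : Fin 2) (y : Plane) : ℝ :=
  fderiv ℝ f y (basisVec i)

/-! ### Formulas in local coordinates -/

/-- Christoffel symbol `Γᵏᵢⱼ` of the Levi-Civita connection of a metric matrix `G`. -/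
def christoffel (G : Plane → Matrix (Fin 2) (Fin 2) ℝ) (k i j : Fin 2) (y : Plane) : ℝ :=
  (1 / 2) * ∑ l, (G y)⁻¹ k l *
    (partialDeriv (fun z => G z j l) i y + partialDeriv (fun z => G z i l) j y
      - partialDeriv (fun z => G z i j) l y)

/-- The `k`-th component of the covariant acceleration of a curve `c` in a coordinate plane with
metric matrix `G`. -/
def covAccel (G : Plane → Matrix (Fin 2) (Fin 2) ℝ) (c : ℝ → Plane) (t : ℝ) (k : Fin 2) : ℝ :=
  deriv (deriv c) t k + ∑ i, ∑ j, christoffel G k i j (c t) * deriv c t i * deriv c t j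

/-- The Hamiltonian `½ gⁱʲ(y) pᵢ pⱼ` of the geodesic flow; for `G = !![E, F; F, G']` this is
`(G' p² - 2 F p q + E q²) / (2 (E G' - F²))`. -/
def hamiltonian (G : Plane → Matrix (Fin 2) (Fin 2) ℝ) (y p : Plane) : ℝ :=
  (1 / 2) * ∑ i, ∑ j, (G y)⁻¹ i j * p i * p j

/-- The canonical Poisson bracket of two functions of position `y` and momentum `p`. -/
def poissonBracket (A B : Plane → Plane → ℝ) (y p : Plane) : ℝ :=
  ∑ i, (partialDeriv (fun z => A z p) i y * partialDeriv (fun r => B y r) i p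
    - partialDeriv (fun r => A y r) i p * partialDeriv (fun z => B z p) i y)

/-! ### Surfaces -/

variable {M : Type*} [TopologicalSpace M] [ChartedSpace Plane M] [IsManifold (𝓡 2) ∞ M]

/-- Smooth Riemannian metrics on the surface `M`. -/
abbrev Metric (M : Type*) [TopologicalSpace M] [ChartedSpace Plane M] [IsManifold (𝓡 2) ∞ M] :
    Type _ :=
  Bundle.ContMDiffRiemannianMetric (𝓡 2) ∞ Plane (fun x : M => TangentSpace (𝓡 2) x)

/-- Covectors (momenta) at a point of `M`. -/
abbrev Covector (x : M) : Type := TangentSpace (𝓡 2) x →L[ℝ] ℝ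

/-- The coordinate vector field `∂/∂yⁱ` of the chart `e` at the point with coordinates `y`. -/
def coordVec (e : OpenPartialHomeomorph M Plane) (i : Fin 2) (y : Plane) :
    TangentSpace (𝓡 2) (e.symm y) :=
  mfderiv (𝓡 2) (𝓡 2) e.symm y (basisVec i)

/-- The matrix of the metric `g` in the chart `e`, as a function of the coordinates. -/
def coordMetric (g : Metric M) (e : OpenPartialHomeomorph M Plane) (y : Plane) :
    Matrix (Fin 2) (Fin 2) ℝ :=
  Matrix.of fun i j => g.inner (e.symm y) (coordVec e i y) (coordVec e j y)

/-- The covector `p₀ dy⁰ + p₁ dy¹` at the point `x`, where `y⁰, y¹` are the coordinates of `e`. -/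
def coordCovector (e : OpenPartialHomeomorph M Plane) (x : M) (p : Plane) : Covector x :=
  (innerSL ℝ p : Plane →L[ℝ] ℝ).comp (mfderiv (𝓡 2) (𝓡 2) e x)

/-- A function on the cotangent bundle, written in the canonical coordinates `(y, p)` that the
chart `e` induces. -/
def inChart (I : (x : M) → Covector x → ℝ) (e : OpenPartialHomeomorph M Plane) (y p : Plane) : ℝ :=
  I (e.symm y) (coordCovector e (e.symm y) p)

/-! ### Cubic first integrals -/

/-- `I` is a cubic first integral of the geodesic flow of `g` on the open set `V`: in every smooth
chart it is a homogeneous cubic polynomial in the momenta, with coefficients that are smooth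
functions of the point, and it Poisson-commutes with the Hamiltonian of the flow. -/
structure IsCubicIntegral (g : Metric M) (I : (x : M) → Covector x → ℝ) (V : Set M) : Prop where
  cubic : ∀ e ∈ IsManifold.maximalAtlas (𝓡 2) ∞ M, ∃ a : Fin 4 → Plane → ℝ,
    (∀ k, ContDiffOn ℝ ∞ (a k) (e.target ∩ e.symm ⁻¹' V)) ∧
    ∀ y ∈ e.target ∩ e.symm ⁻¹' V, ∀ p : Plane,
      inChart I e y p = ∑ k : Fin 4, a k y * p 0 ^ (3 - (k : ℕ)) * p 1 ^ (k : ℕ)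
  commutes : ∀ e ∈ IsManifold.maximalAtlas (𝓡 2) ∞ M,
    ∀ y ∈ e.target ∩ e.symm ⁻¹' V, ∀ p : Plane,
      poissonBracket (inChart I e) (hamiltonian (coordMetric g e)) y p = 0

/-- The real roots `[p : q]` of `I` at `x`, as lines in the cotangent space. -/
def realRoots (I : (x : M) → Covector x → ℝ) (x : M) : Set (Submodule ℝ (Covector x)) :=
  {l | ∃ α : Covector x, α ≠ 0 ∧ I x α = 0 ∧ l = Submodule.span ℝ {α}}

/-- `I` has exactly three distinct real roots at every point of `V` (in particular a cubic `I`
does not vanish identically on the cotangent space of any point of `V`). -/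
def HasThreeRealRoots (I : (x : M) → Covector x → ℝ) (V : Set M) : Prop :=
  ∀ x ∈ V, (realRoots I x).ncard = 3

/-- The zero directions of `I` at `x`: the lines spanned by the tangent vectors `ξ ≠ 0` whose dual
covector `g(ξ, ·)` is a zero of `I`. -/
def zeroDirections (g : Metric M) (I : (x : M) → Covector x → ℝ) (x : M) :
    Set (Submodule ℝ (TangentSpace (𝓡 2) x)) :=
  {L | ∃ ξ : TangentSpace (𝓡 2) x, ξ ≠ 0 ∧ I x (g.inner x ξ) = 0 ∧ L = Submodule.span ℝ {ξ}}

/-! ### Hexagonal geodesic 3-webs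

A (non-singular) 3-web is given by its set `W x` of three tangent lines at every point `x`;
the three foliations are labelled only locally. -/

/-- The line tangent at `x` to the level curve of the function `f`. -/
def levelDirection (f : M → ℝ) (x : M) : Submodule ℝ (TangentSpace (𝓡 2) x) :=
  LinearMap.ker (mfderiv (𝓡 2) 𝓘(ℝ, ℝ) f x).toLinearMap

/-- On the open set `N` the web `W` consists of the three pairwise transverse foliations by the
level curves of the smooth submersions `u 0`, `u 1`, `u 2`. -/
structure AreWebFunctions (W : (x : M) → Set (Submodule ℝ (TangentSpace (𝓡 2) x)))
    (u : Fin 3 → M → ℝ) (N : Set M) : Prop where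
  isOpen : IsOpen N
  smooth : ∀ i, ContMDiffOn (𝓡 2) 𝓘(ℝ, ℝ) ∞ (u i) N
  submersion : ∀ i, ∀ x ∈ N, mfderiv (𝓡 2) 𝓘(ℝ, ℝ) (u i) x ≠ 0
  transverse : ∀ i j, i ≠ j → ∀ x ∈ N, levelDirection (u i) x ≠ levelDirection (u j) x
  directions : ∀ x ∈ N, W x = Set.range fun i => levelDirection (u i) x

/-- Inside `N`, the hexagons around the point `p` close. The leaves are the level curves of `u 0`,
`u 1`, `u 2`. The three leaves through `p` are the large diagonals; the vertices `q 0, …, q 5` lie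
in turn on the leaves through `p` of the foliations `i, j, k, i, j, k`, and consecutive vertices are
joined by a leaf of the remaining foliation. The triangle `p, q 0, q 1` is the given one; the
conclusion is that the sixth side, from `q 5` to `q 0`, is a leaf as well. -/
def HexagonsClose (u : Fin 3 → M → ℝ) (p : M) (N : Set M) : Prop :=
  ∀ i j k : Fin 3, i ≠ j → j ≠ k → i ≠ k → ∀ q : Fin 6 → M, (∀ n, q n ∈ N) →
    u i (q 0) = u i p → u j (q 1) = u j p → u k (q 2) = u k p →
    u i (q 3) = u i p → u j (q 4) = u j p → u k (q 5) = u k p →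
    u k (q 0) = u k (q 1) → u i (q 1) = u i (q 2) → u j (q 2) = u j (q 3) →
    u k (q 3) = u k (q 4) → u i (q 4) = u i (q 5) → u j (q 5) = u j (q 0)

/-- `W` is a 3-web on `V`: locally it is formed by three transverse smooth foliations. -/
def IsWeb (W : (x : M) → Set (Submodule ℝ (TangentSpace (𝓡 2) x))) (V : Set M) : Prop :=
  ∀ p ∈ V, ∃ (u : Fin 3 → M → ℝ) (N : Set M), p ∈ N ∧ N ⊆ V ∧ AreWebFunctions W u N

/-- The web `W` is hexagonal on `V`: around every point of `V` all sufficiently small hexagons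
close. -/
def IsHexagonal (W : (x : M) → Set (Submodule ℝ (TangentSpace (𝓡 2) x))) (V : Set M) : Prop :=
  ∀ p ∈ V, ∃ (u : Fin 3 → M → ℝ) (N : Set M),
    p ∈ N ∧ N ⊆ V ∧ AreWebFunctions W u N ∧ HexagonsClose u p N

/-- The leaves of `W` in `V` are geodesics, as unparametrized curves: in every smooth chart, a
regular smooth curve that is tangent to the web has its covariant acceleration proportional to its
velocity. -/
def IsGeodesic (g : Metric M) (W : (x : M) → Set (Submodule ℝ (TangentSpace (𝓡 2) x)))
    (V : Set M) : Prop :=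
  ∀ e ∈ IsManifold.maximalAtlas (𝓡 2) ∞ M, ∀ (a b : ℝ) (c : ℝ → Plane),
    ContDiffOn ℝ ∞ c (Set.Ioo a b) →
    (∀ t ∈ Set.Ioo a b, c t ∈ e.target ∩ e.symm ⁻¹' V ∧ deriv c t ≠ 0 ∧
      Submodule.span ℝ {(mfderiv (𝓡 2) (𝓡 2) e.symm (c t) (deriv c t) :
        TangentSpace (𝓡 2) (e.symm (c t)))} ∈ W (e.symm (c t))) →
    ∀ t ∈ Set.Ioo a b, ∃ r : ℝ, ∀ k, covAccel (coordMetric g e) c t k = r * deriv c t k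

/-- `W` is a hexagonal geodesic 3-web on the open set `V` of the surface `(M, g)`. -/
structure IsHexagonalGeodesicWeb (g : Metric M)
    (W : (x : M) → Set (Submodule ℝ (TangentSpace (𝓡 2) x))) (V : Set M) : Prop where
  web : IsWeb W V
  hexagonal : IsHexagonal W V
  geodesic : IsGeodesic g W V

/-! ### The web `du dv (du + dv) = 0` of a chart `e = (u, v)` -/

/-- The directions annihilated by the binary cubic form `du dv (du + dv)`, where `u, v` are the
coordinates of the chart `e`. -/
def chartWeb (e : OpenPartialHomeomorph M Plane) (x : M) :
    Set (Submodule ℝ (TangentSpace (𝓡 2) x)) :=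
  {L | ∃ ξ : TangentSpace (𝓡 2) x, ξ ≠ 0 ∧ L = Submodule.span ℝ {ξ} ∧
    ∃ η : Plane, η = mfderiv (𝓡 2) (𝓡 2) e x ξ ∧ η 0 * η 1 * (η 0 + η 1) = 0}

/-- The cubic polynomial
`(E G - F²)⁻² (G p - F q) (E q - F p) ((G - F) p + (E - F) q)` in the momenta `p, q` conjugate to
the coordinates of the chart `e`, where `E, F, G` are the coefficients of the metric there. -/
def chartCubic (g : Metric M) (e : OpenPartialHomeomorph M Plane) (x : M) (α : Covector x) : ℝ :=
  let E := coordMetric g e (e x) 0 0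
  let F := coordMetric g e (e x) 0 1
  let G := coordMetric g e (e x) 1 1
  let q : Fin 2 → ℝ := fun i =>
    α ((mfderiv (𝓡 2) (𝓡 2) e.symm (e x) (basisVec i) : Plane) : TangentSpace (𝓡 2) x)
  ((E * G - F ^ 2) ^ 2)⁻¹ * (G * q 0 - F * q 1) * (E * q 1 - F * q 0) *
    ((G - F) * q 0 + (E - F) * q 1)

end GeodesicWeb

end

/-! ### The geodesic Hamiltonian, Christoffel symbols and momentum lifts in coordinates -/

open scoped Manifold ContDiff Bundle
noncomputable section
namespace GeodesicWeb

/-! Write momenta as `p = g(ξ, ·)`. A cubic with three distinct real roots then becomes, up to a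
nonzero factor, a product of three pairwise independent 1-forms in `ξ`. Three covectors of a plane
are linearly dependent, so the forms can be rescaled until the third is the sum of the first two.
The expression `det G · (θ₁ ∧ θ₂)⁻² · θ₁ θ₂ (θ₁ + θ₂)` is divided by `c` when both forms are
multiplied by `c`, so the remaining factor can be absorbed as well (`exists_normal_form`). The
quotient `det G / (θ₁ ∧ θ₂)²` does not depend on the coordinates.

Everything rests on one identity, `poissonBracket_normalCubic`. For a cubic in this normal form the
bracket with the Hamiltonian is a quartic form in `ξ`. It consists of three squares, whose
coefficients measure how far the kernels of `θ₁`, `θ₂`, `θ₁ + θ₂` are from being geodesic, and of a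
term `θ₁ θ₂ (θ₁ + θ₂) (dθ₁ · θ₂ - dθ₂ · θ₁)`. Evaluation on each kernel isolates one square, and two
further values isolate the curls. So the cubic is a first integral exactly when both forms are
closed and the three kernels are geodesic; the two directions that are needed are
`curl_eq_zero_of_commutes` and `commutes_of_closed_of_geodesic`.

From an integral to a web: the closed forms are `du` and `dv` for local coordinates `(u, v)`, and
the zero directions form the web `du dv (du + dv) = 0` (`exists_chart_of_isCubicIntegral`). Its
hexagons close because the web functions `u`, `v`, `-(u + v)` sum to zero. Its leaves are geodesic
because the integral vanishes along the momentum lift of a leaf and its roots are simple, which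
forces the covariant acceleration to be proportional to the velocity (`isGeodesic_zeroDirections`).

From a web to an integral: take two web functions as coordinates and call the third `f`. Closing of
all small hexagons around a point gives, by repeated use of Rolle's theorem, a third order condition
(`partialDeriv_eq_of_closing`), which says that `∂₀ ∂₁ log (∂₀ f / ∂₁ f)` vanishes there. Hence `∂₀
f / ∂₁ f` is a function of `y⁰` divided by a function of `y¹`, and integrating these gives
coordinates in which the web is `du dv (du + dv) = 0` (`exists_flat_functions`,
`exists_chartWeb_eq`). The explicit cubic of such a chart is, in every other chart, the normal form
of the closed forms `du` and `dv`, so the identity makes it an integral as soon as the web is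
geodesic (`isCubicIntegral_chartCubic`). -/

theorem plane_eq (v : Plane) : v = v 0 • basisVec 0 + v 1 • basisVec 1 := by
  ext i; fin_cases i <;> simp

theorem clm_apply_plane {F : Type*} [NormedAddCommGroup F] [NormedSpace ℝ F]
    (L : Plane →L[ℝ] F) (v : Plane) : L v = v 0 • L (basisVec 0) + v 1 • L (basisVec 1) := by
  conv_lhs => rw [plane_eq v]
  simp

/-- Lowering the index of a vector with the metric matrix. -/
def lower (G : Plane → Matrix (Fin 2) (Fin 2) ℝ) (y ξ : Plane) : Plane :=
  !₂[G y 0 0 * ξ 0 + G y 0 1 * ξ 1, G y 1 0 * ξ 0 + G y 1 1 * ξ 1]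

@[simp] theorem lower_zero (G : Plane → Matrix (Fin 2) (Fin 2) ℝ) (y ξ : Plane) :
    lower G y ξ 0 = G y 0 0 * ξ 0 + G y 0 1 * ξ 1 := rfl

@[simp] theorem lower_one (G : Plane → Matrix (Fin 2) (Fin 2) ℝ) (y ξ : Plane) :
    lower G y ξ 1 = G y 1 0 * ξ 0 + G y 1 1 * ξ 1 := rfl

/-- The quadratic map `Γᵏᵢⱼ ξⁱ ξʲ`. -/
def christoffelQuad (G : Plane → Matrix (Fin 2) (Fin 2) ℝ) (y ξ : Plane) : Plane :=
  WithLp.toLp 2 fun k => ∑ i, ∑ j, christoffel G k i j y * ξ i * ξ j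

theorem inv_fin_two (A : Matrix (Fin 2) (Fin 2) ℝ) :
    A⁻¹ = !![A.det⁻¹ * A 1 1, -(A.det⁻¹ * A 0 1); -(A.det⁻¹ * A 1 0), A.det⁻¹ * A 0 0] := by
  rw [Matrix.inv_def, Matrix.adjugate_fin_two, Ring.inverse_eq_inv']
  ext i j; fin_cases i <;> fin_cases j <;> simp

theorem hamiltonian_eq (G : Plane → Matrix (Fin 2) (Fin 2) ℝ) (y p : Plane) :
    hamiltonian G y p = (1 / 2) * ((G y).det⁻¹ *
      (G y 1 1 * p 0 ^ 2 - (G y 0 1 + G y 1 0) * (p 0 * p 1) + G y 0 0 * p 1 ^ 2)) := by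
  simp only [hamiltonian, Fin.sum_univ_two, inv_fin_two]
  simp
  ring

section Transport

variable {G : Plane → Matrix (Fin 2) (Fin 2) ℝ} {y : Plane}

theorem hasFDerivAt_hamiltonian_momentum (p : Plane) :
    HasFDerivAt (fun r => hamiltonian G y r) ((1 / 2 : ℝ) • (G y).det⁻¹ •
      ((2 * G y 1 1 * p 0 - (G y 0 1 + G y 1 0) * p 1) • (EuclideanSpace.proj 0 : Plane →L[ℝ] ℝ) +
       (2 * G y 0 0 * p 1 - (G y 0 1 + G y 1 0) * p 0) •
        (EuclideanSpace.proj 1 : Plane →L[ℝ] ℝ))) p := by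
  have h0 : HasFDerivAt (fun r : Plane => r 0) (EuclideanSpace.proj 0 : Plane →L[ℝ] ℝ) p :=
    (EuclideanSpace.proj 0 : Plane →L[ℝ] ℝ).hasFDerivAt
  have h1 : HasFDerivAt (fun r : Plane => r 1) (EuclideanSpace.proj 1 : Plane →L[ℝ] ℝ) p :=
    (EuclideanSpace.proj 1 : Plane →L[ℝ] ℝ).hasFDerivAt
  have := (((((h0.pow 2).const_mul (G y 1 1)).sub
    ((h0.mul h1).const_mul (G y 0 1 + G y 1 0))).add
    ((h1.pow 2).const_mul (G y 0 0))).const_mul ((G y).det⁻¹)).const_mul (1 / 2)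
  simp only [hamiltonian_eq]
  refine (this.congr_fderiv ?_)
  ext v
  simp
  ring

theorem differentiableAt_det (hG : ∀ i j, DifferentiableAt ℝ (fun z => G z i j) y) :
    DifferentiableAt ℝ (fun z => (G z).det) y := by
  simp only [Matrix.det_fin_two]
  exact ((hG 0 0).mul (hG 1 1)).sub ((hG 0 1).mul (hG 1 0))

theorem partialDeriv_det (hG : ∀ i j, DifferentiableAt ℝ (fun z => G z i j) y) (i : Fin 2) :
    partialDeriv (fun z => (G z).det) i y =
      partialDeriv (fun z => G z 0 0) i y * G y 1 1 + G y 0 0 * partialDeriv (fun z => G z 1 1) i y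
      - (partialDeriv (fun z => G z 0 1) i y * G y 1 0
        + G y 0 1 * partialDeriv (fun z => G z 1 0) i y) := by
  simp only [Matrix.det_fin_two, partialDeriv]
  have := (((hG 0 0).hasFDerivAt.mul (hG 1 1).hasFDerivAt).sub
    ((hG 0 1).hasFDerivAt.mul (hG 1 0).hasFDerivAt)).fderiv
  erw [this]
  simp
  ring

/-- The momentum stays fixed while the point moves, so only the inverse matrix is differentiated;
`∂(G⁻¹) = -G⁻¹ (∂G) G⁻¹` turns the quadratic form in the momentum into one in `ξ`. -/
theorem partialDeriv_hamiltonian_position (hG : ∀ i j, DifferentiableAt ℝ (fun z => G z i j) y)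
    (hdet : (G y).det ≠ 0) (hsymm : ∀ z, G z 1 0 = G z 0 1) (ξ : Plane) (i : Fin 2) :
    partialDeriv (fun z => hamiltonian G z (lower G y ξ)) i y =
      -(1 / 2) * (partialDeriv (fun z => G z 0 0) i y * ξ 0 ^ 2
        + 2 * partialDeriv (fun z => G z 0 1) i y * (ξ 0 * ξ 1)
        + partialDeriv (fun z => G z 1 1) i y * ξ 1 ^ 2) := by
  set p := lower G y ξ with hp
  have hd := partialDeriv_det hG i
  have hd' := (hasDerivAt_inv hdet).comp_hasFDerivAt y (differentiableAt_det hG).hasFDerivAt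
  have := (((((hG 1 1).hasFDerivAt.mul_const (p 0 ^ 2)).sub
    (((hG 0 1).hasFDerivAt.add (hG 1 0).hasFDerivAt).mul_const (p 0 * p 1))).add
    ((hG 0 0).hasFDerivAt.mul_const (p 1 ^ 2)))).fun_mul hd' |>.const_mul (1 / 2)
  have h2 : (fun z => hamiltonian G z p) = fun z => (1 / 2) * (
      (G z 1 1 * p 0 ^ 2 - (G z 0 1 + G z 1 0) * (p 0 * p 1) + G z 0 0 * p 1 ^ 2) *
      (G z).det⁻¹) := by
    ext z; rw [hamiltonian_eq]; ring
  have hD : (G y).det = G y 0 0 * G y 1 1 - G y 0 1 ^ 2 := by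
    rw [Matrix.det_fin_two, hsymm]; ring
  simp only [partialDeriv] at hd ⊢
  rw [h2]
  erw [this.fderiv]
  simp only [hsymm] at hd ⊢
  simp [hd, hp, hsymm]
  generalize (G y).det = D at *
  field_simp
  subst hD
  ring

/-- Lowering the index cancels the inverse matrix and leaves the Christoffel symbols of the first
kind. -/
theorem lower_christoffelQuad (hdet : (G y).det ≠ 0) (hsymm : ∀ z, G z 1 0 = G z 0 1) (ξ : Plane) :
    lower G y (christoffelQuad G y ξ) = !₂[
      (1 / 2) * partialDeriv (fun z => G z 0 0) 0 y * ξ 0 ^ 2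
        + partialDeriv (fun z => G z 0 0) 1 y * (ξ 0 * ξ 1)
        + (partialDeriv (fun z => G z 0 1) 1 y - (1 / 2) * partialDeriv (fun z => G z 1 1) 0 y)
          * ξ 1 ^ 2,
      (1 / 2) * partialDeriv (fun z => G z 1 1) 1 y * ξ 1 ^ 2
        + partialDeriv (fun z => G z 1 1) 0 y * (ξ 0 * ξ 1)
        + (partialDeriv (fun z => G z 0 1) 0 y - (1 / 2) * partialDeriv (fun z => G z 0 0) 1 y)
          * ξ 0 ^ 2] := by
  have hD : (G y).det = G y 0 0 * G y 1 1 - G y 0 1 ^ 2 := by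
    rw [Matrix.det_fin_two, hsymm]; ring
  ext i
  fin_cases i <;>
  · simp [lower, christoffelQuad, christoffel, Fin.sum_univ_two, inv_fin_two, hsymm]
    generalize (G y).det = D at *
    field_simp
    subst hD
    ring

theorem hasDerivAt_plane {c : ℝ → Plane} {c' : Plane} {t : ℝ} :
    HasDerivAt c c' t ↔ ∀ i, HasDerivAt (fun s => c s i) (c' i) t := by
  constructor
  · intro h i
    exact (EuclideanSpace.proj i : Plane →L[ℝ] ℝ).hasFDerivAt.comp_hasDerivAt t h
  · intro h
    have h2 : HasDerivAt (fun s => WithLp.ofLp (c s)) (WithLp.ofLp c') t := hasDerivAt_pi.2 h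
    exact ((EuclideanSpace.equiv (Fin 2) ℝ).symm : (Fin 2 → ℝ) →L[ℝ] Plane).hasFDerivAt
      |>.comp_hasDerivAt t h2

/-- Derivative of a function on the cotangent bundle along the momentum lift of a curve. -/
theorem hasDerivAt_comp_lower {I : Plane → Plane → ℝ} {c ξ : ℝ → Plane} {ξ' : Plane} {t : ℝ}
    (hI : DifferentiableAt ℝ (fun z : Plane × Plane => I z.1 z.2) (c t, lower G (c t) (ξ t)))
    (hG : ∀ i j, DifferentiableAt ℝ (fun z => G z i j) (c t))
    (hdet : (G (c t)).det ≠ 0) (hsymm : ∀ z, G z 1 0 = G z 0 1)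
    (hc : HasDerivAt c (ξ t) t) (hξ : HasDerivAt ξ ξ' t) :
    HasDerivAt (fun s => I (c s) (lower G (c s) (ξ s)))
      (poissonBracket I (hamiltonian G) (c t) (lower G (c t) (ξ t)) +
        fderiv ℝ (I (c t)) (lower G (c t) (ξ t))
          (lower G (c t) (ξ' + christoffelQuad G (c t) (ξ t)))) t := by
  set y := c t with hy
  set p := lower G y (ξ t) with hp
  have hGc : ∀ i j, HasDerivAt (fun s => G (c s) i j)
      (ξ t 0 * partialDeriv (fun z => G z i j) 0 y + ξ t 1 * partialDeriv (fun z => G z i j) 1 y)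
      t := by
    intro i j
    have := (hG i j).hasFDerivAt.comp_hasDerivAt t hc
    rw [clm_apply_plane] at this
    exact this
  have hξi := hasDerivAt_plane.1 hξ
  have hp' : HasDerivAt (fun s => lower G (c s) (ξ s))
      (!₂[(ξ t 0 * partialDeriv (fun z => G z 0 0) 0 y
          + ξ t 1 * partialDeriv (fun z => G z 0 0) 1 y) * ξ t 0 + G y 0 0 * ξ' 0
        + ((ξ t 0 * partialDeriv (fun z => G z 0 1) 0 y
          + ξ t 1 * partialDeriv (fun z => G z 0 1) 1 y) * ξ t 1 + G y 0 1 * ξ' 1),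
        (ξ t 0 * partialDeriv (fun z => G z 1 0) 0 y
          + ξ t 1 * partialDeriv (fun z => G z 1 0) 1 y) * ξ t 0 + G y 1 0 * ξ' 0
        + ((ξ t 0 * partialDeriv (fun z => G z 1 1) 0 y
          + ξ t 1 * partialDeriv (fun z => G z 1 1) 1 y) * ξ t 1 + G y 1 1 * ξ' 1)]) t := by
    rw [hasDerivAt_plane]
    intro i
    fin_cases i
    · exact ((hGc 0 0).mul (hξi 0)).add ((hGc 0 1).mul (hξi 1))
    · exact ((hGc 1 0).mul (hξi 0)).add ((hGc 1 1).mul (hξi 1))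
  have hpair := HasDerivAt.prodMk hc hp'
  have hI' := hI.hasFDerivAt
  have key := HasFDerivAt.comp_hasDerivAt t (f := fun s => (c s, lower G (c s) (ξ s))) hI' hpair
  have h1 : HasFDerivAt (fun z => I z p) ((fderiv ℝ (fun z : Plane × Plane => I z.1 z.2) (y, p)).comp
      (ContinuousLinearMap.inl ℝ Plane Plane)) y :=
    HasFDerivAt.comp (f := fun z => (z, p)) y hI' (hasFDerivAt_prodMk_left y p)
  have h2 : HasFDerivAt (I y) ((fderiv ℝ (fun z : Plane × Plane => I z.1 z.2) (y, p)).comp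
      (ContinuousLinearMap.inr ℝ Plane Plane)) p :=
    HasFDerivAt.comp (f := fun r => (y, r)) p hI' (hasFDerivAt_prodMk_right y p)
  have h2' : fderiv ℝ (fun r => I y r) p = (fderiv ℝ (fun z : Plane × Plane => I z.1 z.2) (y, p)).comp
      (ContinuousLinearMap.inr ℝ Plane Plane) := h2.fderiv
  refine key.congr_deriv ?_
  have hHy : ∀ i, partialDeriv (fun z => hamiltonian G z p) i y = _ :=
    partialDeriv_hamiltonian_position (y := y) hG hdet hsymm (ξ t)
  have hHp := (hasFDerivAt_hamiltonian_momentum (G := G) (y := y) p).fderiv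
  have hsum : lower G y (ξ' + christoffelQuad G y (ξ t))
      = lower G y ξ' + lower G y (christoffelQuad G y (ξ t)) := by
    ext i; fin_cases i <;> simp [lower] <;> ring
  rw [hsum, lower_christoffelQuad hdet hsymm]
  simp only [poissonBracket, Fin.sum_univ_two, hHy]
  simp only [partialDeriv, hHp, h1.fderiv, h2']
  set L := fderiv ℝ (fun z : Plane × Plane => I z.1 z.2) (y, p)
  have hsplit : ∀ a b : Plane, L (a, b) = L (a, 0) + L (0, b) := by
    intro a b; rw [← map_add]; simp
  have e1 := clm_apply_plane (L.comp (ContinuousLinearMap.inl ℝ Plane Plane))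
  have e2 := clm_apply_plane (L.comp (ContinuousLinearMap.inr ℝ Plane Plane))
  simp only [ContinuousLinearMap.comp_apply, ContinuousLinearMap.inl_apply,
    ContinuousLinearMap.inr_apply] at e1 e2
  rw [hsplit, e1, e2]
  simp only [ContinuousLinearMap.comp_apply, ContinuousLinearMap.inl_apply,
    ContinuousLinearMap.inr_apply]
  rw [e2 (_ + _)]
  -- Both sides are now linear in the four partial derivatives of `I`, so the claim is an algebraic
  -- identity in these, the entries of `G` and their derivatives.
  generalize L (basisVec 0, 0) = L1
  generalize L (basisVec 1, 0) = L2
  generalize L (0, basisVec 0) = L3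
  generalize L (0, basisVec 1) = L4
  have hD : (G y).det = G y 0 0 * G y 1 1 - G y 0 1 ^ 2 := by
    rw [Matrix.det_fin_two, hsymm]; ring
  simp [hp, hsymm]
  generalize (G y).det = D at *
  field_simp
  subst hD
  ring

end Transport
end GeodesicWeb

/-! ### The Poisson bracket of a cubic in normal form -/

namespace GeodesicWeb

open scoped Topology

/-- The value of `∇θ` on `(ξ, ξ)`. -/
def covDiag (G : Plane → Matrix (Fin 2) (Fin 2) ℝ) (θ : Plane → Plane →L[ℝ] ℝ) (y ξ : Plane) : ℝ :=
  fderiv ℝ θ y ξ ξ - θ y (christoffelQuad G y ξ)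

/-- The coefficient of `α ∧ β` with respect to `dy⁰ ∧ dy¹`. -/
def wedge (α β : Plane →L[ℝ] ℝ) : ℝ :=
  α (basisVec 0) * β (basisVec 1) - α (basisVec 1) * β (basisVec 0)

/-- The coefficient of `dθ` with respect to `dy⁰ ∧ dy¹`. -/
def curl (θ : Plane → Plane →L[ℝ] ℝ) (y : Plane) : ℝ :=
  fderiv ℝ θ y (basisVec 0) (basisVec 1) - fderiv ℝ θ y (basisVec 1) (basisVec 0)

/-- The vector spanning the kernel of the covector `α`. -/
def kerVec (α : Plane →L[ℝ] ℝ) : Plane := !₂[-α (basisVec 1), α (basisVec 0)]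

theorem apply_kerVec (α β : Plane →L[ℝ] ℝ) : β (kerVec α) = wedge α β := by
  rw [clm_apply_plane β]; simp [kerVec, wedge]; ring

theorem apply_kerVec_self (α : Plane →L[ℝ] ℝ) : α (kerVec α) = 0 := by
  rw [apply_kerVec, wedge]; ring

variable {G : Plane → Matrix (Fin 2) (Fin 2) ℝ} {y : Plane}

theorem christoffel_swap (hsymm : ∀ z, G z 1 0 = G z 0 1) (k : Fin 2) :
    christoffel G k 1 0 y = christoffel G k 0 1 y := by
  simp only [christoffel, Fin.sum_univ_two, hsymm]
  ring

/-- The classical formula `∂ᵢ log √det G = Γᵏₖᵢ`; it makes the factor `det G` in the normal form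
differentiable in terms of Christoffel symbols alone. -/
theorem deriv_det_eq (hG : ∀ i j, DifferentiableAt ℝ (fun z => G z i j) y)
    (hdet : (G y).det ≠ 0) (hsymm : ∀ z, G z 1 0 = G z 0 1) (i : Fin 2) :
    partialDeriv (fun z => (G z).det) i y =
      2 * (G y).det * (christoffel G 0 0 i y + christoffel G 1 1 i y) := by
  have hD : (G y).det = G y 0 0 * G y 1 1 - G y 0 1 ^ 2 := by
    rw [Matrix.det_fin_two, hsymm]; ring
  rw [partialDeriv_det hG]
  fin_cases i <;>
  · simp [christoffel, Fin.sum_univ_two, inv_fin_two, hsymm]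
    generalize (G y).det = D at *
    field_simp
    ring

/-- The function on tangent vectors `det G · (α ∧ β)⁻² · α β (α + β)`. -/
def normalCubic (D : ℝ) (α β : Plane →L[ℝ] ℝ) (ξ : Plane) : ℝ :=
  D / wedge α β ^ 2 * (α ξ * β ξ * (α ξ + β ξ))

/-- The bracket is the derivative of the cubic along the geodesic flow. Each form contributes `∇θ(ξ,
ξ)`, and the prefactor contributes the derivatives of `det G` and of the wedge. Sorting the result
by the products of the three forms leaves their values on the kernels and the two curls. This
identity serves both directions of the theorem. -/
theorem poissonBracket_normalCubic {I : Plane → Plane → ℝ} {θ₁ θ₂ : Plane → Plane →L[ℝ] ℝ}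
    (hG : ∀ i j, DifferentiableAt ℝ (fun z => G z i j) y)
    (hdet : (G y).det ≠ 0) (hsymm : ∀ z, G z 1 0 = G z 0 1)
    (h₁ : DifferentiableAt ℝ θ₁ y) (h₂ : DifferentiableAt ℝ θ₂ y)
    (hw : wedge (θ₁ y) (θ₂ y) ≠ 0)
    (hI : ∀ᶠ z in 𝓝 y, ∀ ξ, I z (lower G z ξ) = normalCubic (G z).det (θ₁ z) (θ₂ z) ξ)
    (ξ : Plane)
    (hId : DifferentiableAt ℝ (fun z : Plane × Plane => I z.1 z.2) (y, lower G y ξ)) :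
    poissonBracket I (hamiltonian G) y (lower G y ξ) * wedge (θ₁ y) (θ₂ y) ^ 4 =
      (G y).det * (covDiag G θ₁ y (kerVec (θ₁ y)) * (θ₂ y ξ * (θ₁ y ξ + θ₂ y ξ)) ^ 2
        + covDiag G θ₂ y (kerVec (θ₂ y)) * (θ₁ y ξ * (θ₁ y ξ + θ₂ y ξ)) ^ 2
        - covDiag G (θ₁ + θ₂) y (kerVec (θ₁ y + θ₂ y)) * (θ₁ y ξ * θ₂ y ξ) ^ 2
        + wedge (θ₁ y) (θ₂ y) * (θ₁ y ξ * θ₂ y ξ * (θ₁ y ξ + θ₂ y ξ))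
          * (curl θ₁ y * θ₂ y ξ - curl θ₂ y * θ₁ y ξ)) := by
  set Γ := christoffelQuad G y ξ with hΓ
  have hc : HasDerivAt (fun s : ℝ => y + s • ξ) ξ 0 := by
    simpa using ((hasDerivAt_id (0 : ℝ)).smul_const ξ).const_add y
  have hζ : HasDerivAt (fun s : ℝ => ξ - s • Γ) (-Γ) 0 := by
    simpa using ((hasDerivAt_id (0 : ℝ)).smul_const Γ).const_sub ξ
  -- The test velocity `ξ - s Γ` along the line `y + s ξ` has zero covariant derivative at `s = 0`,
  -- so the fibre derivative in `hasDerivAt_comp_lower` drops out and only the bracket remains. No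
  -- solution of the geodesic equation is needed.
  have hlhs := hasDerivAt_comp_lower (G := G) (I := I) (c := fun s : ℝ => y + s • ξ)
    (ξ := fun s : ℝ => ξ - s • Γ) (t := 0) (ξ' := -Γ)
    (by simpa using hId) (by simpa using hG) (by simpa using hdet) hsymm (by simpa using hc) hζ
  have hzero : lower G y (0 : Plane) = 0 := by ext i; fin_cases i <;> simp [lower]
  simp only [zero_smul, add_zero, sub_zero, ← hΓ, neg_add_cancel, hzero, map_zero] at hlhs
  have hy0 : y + (0 : ℝ) • ξ = y := by simp
  have along : ∀ f : Plane → ℝ, DifferentiableAt ℝ f y →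
      HasDerivAt (fun s : ℝ => f (y + s • ξ)) (ξ 0 * partialDeriv f 0 y + ξ 1 * partialDeriv f 1 y)
        0 := by
    intro f hf
    rw [← hy0] at hf
    have := hf.hasFDerivAt.comp_hasDerivAt (0 : ℝ) hc
    rw [hy0, clm_apply_plane] at this
    exact this
  have hform : ∀ θ : Plane → Plane →L[ℝ] ℝ, DifferentiableAt ℝ θ y →
      HasDerivAt (fun s : ℝ => θ (y + s • ξ)) (fderiv ℝ θ y ξ) 0 := by
    intro θ hθ
    rw [← hy0] at hθ
    have := hθ.hasFDerivAt.comp_hasDerivAt (0 : ℝ) hc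
    rw [hy0] at this
    exact this
  have hpair : ∀ θ : Plane → Plane →L[ℝ] ℝ, DifferentiableAt ℝ θ y →
      HasDerivAt (fun s : ℝ => θ (y + s • ξ) (ξ - s • Γ)) (covDiag G θ y ξ) 0 := by
    intro θ hθ
    refine ((hform θ hθ).clm_apply hζ).congr_deriv ?_
    simp [covDiag, ← hΓ]
    ring
  have hbasis : ∀ θ : Plane → Plane →L[ℝ] ℝ, DifferentiableAt ℝ θ y → ∀ i,
      HasDerivAt (fun s : ℝ => θ (y + s • ξ) (basisVec i)) (fderiv ℝ θ y ξ (basisVec i)) 0 := by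
    intro θ hθ i
    simpa using (hform θ hθ).clm_apply (hasDerivAt_const (0 : ℝ) (basisVec i))
  have hW : HasDerivAt (fun s : ℝ => wedge (θ₁ (y + s • ξ)) (θ₂ (y + s • ξ))) _ 0 :=
    ((hbasis θ₁ h₁ 0).mul (hbasis θ₂ h₂ 1)).sub ((hbasis θ₁ h₁ 1).mul (hbasis θ₂ h₂ 0))
  have hK := (along _ (differentiableAt_det hG)).div (hW.pow 2) (by simpa using pow_ne_zero 2 hw)
  have hrhs := hK.mul (((hpair θ₁ h₁).mul (hpair θ₂ h₂)).mul ((hpair θ₁ h₁).add (hpair θ₂ h₂)))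
  have hev : (fun s : ℝ => I (y + s • ξ) (lower G (y + s • ξ) (ξ - s • Γ))) =ᶠ[𝓝 0] fun s : ℝ =>
      normalCubic (G (y + s • ξ)).det (θ₁ (y + s • ξ)) (θ₂ (y + s • ξ)) (ξ - s • Γ) := by
    have : Filter.Tendsto (fun s : ℝ => y + s • ξ) (𝓝 0) (𝓝 y) := by
      simpa using hc.continuousAt.tendsto
    filter_upwards [this.eventually hI] with s hs using hs _
  have huniq := (hlhs.congr_of_eventuallyEq hev.symm).unique hrhs
  rw [huniq]
  -- The quotient rule applied to `det G / wedge²` produces `wedge⁴` in the denominator, which is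
  -- the power in the statement.
  have clear : ∀ d W' q q' : ℝ, ((d * wedge (θ₁ y) (θ₂ y) ^ 2 - (G y).det * W') /
      (wedge (θ₁ y) (θ₂ y) ^ 2) ^ 2 * q + (G y).det / wedge (θ₁ y) (θ₂ y) ^ 2 * q') *
      wedge (θ₁ y) (θ₂ y) ^ 4 = (d * wedge (θ₁ y) (θ₂ y) ^ 2 - (G y).det * W') * q
        + (G y).det * wedge (θ₁ y) (θ₂ y) ^ 2 * q' := by
    intro d W' q q'
    field_simp
  have hadd : fderiv ℝ (θ₁ + θ₂) y = fderiv ℝ θ₁ y + fderiv ℝ θ₂ y := fderiv_add h₁ h₂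
  have expand : ∀ (L : Plane →L[ℝ] Plane →L[ℝ] ℝ) (a b : Plane), L a b =
      a 0 * (b 0 * L (basisVec 0) (basisVec 0) + b 1 * L (basisVec 0) (basisVec 1)) +
      a 1 * (b 0 * L (basisVec 1) (basisVec 0) + b 1 * L (basisVec 1) (basisVec 1)) := by
    intro L a b
    rw [clm_apply_plane L a, add_apply, smul_apply,
      smul_apply, clm_apply_plane (L (basisVec 0)) b,
      clm_apply_plane (L (basisVec 1)) b]
    simp
  have expand1 : ∀ (L : Plane →L[ℝ] ℝ) (a : Plane),
      L a = a 0 * L (basisVec 0) + a 1 * L (basisVec 1) := fun L a => clm_apply_plane L a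
  simp only [deriv_det_eq hG hdet hsymm, zero_smul, add_zero, sub_zero, Pi.mul_apply, Pi.pow_apply,
    Pi.div_apply, Pi.add_apply, covDiag, hadd, curl]
  rw [clear]
  rw [wedge] at hw ⊢
  rw [expand (fderiv ℝ θ₁ y) ξ ξ, expand (fderiv ℝ θ₂ y) ξ ξ,
    expand (fderiv ℝ θ₁ y) ξ (basisVec 0), expand (fderiv ℝ θ₂ y) ξ (basisVec 0),
    expand (fderiv ℝ θ₁ y) ξ (basisVec 1), expand (fderiv ℝ θ₂ y) ξ (basisVec 1),
    expand (fderiv ℝ θ₁ y) (kerVec _) (kerVec _), expand (fderiv ℝ θ₂ y) (kerVec _) (kerVec _),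
    expand (fderiv ℝ θ₁ y + fderiv ℝ θ₂ y) (kerVec _) (kerVec _),
    expand1 _ (christoffelQuad G y (kerVec (θ₁ y))), expand1 _ (christoffelQuad G y (kerVec (θ₂ y))),
    expand1 _ (christoffelQuad G y (kerVec (θ₁ y + θ₂ y))), expand1 (θ₁ y) Γ, expand1 (θ₂ y) Γ,
    expand1 (θ₁ y) ξ, expand1 (θ₂ y) ξ]
  simp only [hΓ, christoffelQuad, kerVec, Fin.sum_univ_two, christoffel_swap hsymm,
    add_apply, PiLp.toLp_apply, Matrix.cons_val_zero, Matrix.cons_val_one,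
    PiLp.single_apply]
  simp only [Fin.isValue, if_true, one_ne_zero, zero_ne_one, if_false]
  -- From here on the Christoffel symbols, the coefficients of the forms and their first derivatives
  -- are independent variables of a polynomial identity.
  generalize (G y).det = D at *
  generalize christoffel G 0 0 0 y = g1
  generalize christoffel G 0 0 1 y = g2
  generalize christoffel G 0 1 1 y = g3
  generalize christoffel G 1 0 0 y = g4
  generalize christoffel G 1 0 1 y = g5
  generalize christoffel G 1 1 1 y = g6
  generalize θ₁ y (basisVec 0) = a0 at *
  generalize θ₁ y (basisVec 1) = a1 at *
  generalize θ₂ y (basisVec 0) = b0 at *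
  generalize θ₂ y (basisVec 1) = b1 at *
  generalize fderiv ℝ θ₁ y (basisVec 0) (basisVec 0) = a00
  generalize fderiv ℝ θ₁ y (basisVec 0) (basisVec 1) = a01
  generalize fderiv ℝ θ₁ y (basisVec 1) (basisVec 0) = a10
  generalize fderiv ℝ θ₁ y (basisVec 1) (basisVec 1) = a11
  generalize fderiv ℝ θ₂ y (basisVec 0) (basisVec 0) = b00
  generalize fderiv ℝ θ₂ y (basisVec 0) (basisVec 1) = b01
  generalize fderiv ℝ θ₂ y (basisVec 1) (basisVec 0) = b10
  generalize fderiv ℝ θ₂ y (basisVec 1) (basisVec 1) = b11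
  generalize ξ 0 = x0
  generalize ξ 1 = x1
  clear * - hw
  push_cast
  ring

end GeodesicWeb

/-! ### Consequences of the bracket identity, primitives, smooth roots and binary cubics -/

namespace GeodesicWeb

open scoped Topology

section Commuting

variable {G : Plane → Matrix (Fin 2) (Fin 2) ℝ} {y : Plane}

theorem exists_lower_eq (hdet : (G y).det ≠ 0) (p : Plane) : ∃ ξ, lower G y ξ = p := by
  refine ⟨!₂[(G y 1 1 * p 0 - G y 0 1 * p 1) / (G y).det,
    (G y 0 0 * p 1 - G y 1 0 * p 0) / (G y).det], ?_⟩
  have hD : (G y).det = G y 0 0 * G y 1 1 - G y 0 1 * G y 1 0 := Matrix.det_fin_two _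
  generalize (G y).det = D at *
  ext i
  fin_cases i <;> simp [lower] <;> field_simp <;> rw [hD] <;> ring

theorem wedge_self (α : Plane →L[ℝ] ℝ) : wedge α α = 0 := by rw [wedge]; ring

theorem wedge_comm (α β : Plane →L[ℝ] ℝ) : wedge α β = -wedge β α := by simp only [wedge]; ring

/-- A cubic first integral in normal form is given by closed forms. -/
theorem curl_eq_zero_of_commutes {I : Plane → Plane → ℝ} {θ₁ θ₂ : Plane → Plane →L[ℝ] ℝ}
    (hG : ∀ i j, DifferentiableAt ℝ (fun z => G z i j) y)
    (hdet : (G y).det ≠ 0) (hsymm : ∀ z, G z 1 0 = G z 0 1)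
    (h₁ : DifferentiableAt ℝ θ₁ y) (h₂ : DifferentiableAt ℝ θ₂ y)
    (hw : wedge (θ₁ y) (θ₂ y) ≠ 0)
    (hI : ∀ᶠ z in 𝓝 y, ∀ ξ, I z (lower G z ξ) = normalCubic (G z).det (θ₁ z) (θ₂ z) ξ)
    (hId : ∀ p, DifferentiableAt ℝ (fun z : Plane × Plane => I z.1 z.2) (y, p))
    (hcomm : ∀ p, poissonBracket I (hamiltonian G) y p = 0) :
    curl θ₁ y = 0 ∧ curl θ₂ y = 0 := by
  have key := fun ξ => poissonBracket_normalCubic hG hdet hsymm h₁ h₂ hw hI ξ (hId _)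
  simp only [hcomm, zero_mul] at key
  generalize covDiag G θ₁ y (kerVec (θ₁ y)) = n₁ at key
  generalize covDiag G θ₂ y (kerVec (θ₂ y)) = n₂ at key
  generalize covDiag G (θ₁ + θ₂) y (kerVec (θ₁ y + θ₂ y)) = n₃ at key
  set W := wedge (θ₁ y) (θ₂ y) with hW
  have hW' : wedge (θ₂ y) (θ₁ y) = -W := wedge_comm _ _
  -- The two forms are a coframe at `y`, so `ξ` can be chosen with prescribed values `s` and `t`;
  -- its expansion in the kernel vectors is explicit.
  have k : ∀ s t : ℝ, n₁ * (t * (s + t)) ^ 2 + n₂ * (s * (s + t)) ^ 2 - n₃ * (s * t) ^ 2 +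
      W * (s * t * (s + t)) * (curl θ₁ y * t - curl θ₂ y * s) = 0 := by
    intro s t
    have := key (-(s / W) • kerVec (θ₂ y) + (t / W) • kerVec (θ₁ y))
    simp only [map_add, map_smul, apply_kerVec, ← hW, hW', wedge_self, smul_eq_mul] at this
    have e1 : -(s / W) * -W + t / W * 0 = s := by field_simp; ring
    have e2 : -(s / W) * 0 + t / W * W = t := by field_simp; ring
    rw [e1, e2] at this
    exact (mul_eq_zero.1 this.symm).resolve_left hdet
  -- The points `(0, 1)`, `(1, 0)`, `(1, -1)` lie on the three kernels and give the vanishing of one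
  -- defect each. The points `(1, 1)` and `(2, 1)` then give two independent equations for the
  -- curls.
  have k1 := k 0 1
  have k2 := k 1 0
  have k3 := k 1 (-1)
  have k4 := k 1 1
  have k5 := k 2 1
  have hn1 : n₁ = 0 := by linarith
  have hn2 : n₂ = 0 := by linarith
  have hn3 : n₃ = 0 := by linarith
  subst hn1 hn2 hn3
  have a1 : W * (curl θ₁ y - curl θ₂ y) = 0 := by linarith
  have a2 : W * (curl θ₁ y - 2 * curl θ₂ y) = 0 := by linarith
  have b1 := (mul_eq_zero.1 a1).resolve_left hw
  have b2 := (mul_eq_zero.1 a2).resolve_left hw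
  constructor <;> linarith

/-- Closed forms whose kernels are geodesic give a commuting function in normal form. -/
theorem commutes_of_closed_of_geodesic {I : Plane → Plane → ℝ} {θ₁ θ₂ : Plane → Plane →L[ℝ] ℝ}
    (hG : ∀ i j, DifferentiableAt ℝ (fun z => G z i j) y)
    (hdet : (G y).det ≠ 0) (hsymm : ∀ z, G z 1 0 = G z 0 1)
    (h₁ : DifferentiableAt ℝ θ₁ y) (h₂ : DifferentiableAt ℝ θ₂ y)
    (hw : wedge (θ₁ y) (θ₂ y) ≠ 0)
    (hI : ∀ᶠ z in 𝓝 y, ∀ ξ, I z (lower G z ξ) = normalCubic (G z).det (θ₁ z) (θ₂ z) ξ)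
    (hId : ∀ p, DifferentiableAt ℝ (fun z : Plane × Plane => I z.1 z.2) (y, p))
    (hc₁ : curl θ₁ y = 0) (hc₂ : curl θ₂ y = 0)
    (hn₁ : covDiag G θ₁ y (kerVec (θ₁ y)) = 0) (hn₂ : covDiag G θ₂ y (kerVec (θ₂ y)) = 0)
    (hn₃ : covDiag G (θ₁ + θ₂) y (kerVec (θ₁ y + θ₂ y)) = 0) (p : Plane) :
    poissonBracket I (hamiltonian G) y p = 0 := by
  obtain ⟨ξ, rfl⟩ := exists_lower_eq hdet p
  have key := poissonBracket_normalCubic hG hdet hsymm h₁ h₂ hw hI ξ (hId _)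
  rw [hc₁, hc₂, hn₁, hn₂, hn₃] at key
  simp only [zero_mul, sub_zero, add_zero, mul_zero] at key
  exact (mul_eq_zero.1 key).resolve_right (pow_ne_zero 4 hw)

end Commuting

/-- The Poincaré lemma for smooth 1-forms on a disc. -/
theorem exists_primitive {θ : Plane → Plane →L[ℝ] ℝ} {y₀ : Plane} {r : ℝ}
    (hθ : ContDiffOn ℝ ∞ θ (Metric.ball y₀ r)) (hc : ∀ y ∈ Metric.ball y₀ r, curl θ y = 0) :
    ∃ f : Plane → ℝ, ContDiffOn ℝ ∞ f (Metric.ball y₀ r) ∧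
      ∀ y ∈ Metric.ball y₀ r, HasFDerivAt f (θ y) y := by
  obtain ⟨f, hf⟩ := (convex_ball y₀ r).exists_forall_hasFDerivAt_of_fderiv_symmetric
    Metric.isOpen_ball (hθ.differentiableOn (by simp)) (fun a ha v w => by
      have h := hc a ha
      rw [curl] at h
      rw [clm_apply_plane (fderiv ℝ θ a) v, clm_apply_plane (fderiv ℝ θ a) w]
      simp only [add_apply, smul_apply, smul_eq_mul]
      rw [clm_apply_plane (fderiv ℝ θ a (basisVec 0)) v,
        clm_apply_plane (fderiv ℝ θ a (basisVec 1)) v,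
        clm_apply_plane (fderiv ℝ θ a (basisVec 0)) w,
        clm_apply_plane (fderiv ℝ θ a (basisVec 1)) w]
      simp only [smul_eq_mul]
      linear_combination (v 0 * w 1 - v 1 * w 0) * h)
  refine ⟨f, ?_, hf⟩
  have h1 : ContDiffOn ℝ (∞ + 1) f (Metric.ball y₀ r) := by
    rw [contDiffOn_succ_iff_fderiv_of_isOpen Metric.isOpen_ball]
    refine ⟨fun y hy => (hf y hy).differentiableAt.differentiableWithinAt, by simp, ?_⟩
    exact hθ.congr fun y hy => (hf y hy).fderiv
  simpa using h1

/-- Smooth implicit function theorem for a simple zero of a function of one variable depending on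
parameters. -/
theorem exists_smooth_root {E : Type*} [NormedAddCommGroup E] [NormedSpace ℝ E] [CompleteSpace E]
    {F : E × ℝ → ℝ} {Ω : Set (E × ℝ)} (hΩ : IsOpen Ω)
    (hF : ContDiffOn ℝ ∞ F Ω) {y₀ : E} {t₀ d : ℝ} (h₀ : (y₀, t₀) ∈ Ω) (hz : F (y₀, t₀) = 0)
    (hd : HasDerivAt (fun t => F (y₀, t)) d t₀) (hd0 : d ≠ 0) :
    ∃ (U : Set E) (ρ : E → ℝ), IsOpen U ∧ y₀ ∈ U ∧ ContDiffOn ℝ ∞ ρ U ∧ ρ y₀ = t₀ ∧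
      ∀ y ∈ U, F (y, ρ y) = 0 := by
  have hinf : (∞ : WithTop ℕ∞) ≠ 0 := by simp
  have hFat : ∀ u ∈ Ω, ContDiffAt ℝ ∞ F u := fun u hu => hF.contDiffAt (hΩ.mem_nhds hu)
  have hinv : ∀ u : E × ℝ, fderiv ℝ F u (0, 1) ≠ 0 →
      (fderiv ℝ F u ∘L .inr ℝ E ℝ).IsInvertible := by
    intro u hu
    refine ⟨ContinuousLinearEquiv.unitsEquivAut ℝ (Units.mk0 _ hu), ?_⟩
    ext
    simp
  have hder : fderiv ℝ F (y₀, t₀) (0, 1) = d := by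
    have h1 := ((hFat _ h₀).differentiableAt hinf).hasFDerivAt
    have h2 : HasDerivAt (fun t : ℝ => ((y₀, t) : E × ℝ)) (0, 1) t₀ :=
      (hasDerivAt_const t₀ y₀).prodMk (hasDerivAt_id t₀)
    exact (HasFDerivAt.comp_hasDerivAt t₀ h1 h2).unique hd
  have hopen : IsOpen {u ∈ Ω | fderiv ℝ F u (0, 1) ≠ 0} := by
    have hc : ContinuousOn (fun u => fderiv ℝ F u (0, 1)) Ω :=
      (hF.continuousOn_fderiv_of_isOpen hΩ (by simp)).clm_apply continuousOn_const
    exact hc.isOpen_inter_preimage hΩ isOpen_ne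
  have hu₀ : (y₀, t₀) ∈ {u ∈ Ω | fderiv ℝ F u (0, 1) ≠ 0} := ⟨h₀, by rw [hder]; exact hd0⟩
  have inv₀ := hinv _ hu₀.2
  set ρ := (hFat _ h₀).implicitFunction hinf inv₀ with hρ
  have hρ₀ : ρ y₀ = t₀ := (hFat _ h₀).implicitFunction_apply_self hinf inv₀
  have hρs : ContDiffAt ℝ ∞ ρ y₀ := (hFat _ h₀).contDiffAt_implicitFunction hinf inv₀
  have hρc : ∀ᶠ y in 𝓝 y₀, ContinuousAt ρ y := by
    have h1 : ContDiffAt ℝ 1 ρ y₀ := hρs.of_le (by simp)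
    exact (h1.eventually (by simp)).mono fun y hy => hy.continuousAt
  have hρF : ∀ᶠ y in 𝓝 y₀, F (y, ρ y) = F (y₀, t₀) :=
    (hFat _ h₀).eventually_apply_implicitFunction hinf inv₀
  have hmem : ∀ᶠ y in 𝓝 y₀, (y, ρ y) ∈ {u ∈ Ω | fderiv ℝ F u (0, 1) ≠ 0} := by
    have hcont : ContinuousAt (fun y => (y, ρ y)) y₀ := continuousAt_id.prodMk hρs.continuousAt
    refine hcont.eventually_mem (hopen.mem_nhds ?_)
    rw [hρ₀]; exact hu₀
  obtain ⟨U, hU, hUo, hyU⟩ := eventually_nhds_iff.1 (hρc.and (hρF.and hmem))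
  refine ⟨U, ρ, hUo, hyU, fun y hy => ContDiffAt.contDiffWithinAt ?_, hρ₀,
    fun y hy => (hU y hy).2.1.trans hz⟩
  have hyΩ := (hU y hy).2.2.1
  have invy := hinv _ (hU y hy).2.2.2
  -- Infinite differentiability of `ρ` at `y₀` alone gives no common neighbourhood for all orders.
  -- At each nearby point `ρ` is therefore compared, by local uniqueness, with the implicit function
  -- based at that point.
  have hs := (hFat _ hyΩ).contDiffAt_implicitFunction hinf invy
  refine hs.congr_of_eventuallyEq ?_
  have hcont : ContinuousAt (fun z => (z, ρ z)) y := continuousAt_id.prodMk (hU y hy).1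
  have hev := hcont.eventually ((hFat _ hyΩ).eventually_apply_eq_iff_implicitFunction hinf invy)
  filter_upwards [hev, hUo.mem_nhds hy] with z hz hzU
  exact (hz.1 ((hU z hzU).2.1.trans (hU y hy).2.1.symm)).symm

section Cubic

/-- The binary cubic form with coefficients `a`. -/
def cubicForm (a : Fin 4 → ℝ) (p : Plane) : ℝ :=
  ∑ k : Fin 4, a k * p 0 ^ (3 - (k : ℕ)) * p 1 ^ (k : ℕ)

theorem cubicForm_eq (a : Fin 4 → ℝ) (p : Plane) :
    cubicForm a p = a 0 * p 0 ^ 3 + a 1 * p 0 ^ 2 * p 1 + a 2 * p 0 * p 1 ^ 2 + a 3 * p 1 ^ 3 := by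
  simp [cubicForm, Fin.sum_univ_four]

/-- The determinant of two vectors of the plane. -/
def cross (p q : Plane) : ℝ := p 0 * q 1 - p 1 * q 0

/-- A binary cubic form is determined by three roots and one further value. -/
theorem cubicForm_factor {a : Fin 4 → ℝ} {α β γ : Plane} (hα : cubicForm a α = 0)
    (hβ : cubicForm a β = 0) (hγ : cubicForm a γ = 0) (hαβ : cross α β ≠ 0) (hβγ : cross β γ ≠ 0)
    (hαγ : cross α γ ≠ 0) (m p : Plane) :
    cubicForm a p * (cross m α * cross m β * cross m γ) =
      cubicForm a m * (cross p α * cross p β * cross p γ) := by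
  have h : (cubicForm a p * (cross m α * cross m β * cross m γ) -
      cubicForm a m * (cross p α * cross p β * cross p γ)) *
        (cross α β * cross α γ * cross β γ) = 0 := by
    rw [cubicForm_eq] at *
    rw [cubicForm_eq] at *
    simp only [cross]
    -- Binary cubics form a space of dimension four, so the values at `p`, `m`, `α`, `β`, `γ`
    -- satisfy a linear relation. The coefficient of each value is, up to sign, the product of the
    -- determinants of all pairs among the other four points.
    linear_combination
      (-(p 0 * β 1 - p 1 * β 0) * (p 0 * γ 1 - p 1 * γ 0) * (p 0 * m 1 - p 1 * m 0)
        * (m 0 * β 1 - m 1 * β 0) * (m 0 * γ 1 - m 1 * γ 0) * (β 0 * γ 1 - β 1 * γ 0)) * hα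
      + ((p 0 * α 1 - p 1 * α 0) * (p 0 * γ 1 - p 1 * γ 0) * (p 0 * m 1 - p 1 * m 0)
        * (m 0 * α 1 - m 1 * α 0) * (m 0 * γ 1 - m 1 * γ 0) * (α 0 * γ 1 - α 1 * γ 0)) * hβ
      - ((p 0 * α 1 - p 1 * α 0) * (p 0 * β 1 - p 1 * β 0) * (p 0 * m 1 - p 1 * m 0)
        * (m 0 * α 1 - m 1 * α 0) * (m 0 * β 1 - m 1 * β 0) * (α 0 * β 1 - α 1 * β 0)) * hγ
  have h2 := (mul_eq_zero.1 h).resolve_right (mul_ne_zero (mul_ne_zero hαβ hαγ) hβγ)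
  linarith

end Cubic

end GeodesicWeb

/-! ### Closing hexagons and a third order condition -/

namespace GeodesicWeb

open scoped Topology

section PartialDerivatives

variable {f : Plane → ℝ} {Ω : Set Plane}

theorem contDiffOn_partialDeriv (hΩ : IsOpen Ω) (hf : ContDiffOn ℝ ∞ f Ω) (i : Fin 2) :
    ContDiffOn ℝ ∞ (partialDeriv f i) Ω :=
  (hf.fderiv_of_isOpen hΩ (by simp)).clm_apply contDiffOn_const

theorem differentiableAt_of_contDiffOn {E F : Type*} [NormedAddCommGroup E] [NormedSpace ℝ E]
    [NormedAddCommGroup F] [NormedSpace ℝ F] {f : E → F} {Ω : Set E} (hΩ : IsOpen Ω)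
    (hf : ContDiffOn ℝ ∞ f Ω) {y : E} (hy : y ∈ Ω) : DifferentiableAt ℝ f y :=
  (hf.contDiffAt (hΩ.mem_nhds hy)).differentiableAt (by simp)

theorem partialDeriv_partialDeriv (hΩ : IsOpen Ω) (hf : ContDiffOn ℝ ∞ f Ω) {y : Plane}
    (hy : y ∈ Ω) (i j : Fin 2) :
    partialDeriv (partialDeriv f i) j y = fderiv ℝ (fderiv ℝ f) y (basisVec j) (basisVec i) := by
  have h1 : DifferentiableAt ℝ (fderiv ℝ f) y :=
    differentiableAt_of_contDiffOn hΩ (hf.fderiv_of_isOpen hΩ (by simp)) hy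
  have h2 := (h1.hasFDerivAt.clm_apply (hasFDerivAt_const (basisVec i) y)).fderiv
  change fderiv ℝ (fun z => fderiv ℝ f z (basisVec i)) y (basisVec j) = _
  rw [h2]
  simp

theorem partialDeriv_comm (hΩ : IsOpen Ω) (hf : ContDiffOn ℝ ∞ f Ω) {y : Plane}
    (hy : y ∈ Ω) (i j : Fin 2) :
    partialDeriv (partialDeriv f i) j y = partialDeriv (partialDeriv f j) i y := by
  rw [partialDeriv_partialDeriv hΩ hf hy, partialDeriv_partialDeriv hΩ hf hy]
  exact (hf.contDiffAt (hΩ.mem_nhds hy)).isSymmSndFDerivAt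
    (by rw [minSmoothness_of_isRCLikeNormedField]; exact WithTop.coe_le_coe.2 (le_top (a := (2 : ℕ∞)))) _ _

theorem hasDerivAt_comp_pair {a b : ℝ → ℝ} {a' b' t : ℝ}
    (hf : DifferentiableAt ℝ f !₂[a t, b t]) (ha : HasDerivAt a a' t) (hb : HasDerivAt b b' t) :
    HasDerivAt (fun s => f !₂[a s, b s])
      (a' * partialDeriv f 0 !₂[a t, b t] + b' * partialDeriv f 1 !₂[a t, b t]) t := by
  have h : HasDerivAt (fun s => (!₂[a s, b s] : Plane)) !₂[a', b'] t := by
    rw [hasDerivAt_plane]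
    intro i
    fin_cases i
    · exact ha
    · exact hb
  have h2 := hf.hasFDerivAt.comp_hasDerivAt t h
  rw [clm_apply_plane] at h2
  exact h2

theorem hasDerivAt_fst {s t : ℝ} (hf : DifferentiableAt ℝ f !₂[s, t]) :
    HasDerivAt (fun s => f !₂[s, t]) (partialDeriv f 0 !₂[s, t]) s := by
  simpa using hasDerivAt_comp_pair (a := id) (b := fun _ => t) hf (hasDerivAt_id s)
    (hasDerivAt_const s t)

theorem hasDerivAt_snd {s t : ℝ} (hf : DifferentiableAt ℝ f !₂[s, t]) :
    HasDerivAt (fun t => f !₂[s, t]) (partialDeriv f 1 !₂[s, t]) t := by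
  simpa using hasDerivAt_comp_pair (a := fun _ => s) (b := id) hf (hasDerivAt_const t s)
    (hasDerivAt_id t)

theorem pair_eta (y : Plane) : !₂[y 0, y 1] = y := by
  ext i; fin_cases i <;> rfl

theorem pair_zero : (!₂[0, 0] : Plane) = 0 := by
  ext i; fin_cases i <;> rfl

/-- Product neighbourhoods let the two coordinates vary independently, as is needed for one-variable
arguments along leaves. -/
theorem exists_box {P : Plane → Prop} {y : Plane} (h : ∀ᶠ z in 𝓝 y, P z) :
    ∃ r > 0, ∀ s t : ℝ, |s - y 0| < r → |t - y 1| < r → P !₂[s, t] := by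
  have hc : ContinuousAt (fun z : ℝ × ℝ => (!₂[z.1, z.2] : Plane)) (y 0, y 1) := by
    apply Continuous.continuousAt
    fun_prop
  have h' : ∀ᶠ z in 𝓝 (!₂[y 0, y 1] : Plane), P z := by rwa [pair_eta]
  obtain ⟨r, hr, hr'⟩ := Metric.eventually_nhds_iff.1 (hc.eventually h')
  refine ⟨r, hr, fun s t hs ht => hr' (y := (s, t)) ?_⟩
  rw [Prod.dist_eq, Real.dist_eq, Real.dist_eq]
  exact max_lt hs ht

end PartialDerivatives

section Hexagon

/-- The third order condition implied by closing hexagons, for web functions `s`, `t`, `F`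
normalised along the two leaves through the origin. -/
theorem partialDeriv_eq_of_closing {F : Plane → ℝ} {Ω : Set Plane} (hΩ : IsOpen Ω)
    (hF : ContDiffOn ℝ ∞ F Ω) (h0 : (0 : Plane) ∈ Ω) {r₀ : ℝ} (hr₀ : 0 < r₀)
    (hx : ∀ s, |s| < r₀ → F !₂[s, 0] = s) (hy : ∀ t, |t| < r₀ → F !₂[0, t] = t)
    (hclose : ∀ s t s', |s| < r₀ → |t| < r₀ → |s'| < r₀ → F !₂[s, t] = 0 → F !₂[t, s'] = 0 →
      s' = s) :
    partialDeriv (partialDeriv (partialDeriv F 0) 1) 0 0 =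
      partialDeriv (partialDeriv (partialDeriv F 0) 1) 1 0 := by
  set P := partialDeriv F 0 with hP
  set Q := partialDeriv F 1 with hQ
  set M := partialDeriv P 1 with hM
  have hPs : ContDiffOn ℝ ∞ P Ω := contDiffOn_partialDeriv hΩ hF 0
  have hQs : ContDiffOn ℝ ∞ Q Ω := contDiffOn_partialDeriv hΩ hF 1
  have hMs : ContDiffOn ℝ ∞ M Ω := contDiffOn_partialDeriv hΩ hPs 1
  by_contra hne
  -- If the two third derivatives differ at the origin, they differ on a whole box; the rest of the
  -- proof finds a point of that box where they agree.
  have hne' : ∀ᶠ z in 𝓝 (0 : Plane), partialDeriv M 0 z - partialDeriv M 1 z ≠ 0 := by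
    have hc : ContinuousAt (fun z => partialDeriv M 0 z - partialDeriv M 1 z) 0 :=
      ((contDiffOn_partialDeriv hΩ hMs 0).continuousOn.continuousAt (hΩ.mem_nhds h0)).sub
        ((contDiffOn_partialDeriv hΩ hMs 1).continuousOn.continuousAt (hΩ.mem_nhds h0))
    exact hc.eventually_ne (sub_ne_zero.2 hne)
  obtain ⟨r₁, hr₁, hbox⟩ := exists_box (hne'.and (hΩ.eventually_mem h0))
  simp only [PiLp.zero_apply, sub_zero] at hbox
  set r := min r₀ r₁ with hr
  have hrpos : 0 < r := lt_min hr₀ hr₁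
  have hmem : ∀ s t, |s| < r → |t| < r → (!₂[s, t] : Plane) ∈ Ω := fun s t hs ht =>
    (hbox s t (hs.trans_le (min_le_right _ _)) (ht.trans_le (min_le_right _ _))).2
  have hdF : ∀ s t, |s| < r → |t| < r → DifferentiableAt ℝ F !₂[s, t] := fun s t hs ht =>
    differentiableAt_of_contDiffOn hΩ hF (hmem s t hs ht)
  have hdP : ∀ s t, |s| < r → |t| < r → DifferentiableAt ℝ P !₂[s, t] := fun s t hs ht =>
    differentiableAt_of_contDiffOn hΩ hPs (hmem s t hs ht)
  have hdQ : ∀ s t, |s| < r → |t| < r → DifferentiableAt ℝ Q !₂[s, t] := fun s t hs ht =>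
    differentiableAt_of_contDiffOn hΩ hQs (hmem s t hs ht)
  have hdM : ∀ s t, |s| < r → |t| < r → DifferentiableAt ℝ M !₂[s, t] := fun s t hs ht =>
    differentiableAt_of_contDiffOn hΩ hMs (hmem s t hs ht)
  have near : ∀ {s : ℝ}, |s| < r → ∀ᶠ σ in 𝓝 s, |σ| < r₀ := fun {s} hs =>
    (continuous_abs.continuousAt.eventually_lt continuousAt_const
      (hs.trans_le (min_le_left _ _)))
  have hP1 : ∀ s, |s| < r → P !₂[s, 0] = 1 := by
    intro s hs
    have h1 := hasDerivAt_fst (hdF s 0 hs (by simpa using hrpos))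
    have h2 : HasDerivAt (fun s => F !₂[s, 0]) 1 s :=
      (hasDerivAt_id s).congr_of_eventuallyEq ((near hs).mono fun σ hσ => hx σ hσ)
    exact h1.unique h2
  have hQ1 : ∀ t, |t| < r → Q !₂[0, t] = 1 := by
    intro t ht
    have h1 := hasDerivAt_snd (hdF 0 t (by simpa using hrpos) ht)
    have h2 : HasDerivAt (fun t => F !₂[0, t]) 1 t :=
      (hasDerivAt_id t).congr_of_eventuallyEq ((near ht).mono fun σ hσ => hy σ hσ)
    exact h1.unique h2
  have hF00 : F !₂[0, 0] = 0 := hx 0 (by simpa using hr₀)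
  -- the function `s ↦ F (s, -2s)` has derivative `-1` at the origin
  have hdiag : HasDerivAt (fun s : ℝ => F !₂[s, -2 * s]) (-1) 0 := by
    have h1 := hasDerivAt_comp_pair (f := F) (a := id) (b := fun s => -2 * s) (t := 0)
      (by simpa using hdF 0 0 (by simpa using hrpos) (by simpa using hrpos)) (hasDerivAt_id 0)
      ((hasDerivAt_id (0 : ℝ)).const_mul (-2))
    refine h1.congr_deriv ?_
    have e1 := hP1 0 (by simpa using hrpos)
    have e2 := hQ1 0 (by simpa using hrpos)
    simp only [id, mul_zero, mul_one]
    rw [← hP, ← hQ, e1, e2]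
    norm_num
  have hsign : ∀ᶠ s in 𝓝 (0 : ℝ), s ≠ 0 → F !₂[s, -2 * s] * s < 0 := by
    have h1 := hdiag.tendsto_slope
    have h2 : ∀ᶠ s in 𝓝[≠] (0 : ℝ), slope (fun s : ℝ => F !₂[s, -2 * s]) 0 s < 0 :=
      h1.eventually (gt_mem_nhds (by norm_num))
    rw [eventually_nhdsWithin_iff] at h2
    filter_upwards [h2] with s hs hs0
    have h3 := hs hs0
    rw [slope_def_field] at h3
    simp only [mul_zero, hF00, sub_zero] at h3
    have h4 : F !₂[s, -2 * s] * s = F !₂[s, -2 * s] / s * (s * s) := by field_simp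
    rw [h4]
    exact mul_neg_of_neg_of_pos h3 (mul_self_pos.2 hs0)
  obtain ⟨δ, hδ, hδs⟩ := Metric.eventually_nhds_iff.1 hsign
  simp only [Real.dist_eq, sub_zero] at hδs
  -- The construction below gives `-2s < t < 0` and `0 < s' < -2t < 4s`, so these bounds keep every
  -- point within `r / 2` and every use of the sign estimate within `δ`.
  set s := min (r / 8) (δ / 4) with hs
  have hspos : 0 < s := lt_min (by positivity) (by positivity)
  have hsr : s ≤ r / 8 := min_le_left _ _
  have hsδ : s ≤ δ / 4 := min_le_right _ _
  have hrr₀ : r ≤ r₀ := min_le_left _ _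
  have habs : ∀ {a : ℝ}, -(r / 2) ≤ a → a ≤ r / 2 → |a| < r := fun h1 h2 =>
    abs_lt.2 ⟨by linarith, by linarith⟩
  have hcont : ∀ a, |a| < r → ContinuousOn (fun t => F !₂[a, t]) (Set.Icc (-(r / 2)) (r / 2)) :=
    fun a ha t ht => (hasDerivAt_snd (hdF a t ha (habs ht.1 ht.2))).continuousAt.continuousWithinAt
  obtain ⟨t, ⟨ht1, ht2⟩, htF⟩ : ∃ t ∈ Set.Ioo (-2 * s) 0, F !₂[s, t] = 0 := by
    have hneg : F !₂[s, -2 * s] < 0 := by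
      have := hδs (by rw [abs_of_pos hspos]; linarith) hspos.ne'
      nlinarith
    have hpos : 0 < F !₂[s, 0] := by rw [hx s (by rw [abs_of_pos hspos]; linarith)]; exact hspos
    exact intermediate_value_Ioo (by linarith) ((hcont s (habs (by linarith) (by linarith))).mono
      (Set.Icc_subset_Icc (by linarith) (by linarith))) ⟨hneg, hpos⟩
  obtain ⟨s', ⟨hs1, hs2⟩, hsF⟩ : ∃ s' ∈ Set.Ioo 0 (-2 * t), F !₂[t, s'] = 0 := by
    have hpos : 0 < F !₂[t, -2 * t] := by
      have := hδs (y := t) (by rw [abs_of_neg ht2]; linarith) ht2.ne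
      nlinarith
    have hneg : F !₂[t, 0] < 0 := by rw [hx t (by rw [abs_of_neg ht2]; linarith)]; exact ht2
    exact intermediate_value_Ioo (by linarith) ((hcont t (habs (by linarith) (by linarith))).mono
      (Set.Icc_subset_Icc (by linarith) (by linarith))) ⟨hneg, hpos⟩
  have hss : s' = s := hclose s t s' (by rw [abs_of_pos hspos]; linarith)
    (by rw [abs_of_neg ht2]; linarith) (by rw [abs_of_pos hs1]; linarith) htF hsF
  rw [hss] at hsF
  have htr : |t| < r := habs (by linarith) (by linarith)
  -- Closing gives `F(s, t) = F(t, s) = 0`, and `F(0, t) = t = F(t, 0)` by the normalisation. So the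
  -- antisymmetric part of `F` vanishes at both ends of `[0, s]` and Rolle's theorem applies.
  obtain ⟨σ, hσ, hσ'⟩ : ∃ σ ∈ Set.Ioo 0 s, P !₂[σ, t] - Q !₂[t, σ] = 0 := by
    have hd : ∀ σ ∈ Set.Icc 0 s, HasDerivAt (fun σ => F !₂[σ, t] - F !₂[t, σ])
        (P !₂[σ, t] - Q !₂[t, σ]) σ := fun σ hσ => by
      have hσr : |σ| < r := habs (by linarith [hσ.1]) (by linarith [hσ.2])
      exact (hasDerivAt_fst (hdF σ t hσr htr)).sub (hasDerivAt_snd (hdF t σ htr hσr))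
    refine exists_hasDerivAt_eq_zero hspos
      (fun σ hσ => (hd σ hσ).continuousAt.continuousWithinAt) ?_
      fun σ hσ => hd σ (Set.Ioo_subset_Icc_self hσ)
    rw [htF, hsF, hx t (htr.trans_le hrr₀), hy t (htr.trans_le hrr₀)]
    ring
  have hσr : |σ| < r := habs (by linarith [hσ.1]) (by linarith [hσ.2])
  -- Rolle in the second variable: the difference vanishes at `t` by the previous step and at `0`
  -- because both first derivatives equal `1` on the axes.
  obtain ⟨τ, hτ, hτ'⟩ : ∃ τ ∈ Set.Ioo t 0, M !₂[σ, τ] - M !₂[τ, σ] = 0 := by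
    have hd : ∀ τ ∈ Set.Icc t 0, HasDerivAt (fun τ => P !₂[σ, τ] - Q !₂[τ, σ])
        (M !₂[σ, τ] - M !₂[τ, σ]) τ := fun τ hτ => by
      have hτr : |τ| < r := habs (by linarith [hτ.1]) (by linarith [hτ.2])
      have e : M !₂[τ, σ] = partialDeriv Q 0 !₂[τ, σ] :=
        partialDeriv_comm hΩ hF (hmem τ σ hτr hσr) 0 1
      rw [e]
      exact (hasDerivAt_snd (hdP σ τ hσr hτr)).sub (hasDerivAt_fst (hdQ τ σ hτr hσr))
    refine exists_hasDerivAt_eq_zero ht2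
      (fun τ hτ => (hd τ hτ).continuousAt.continuousWithinAt) ?_
      fun τ hτ => hd τ (Set.Ioo_subset_Icc_self hτ)
    rw [hσ', hP1 σ hσr, hQ1 σ hσr, sub_self]
  have hτr : |τ| < r := habs (by linarith [hτ.1]) (by linarith [hτ.2])
  -- The mixed derivative takes equal values at the mirror points `(σ, τ)` and `(τ, σ)`. Rolle along
  -- the segment joining them compares its two partial derivatives.
  obtain ⟨l, hl, hl'⟩ : ∃ l ∈ Set.Ioo τ σ, partialDeriv M 0 !₂[l, σ + τ - l] -
      partialDeriv M 1 !₂[l, σ + τ - l] = 0 := by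
    have hd : ∀ l ∈ Set.Icc τ σ, HasDerivAt (fun l => M !₂[l, σ + τ - l])
        (partialDeriv M 0 !₂[l, σ + τ - l] - partialDeriv M 1 !₂[l, σ + τ - l]) l := fun l hl => by
      have h1 := hasDerivAt_comp_pair (f := M) (a := id) (b := fun l => σ + τ - l) (t := l)
        (hdM l _ (habs (by linarith [hl.1, hτ.1]) (by linarith [hl.2, hσ.2]))
          (habs (by linarith [hl.2, hτ.1]) (by linarith [hl.1, hσ.2]))) (hasDerivAt_id l)
        ((hasDerivAt_id l).const_sub (σ + τ))
      refine h1.congr_deriv ?_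
      simp only [id]
      ring
    refine exists_hasDerivAt_eq_zero (by linarith [hτ.2, hσ.1])
      (fun l hl => (hd l hl).continuousAt.continuousWithinAt) ?_
      fun l hl => hd l (Set.Ioo_subset_Icc_self hl)
    have e1 : σ + τ - τ = σ := by ring
    have e2 : σ + τ - σ = τ := by ring
    rw [e1, e2]
    linarith
  refine (hbox l (σ + τ - l) ?_ ?_).1 hl'
  · exact (habs (by linarith [hl.1, hτ.1]) (by linarith [hl.2, hσ.2])).trans_le (min_le_right _ _)
  · exact (habs (by linarith [hl.2, hτ.1]) (by linarith [hl.1, hσ.2])).trans_le (min_le_right _ _)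

end Hexagon
end GeodesicWeb

/-! ### Web curvature and its vanishing -/

namespace GeodesicWeb

open scoped Topology

/-- A smooth local inverse of a function of one real variable. -/
theorem exists_smooth_local_inverse {φ : ℝ → ℝ} {U : Set ℝ} (hU : IsOpen U)
    (hφ : ContDiffOn ℝ ∞ φ U) {x₀ d : ℝ} (hx₀ : x₀ ∈ U) (hd : HasDerivAt φ d x₀) (hd0 : d ≠ 0) :
    ∃ (V : Set ℝ) (a : ℝ → ℝ), IsOpen V ∧ φ x₀ ∈ V ∧ ContDiffOn ℝ ∞ a V ∧ a (φ x₀) = x₀ ∧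
      ∀ s ∈ V, φ (a s) = s := by
  obtain ⟨V, a, hV, h0, ha, ha0, hz⟩ := exists_smooth_root (F := fun z : ℝ × ℝ => φ z.2 - z.1)
    (Ω := Prod.snd ⁻¹' U) (hU.preimage continuous_snd)
    ((hφ.comp contDiffOn_snd fun z hz => hz).sub contDiffOn_fst) (y₀ := φ x₀) (t₀ := x₀) (d := d)
    hx₀ (sub_self _) (hd.sub_const _) hd0
  exact ⟨V, a, hV, h0, ha, ha0, fun s hs => sub_eq_zero.1 (hz s hs)⟩

/-- The numerator of the mixed logarithmic derivative `∂₀ ∂₁ log (∂₀ f / ∂₁ f)`, which is the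
curvature of the web `y⁰ = const`, `y¹ = const`, `f = const`. -/
def webCurvature (f : Plane → ℝ) (y : Plane) : ℝ :=
  partialDeriv f 1 y ^ 2 *
      (partialDeriv (partialDeriv (partialDeriv f 0) 1) 0 y * partialDeriv f 0 y
        - partialDeriv (partialDeriv f 0) 1 y * partialDeriv (partialDeriv f 0) 0 y) -
    partialDeriv f 0 y ^ 2 *
      (partialDeriv (partialDeriv (partialDeriv f 0) 1) 1 y * partialDeriv f 1 y
        - partialDeriv (partialDeriv f 0) 1 y * partialDeriv (partialDeriv f 1) 1 y)

theorem contDiffOn_pair {E : Type*} [NormedAddCommGroup E] [NormedSpace ℝ E] {a b : E → ℝ}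
    {s : Set E} (ha : ContDiffOn ℝ ∞ a s) (hb : ContDiffOn ℝ ∞ b s) :
    ContDiffOn ℝ ∞ (fun z => (!₂[a z, b z] : Plane)) s := by
  rw [contDiffOn_euclidean]
  intro i
  fin_cases i
  · exact ha
  · exact hb

theorem contDiff_coord (i : Fin 2) : ContDiff ℝ ∞ (fun y : Plane => y i) :=
  (EuclideanSpace.proj i : Plane →L[ℝ] ℝ).contDiff

/-- Closing of all small hexagons around a point forces the web curvature to vanish there. -/
theorem webCurvature_eq_zero_of_closing {f : Plane → ℝ} {Ω : Set Plane} (hΩ : IsOpen Ω)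
    (hf : ContDiffOn ℝ ∞ f Ω) {y : Plane} (hy : y ∈ Ω) (hf0 : partialDeriv f 0 y ≠ 0)
    (hf1 : partialDeriv f 1 y ≠ 0)
    {ρ : ℝ} (hρ0 : 0 < ρ)
    (hρ : ∀ x x' t t' t'' : ℝ, |x - y 0| < ρ → |x' - y 0| < ρ →
      |t - y 1| < ρ → |t' - y 1| < ρ → |t'' - y 1| < ρ →
      f !₂[x, y 1] = f !₂[y 0, t] → f !₂[x, t'] = f y → f !₂[x', y 1] = f !₂[y 0, t'] →
      f !₂[x', t''] = f y → t'' = t) :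
    webCurvature f y = 0 := by
  have hdf : ∀ {z}, z ∈ Ω → DifferentiableAt ℝ f z := differentiableAt_of_contDiffOn hΩ hf
  have hy' : (!₂[y 0, y 1] : Plane) ∈ Ω := by rwa [pair_eta]
  -- local inverses of `f` along the two leaves through `y`
  obtain ⟨V, a, hV, hV0, ha, ha0, haV⟩ : ∃ (V : Set ℝ) (a : ℝ → ℝ), IsOpen V ∧ (0 : ℝ) ∈ V ∧
      ContDiffOn ℝ ∞ a V ∧ a 0 = y 0 ∧ ∀ s ∈ V, f !₂[a s, y 1] - f y = s := by
    have := exists_smooth_local_inverse (φ := fun x => f !₂[x, y 1] - f y)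
      (U := (fun x : ℝ => (!₂[x, y 1] : Plane)) ⁻¹' Ω)
      (hΩ.preimage (by fun_prop))
      ((hf.comp (contDiffOn_pair contDiffOn_id contDiffOn_const) fun z hz => hz).sub
        contDiffOn_const) (x₀ := y 0) hy'
      ((hasDerivAt_fst (hdf hy')).sub_const _) (by rwa [pair_eta])
    simpa [pair_eta] using this
  obtain ⟨W, b, hW, hW0, hb, hb0, hbW⟩ : ∃ (V : Set ℝ) (a : ℝ → ℝ), IsOpen V ∧ (0 : ℝ) ∈ V ∧
      ContDiffOn ℝ ∞ a V ∧ a 0 = y 1 ∧ ∀ s ∈ V, f !₂[y 0, a s] - f y = s := by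
    have := exists_smooth_local_inverse (φ := fun x => f !₂[y 0, x] - f y)
      (U := (fun x : ℝ => (!₂[y 0, x] : Plane)) ⁻¹' Ω)
      (hΩ.preimage (by fun_prop))
      ((hf.comp (contDiffOn_pair contDiffOn_const contDiffOn_id) fun z hz => hz).sub
        contDiffOn_const) (x₀ := y 1) hy'
      ((hasDerivAt_snd (hdf hy')).sub_const _) (by rwa [pair_eta])
    simpa [pair_eta] using this
  have hac : ContinuousAt a 0 := ha.continuousOn.continuousAt (hV.mem_nhds hV0)
  have hbc : ContinuousAt b 0 := hb.continuousOn.continuousAt (hW.mem_nhds hW0)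
  set g : Plane → Plane := fun z => !₂[a (z 0), b (z 1)] with hg
  set S : Set Plane := {z | z 0 ∈ V ∧ z 1 ∈ W} with hS
  have hSo : IsOpen S := (hV.preimage (by fun_prop)).inter (hW.preimage (by fun_prop))
  have hgs : ContDiffOn ℝ ∞ g S := contDiffOn_pair
    (ha.comp (contDiff_coord 0).contDiffOn fun z hz => hz.1)
    (hb.comp (contDiff_coord 1).contDiffOn fun z hz => hz.2)
  set T : Set Plane := S ∩ g ⁻¹' Ω with hT
  have hTo : IsOpen T := hgs.continuousOn.isOpen_inter_preimage hSo hΩ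
  set F : Plane → ℝ := fun z => f (g z) - f y with hF
  have hFs : ContDiffOn ℝ ∞ F T :=
    (hf.comp (hgs.mono Set.inter_subset_left) fun z hz => hz.2).sub contDiffOn_const
  have h0T : (0 : Plane) ∈ T := ⟨⟨hV0, hW0⟩, by
    change (!₂[a 0, b 0] : Plane) ∈ Ω
    rw [ha0, hb0]; exact hy'⟩
  -- a small box on which everything is defined
  obtain ⟨r₁, hr₁, hboxT⟩ := exists_box (hTo.eventually_mem h0T)
  simp only [PiLp.zero_apply, sub_zero] at hboxT
  obtain ⟨r₂, hr₂, hr₂'⟩ := Metric.eventually_nhds_iff.1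
    ((hac.eventually (Metric.ball_mem_nhds (a 0) hρ0)).and
      (hbc.eventually (Metric.ball_mem_nhds (b 0) hρ0)))
  simp only [Real.dist_eq, sub_zero, ha0, hb0] at hr₂'
  set r := min r₁ r₂ with hr
  have hrpos : 0 < r := lt_min hr₁ hr₂
  have memT : ∀ {s t}, |s| < r → |t| < r → (!₂[s, t] : Plane) ∈ T := fun hs ht =>
    hboxT _ _ (hs.trans_le (min_le_left _ _)) (ht.trans_le (min_le_left _ _))
  have zlt : |(0 : ℝ)| < r := by simpa using hrpos
  have memV : ∀ {s}, |s| < r → s ∈ V := fun hs => (memT hs zlt).1.1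
  have memW : ∀ {s}, |s| < r → s ∈ W := fun hs => (memT zlt hs).1.2
  have memΩ : ∀ {s t}, |s| < r → |t| < r → (!₂[a s, b t] : Plane) ∈ Ω := fun hs ht => (memT hs ht).2
  have fa : ∀ {s}, |s| < r → f !₂[a s, y 1] = f y + s := fun hs => by
    linarith [haV _ (memV hs)]
  have fb : ∀ {s}, |s| < r → f !₂[y 0, b s] = f y + s := fun hs => by
    linarith [hbW _ (memW hs)]
  -- With the parameters `a` and `b`, the `f`-leaf joining the two axes at value `f y + s` has end
  -- points with the same parameter `s`. The hexagon is thus described by `s`, `t`, `s'` only, and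
  -- its closing reads `s' = s`.
  have key := partialDeriv_eq_of_closing hTo hFs h0T hrpos
    (fun s hs => by
      change f !₂[a s, b 0] - f y = s
      rw [hb0, fa hs]; ring)
    (fun s hs => by
      change f !₂[a 0, b s] - f y = s
      rw [ha0, fb hs]; ring)
    (fun s t s' hs ht hs' h1 h2 => by
      have e1 : f !₂[a s, b t] = f y := sub_eq_zero.1 h1
      have e2 : f !₂[a t, b s'] = f y := sub_eq_zero.1 h2
      have A : ∀ {s}, |s| < r → |a s - y 0| < ρ ∧ |b s - y 1| < ρ := fun hs =>
        hr₂' (hs.trans_le (min_le_right _ _))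
      have := hρ (a s) (a t) (b s) (b t) (b s') (A hs).1 (A ht).1 (A hs).2 (A ht).2 (A hs').2
        ((fa hs).trans (fb hs).symm) e1 ((fa ht).trans (fb ht).symm) e2
      have h3 := fb hs'
      rw [this, fb hs] at h3
      linarith)
  -- express the mixed derivative of `F` by derivatives of `f`
  have ra : ∀ {s}, |s| < r → HasDerivAt a (deriv a s) s := fun hs =>
    (differentiableAt_of_contDiffOn hV ha (memV hs)).hasDerivAt
  have rb : ∀ {s}, |s| < r → HasDerivAt b (deriv b s) s := fun hs =>
    (differentiableAt_of_contDiffOn hW hb (memW hs)).hasDerivAt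
  have near : ∀ {s : ℝ}, |s| < r → ∀ᶠ σ in 𝓝 s, |σ| < r := fun {s} hs =>
    continuous_abs.continuousAt.eventually_lt continuousAt_const hs
  have axisA : ∀ {s}, |s| < r → (!₂[a s, y 1] : Plane) ∈ Ω := fun hs => by
    have := memΩ hs zlt; rwa [hb0] at this
  have axisB : ∀ {s}, |s| < r → (!₂[y 0, b s] : Plane) ∈ Ω := fun hs => by
    have := memΩ zlt hs; rwa [ha0] at this
  have da : ∀ {s}, |s| < r → deriv a s * partialDeriv f 0 !₂[a s, y 1] = 1 := fun {s} hs => by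
    have h1 := (hasDerivAt_comp_pair (f := f) (b := fun _ => y 1) (hdf (axisA hs)) (ra hs)
      (hasDerivAt_const s (y 1)))
    have h2 : HasDerivAt (fun s => f !₂[a s, y 1]) 1 s :=
      ((hasDerivAt_id s).const_add (f y)).congr_of_eventuallyEq ((near hs).mono fun σ hσ => fa hσ)
    simpa using h1.unique h2
  have db : ∀ {s}, |s| < r → deriv b s * partialDeriv f 1 !₂[y 0, b s] = 1 := fun {s} hs => by
    have h1 := (hasDerivAt_comp_pair (f := f) (a := fun _ => y 0) (hdf (axisB hs))
      (hasDerivAt_const s (y 0)) (rb hs))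
    have h2 : HasDerivAt (fun s => f !₂[y 0, b s]) 1 s :=
      ((hasDerivAt_id s).const_add (f y)).congr_of_eventuallyEq ((near hs).mono fun σ hσ => fb hσ)
    simpa using h1.unique h2
  set P := partialDeriv f 0 with hP
  set Q := partialDeriv f 1 with hQ
  set M := partialDeriv P 1 with hM
  have hPs : ContDiffOn ℝ ∞ P Ω := contDiffOn_partialDeriv hΩ hf 0
  have hQs : ContDiffOn ℝ ∞ Q Ω := contDiffOn_partialDeriv hΩ hf 1
  have hMs : ContDiffOn ℝ ∞ M Ω := contDiffOn_partialDeriv hΩ hPs 1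
  have hF0 : ∀ {s t}, |s| < r → |t| < r → partialDeriv F 0 !₂[s, t] = deriv a s * P !₂[a s, b t] :=
    fun {s t} hs ht => by
      have h1 := hasDerivAt_fst (differentiableAt_of_contDiffOn hTo hFs (memT hs ht))
      have h2 := (hasDerivAt_comp_pair (f := f) (b := fun _ => b t) (hdf (memΩ hs ht)) (ra hs)
        (hasDerivAt_const s (b t))).sub_const (f y)
      simpa using h1.unique h2
  have hF01 : ∀ {s t}, |s| < r → |t| < r → partialDeriv (partialDeriv F 0) 1 !₂[s, t] =
      deriv a s * deriv b t * M !₂[a s, b t] := fun {s t} hs ht => by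
    have h1 := hasDerivAt_snd (differentiableAt_of_contDiffOn hTo
      (contDiffOn_partialDeriv hTo hFs 0) (memT hs ht))
    have h2 := (hasDerivAt_comp_pair (f := P) (a := fun _ => a s)
      (differentiableAt_of_contDiffOn hΩ hPs (memΩ hs ht)) (hasDerivAt_const t (a s))
      (rb ht)).const_mul (deriv a s)
    have h3 := h1.unique (h2.congr_of_eventuallyEq ((near ht).mono fun σ hσ => hF0 hs hσ))
    rw [h3]; ring
  have hTM := contDiffOn_partialDeriv hTo (contDiffOn_partialDeriv hTo hFs 0) 1
  have hdiffM : DifferentiableAt ℝ (partialDeriv (partialDeriv F 0) 1) !₂[0, 0] :=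
    differentiableAt_of_contDiffOn hTo hTM (memT zlt zlt)
  have ea := da zlt
  have eb := db zlt
  rw [ha0, pair_eta] at ea
  rw [hb0, pair_eta] at eb
  have hpt : (!₂[a 0, b 0] : Plane) = y := by rw [ha0, hb0, pair_eta]
  have hpa : (!₂[a 0, y 1] : Plane) = y := by rw [ha0, pair_eta]
  have hpb : (!₂[y 0, b 0] : Plane) = y := by rw [hb0, pair_eta]
  have hdM : DifferentiableAt ℝ M y := differentiableAt_of_contDiffOn hΩ hMs hy
  have hdP : DifferentiableAt ℝ P y := differentiableAt_of_contDiffOn hΩ hPs hy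
  have hdQ : DifferentiableAt ℝ Q y := differentiableAt_of_contDiffOn hΩ hQs hy
  -- On the first axis `da` replaces the factor `deriv a` by `1 / P`, so no second derivative of `a`
  -- appears. For `d1` the same is done with `b` and `Q` on the second axis.
  have d0 : partialDeriv (partialDeriv (partialDeriv F 0) 1) 0 0 =
      deriv b 0 * ((deriv a 0 * partialDeriv M 0 y) * P y
        - M y * (deriv a 0 * partialDeriv P 0 y)) / P y ^ 2 := by
    have h1 := hasDerivAt_fst hdiffM
    have n1 := hasDerivAt_comp_pair (f := M) (a := a) (b := fun _ => b 0) (t := 0)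
      (by rwa [hpt]) (ra zlt) (hasDerivAt_const _ _)
    have n2 := hasDerivAt_comp_pair (f := P) (a := a) (b := fun _ => y 1) (t := 0)
      (by rwa [hpa]) (ra zlt) (hasDerivAt_const _ _)
    have h2 := (n1.fun_div n2 (by rwa [hpa])).const_mul (deriv b 0)
    have h3 := h1.unique (h2.congr_of_eventuallyEq ((near zlt).mono fun σ hσ => by
      beta_reduce
      rw [hF01 hσ zlt]
      have e := da hσ
      have e' : P !₂[a σ, y 1] ≠ 0 := right_ne_zero_of_mul_eq_one e
      field_simp
      linear_combination (deriv b 0 * M !₂[a σ, b 0]) * e))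
    rw [pair_zero, hpt, hpa] at h3
    rw [h3]
    ring
  have d1 : partialDeriv (partialDeriv (partialDeriv F 0) 1) 1 0 =
      deriv a 0 * ((deriv b 0 * partialDeriv M 1 y) * Q y
        - M y * (deriv b 0 * partialDeriv Q 1 y)) / Q y ^ 2 := by
    have h1 := hasDerivAt_snd hdiffM
    have n1 := hasDerivAt_comp_pair (f := M) (b := b) (a := fun _ => a 0) (t := 0)
      (by rwa [hpt]) (hasDerivAt_const _ _) (rb zlt)
    have n2 := hasDerivAt_comp_pair (f := Q) (b := b) (a := fun _ => y 0) (t := 0)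
      (by rwa [hpb]) (hasDerivAt_const _ _) (rb zlt)
    have h2 := (n1.fun_div n2 (by rwa [hpb])).const_mul (deriv a 0)
    have h3 := h1.unique (h2.congr_of_eventuallyEq ((near zlt).mono fun σ hσ => by
      beta_reduce
      rw [hF01 zlt hσ]
      have e := db hσ
      have e' : Q !₂[y 0, b σ] ≠ 0 := right_ne_zero_of_mul_eq_one e
      field_simp
      linear_combination (deriv a 0 * M !₂[a 0, b σ]) * e))
    rw [pair_zero, hpt, hpb] at h3
    rw [h3]
    ring
  rw [d0, d1] at key
  have ha' : deriv a 0 = (P y)⁻¹ := eq_inv_of_mul_eq_one_left ea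
  have hb' : deriv b 0 = (Q y)⁻¹ := eq_inv_of_mul_eq_one_left eb
  rw [ha', hb'] at key
  field_simp at key
  rw [webCurvature, ← hP, ← hQ, ← hM]
  linear_combination key

theorem eq_of_hasDerivAt_zero {φ : ℝ → ℝ} {a b : ℝ}
    (h : ∀ t ∈ Set.uIcc a b, HasDerivAt φ 0 t) : φ b = φ a := by
  have := (convex_uIcc a b).norm_image_sub_le_of_norm_hasDerivWithin_le (C := 0) (f := φ)
    (f' := fun _ => 0) (fun t ht => (h t ht).hasDerivWithinAt) (by simp) Set.left_mem_uIcc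
    Set.right_mem_uIcc
  rw [zero_mul] at this
  exact sub_eq_zero.1 (norm_le_zero_iff.1 this)

theorem mem_ball_iff {c y : Plane} {r : ℝ} (hr : 0 < r) :
    y ∈ Metric.ball c r ↔ (y 0 - c 0) ^ 2 + (y 1 - c 1) ^ 2 < r ^ 2 := by
  rw [Metric.mem_ball, EuclideanSpace.dist_eq, Real.sqrt_lt' hr, Fin.sum_univ_two,
    Real.dist_eq, Real.dist_eq, sq_abs, sq_abs]

theorem sq_sub_le_of_mem_uIcc {a b t : ℝ} (ht : t ∈ Set.uIcc a b) : (t - a) ^ 2 ≤ (b - a) ^ 2 := by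
  rw [sq_le_sq]
  rcases Set.mem_uIcc.1 ht with h | h
  · rw [abs_of_nonneg (by linarith), abs_of_nonneg (by linarith)]; linarith
  · rw [abs_of_nonpos (by linarith), abs_of_nonpos (by linarith)]; linarith

/-- A web of vanishing curvature is given by additively separated functions: there are functions
`A(y⁰)` and `B(y¹)` such that `dA + dB` is proportional to `df`. -/
theorem exists_flat_functions {f : Plane → ℝ} {c : Plane} {r : ℝ} (hr : 0 < r)
    (hf : ContDiffOn ℝ ∞ f (Metric.ball c r))
    (hf0 : ∀ y ∈ Metric.ball c r, partialDeriv f 0 y ≠ 0)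
    (hf1 : ∀ y ∈ Metric.ball c r, partialDeriv f 1 y ≠ 0)
    (hcurv : ∀ y ∈ Metric.ball c r, webCurvature f y = 0) :
    ∃ A B α β : Plane → ℝ, ContDiffOn ℝ ∞ A (Metric.ball c r) ∧
      ContDiffOn ℝ ∞ B (Metric.ball c r) ∧ ∀ y ∈ Metric.ball c r, α y ≠ 0 ∧ β y ≠ 0 ∧
        α y * partialDeriv f 1 y = β y * partialDeriv f 0 y ∧
        HasFDerivAt A (α y • (EuclideanSpace.proj 0 : Plane →L[ℝ] ℝ)) y ∧
        HasFDerivAt B (β y • (EuclideanSpace.proj 1 : Plane →L[ℝ] ℝ)) y := by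
  set S := Metric.ball c r with hS
  have hSo : IsOpen S := Metric.isOpen_ball
  have hcS : c ∈ S := Metric.mem_ball_self hr
  set P := partialDeriv f 0 with hP
  set Q := partialDeriv f 1 with hQ
  set M := partialDeriv P 1 with hM
  have hPs : ContDiffOn ℝ ∞ P S := contDiffOn_partialDeriv hSo hf 0
  have hQs : ContDiffOn ℝ ∞ Q S := contDiffOn_partialDeriv hSo hf 1
  -- This is `∂₀ log (∂₀ f / ∂₁ f)`. Vanishing curvature says that it does not depend on `y¹`.
  set L : Plane → ℝ := fun y => partialDeriv P 0 y / P y - M y / Q y with hL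
  -- In a disc the coordinate segments from a point towards the axes through the centre stay inside;
  -- all integrations run along such segments.
  have vert : ∀ {x y t : ℝ}, !₂[x, y] ∈ S → t ∈ Set.uIcc (c 1) y → (!₂[x, t] : Plane) ∈ S := by
    intro x y t hy ht
    rw [hS, mem_ball_iff hr] at hy ⊢
    have := sq_sub_le_of_mem_uIcc ht
    simp at hy ⊢
    linarith
  have horiz : ∀ {x y t : ℝ}, !₂[x, y] ∈ S → t ∈ Set.uIcc (c 0) x → (!₂[t, y] : Plane) ∈ S := by
    intro x y t hy ht
    rw [hS, mem_ball_iff hr] at hy ⊢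
    have := sq_sub_le_of_mem_uIcc ht
    simp at hy ⊢
    linarith
  have dP : ∀ {z}, z ∈ S → DifferentiableAt ℝ P z := differentiableAt_of_contDiffOn hSo hPs
  have dQ : ∀ {z}, z ∈ S → DifferentiableAt ℝ Q z := differentiableAt_of_contDiffOn hSo hQs
  have dM : ∀ {z}, z ∈ S → DifferentiableAt ℝ M z :=
    differentiableAt_of_contDiffOn hSo (contDiffOn_partialDeriv hSo hPs 1)
  have dP0 : ∀ {z}, z ∈ S → DifferentiableAt ℝ (partialDeriv P 0) z :=
    differentiableAt_of_contDiffOn hSo (contDiffOn_partialDeriv hSo hPs 0)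
  have hLconst : ∀ {x y : ℝ}, !₂[x, y] ∈ S → L !₂[x, y] = L !₂[x, c 1] := by
    intro x y hy
    refine eq_of_hasDerivAt_zero (φ := fun t => L !₂[x, t]) fun t ht => ?_
    have hz := vert hy ht
    have h1 := ((hasDerivAt_snd (dP0 hz)).fun_div (hasDerivAt_snd (dP hz)) (hf0 _ hz)).fun_sub
      ((hasDerivAt_snd (dM hz)).fun_div (hasDerivAt_snd (dQ hz)) (hf1 _ hz))
    refine h1.congr_deriv ?_
    have hk := hcurv _ hz
    rw [webCurvature, ← hP, ← hQ, ← hM] at hk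
    rw [partialDeriv_comm hSo hPs hz 0 1, ← hM]
    have n0 := hf0 _ hz
    have n1 := hf1 _ hz
    field_simp
    linear_combination hk
  set q : Plane → ℝ := fun y => P y / Q y with hq
  have hqs : ContDiffOn ℝ ∞ q S := hPs.div hQs hf1
  have hq0 : ∀ {z}, z ∈ S → q z ≠ 0 := fun hz => div_ne_zero (hf0 _ hz) (hf1 _ hz)
  have hqd : ∀ {x y : ℝ}, !₂[x, y] ∈ S →
      HasDerivAt (fun x => q !₂[x, y]) (q !₂[x, y] * L !₂[x, y]) x := by
    intro x y hz
    refine ((hasDerivAt_fst (dP hz)).fun_div (hasDerivAt_fst (dQ hz)) (hf1 _ hz)).congr_deriv ?_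
    have n0 := hf0 _ hz
    have n1 := hf1 _ hz
    rw [← partialDeriv_comm hSo hf hz 0 1, ← hP, ← hM]
    simp only [hq, hL]
    field_simp
  -- Numerator and denominator have the same logarithmic derivative in `x`, so their ratio is
  -- constant in `x`; this separates the variables of `q`.
  have hsep : ∀ {x y : ℝ}, !₂[x, y] ∈ S →
      q !₂[x, y] / q !₂[x, c 1] = q !₂[c 0, y] / q !₂[c 0, c 1] := by
    intro x y hy
    refine eq_of_hasDerivAt_zero (φ := fun t => q !₂[t, y] / q !₂[t, c 1]) fun t ht => ?_
    have hz := horiz hy ht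
    have hz1 := vert hz Set.left_mem_uIcc
    refine ((hqd hz).fun_div (hqd hz1) (hq0 hz1)).congr_deriv ?_
    rw [hLconst hz]
    have := hq0 hz1
    field_simp
    ring
  set α : Plane → ℝ := fun y => q !₂[y 0, c 1] with hα
  set β : Plane → ℝ := fun y => q c / q !₂[c 0, y 1] with hβ
  have m0 : ∀ y ∈ S, (!₂[y 0, c 1] : Plane) ∈ S := fun y hy =>
    vert (by rwa [pair_eta]) Set.left_mem_uIcc
  have m1 : ∀ y ∈ S, (!₂[c 0, y 1] : Plane) ∈ S := fun y hy =>
    horiz (by rwa [pair_eta]) Set.left_mem_uIcc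
  have hαs : ContDiffOn ℝ ∞ α S :=
    hqs.comp (contDiffOn_pair (contDiff_coord 0).contDiffOn contDiffOn_const) m0
  have hβs : ContDiffOn ℝ ∞ β S := contDiffOn_const.div
    (hqs.comp (contDiffOn_pair contDiffOn_const (contDiff_coord 1).contDiffOn) m1)
    fun y hy => hq0 (m1 y hy)
  have curl_smul : ∀ (γ : Plane → ℝ) (i : Fin 2), ContDiffOn ℝ ∞ γ S → ∀ y ∈ S,
      curl (fun y => γ y • (EuclideanSpace.proj i : Plane →L[ℝ] ℝ)) y =
        partialDeriv γ 0 y * basisVec 1 i - partialDeriv γ 1 y * basisVec 0 i := by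
    intro γ i hγ y hy
    have := ((differentiableAt_of_contDiffOn hSo hγ hy).hasFDerivAt.smul_const
      (EuclideanSpace.proj i : Plane →L[ℝ] ℝ)).fderiv
    rw [curl, this]
    simp [partialDeriv]
  have hα1 : ∀ y ∈ S, partialDeriv α 1 y = 0 := by
    intro y hy
    have h1 := hasDerivAt_snd (s := y 0) (t := y 1) (f := α)
      (by rw [pair_eta]; exact differentiableAt_of_contDiffOn hSo hαs hy)
    rw [pair_eta] at h1
    exact h1.unique (hasDerivAt_const (y 1) (q !₂[y 0, c 1]))
  have hβ0 : ∀ y ∈ S, partialDeriv β 0 y = 0 := by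
    intro y hy
    have h1 := hasDerivAt_fst (s := y 0) (t := y 1) (f := β)
      (by rw [pair_eta]; exact differentiableAt_of_contDiffOn hSo hβs hy)
    rw [pair_eta] at h1
    exact h1.unique (hasDerivAt_const (y 0) (q c / q !₂[c 0, y 1]))
  obtain ⟨A, hA, hA'⟩ := exists_primitive
    (θ := fun y => α y • (EuclideanSpace.proj 0 : Plane →L[ℝ] ℝ)) (hαs.smul contDiffOn_const)
    (fun y hy => by rw [curl_smul α 0 hαs y hy, hα1 y hy]; simp)
  obtain ⟨B, hB, hB'⟩ := exists_primitive
    (θ := fun y => β y • (EuclideanSpace.proj 1 : Plane →L[ℝ] ℝ)) (hβs.smul contDiffOn_const)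
    (fun y hy => by rw [curl_smul β 1 hβs y hy, hβ0 y hy]; simp)
  refine ⟨A, B, α, β, hA, hB, fun y hy => ⟨hq0 (m0 y hy), div_ne_zero (hq0 hcS) (hq0 (m1 y hy)),
    ?_, hA' y hy, hB' y hy⟩⟩
  have h1 := hsep (x := y 0) (y := y 1) (by rwa [pair_eta])
  rw [pair_eta, pair_eta] at h1
  have n0 := hq0 (m0 y hy)
  have n1 := hq0 (m1 y hy)
  have nc := hq0 hcS
  have h2 : α y = β y * q y := by
    simp only [hα, hβ]
    rw [div_eq_div_iff n0 nc] at h1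
    field_simp
    linear_combination -h1
  have n2 := hf1 y hy
  rw [h2]
  simp only [hq]
  field_simp

end GeodesicWeb

/-! ### Charts, coordinate vectors and the metric matrix -/

set_option linter.unusedSectionVars false

namespace GeodesicWeb

open scoped Topology

variable {M : Type*} [TopologicalSpace M] [ChartedSpace Plane M] [IsManifold (𝓡 2) ∞ M]

section Charts

variable {e : OpenPartialHomeomorph M Plane}

theorem mdifferentiable_chart (he : e ∈ IsManifold.maximalAtlas (𝓡 2) ∞ M) :
    e.MDifferentiable (𝓡 2) (𝓡 2) :=
  ⟨(contMDiffOn_of_mem_maximalAtlas he).mdifferentiableOn (by simp),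
    (contMDiffOn_symm_of_mem_maximalAtlas he).mdifferentiableOn (by simp)⟩

theorem mfderiv_symm_mfderiv (he : e ∈ IsManifold.maximalAtlas (𝓡 2) ∞ M) {x : M}
    (hx : x ∈ e.source) (X : TangentSpace (𝓡 2) x) :
    (mfderiv (𝓡 2) (𝓡 2) e.symm (e x) (mfderiv (𝓡 2) (𝓡 2) e x X) : TangentSpace (𝓡 2) x) = X :=
  DFunLike.congr_fun ((mdifferentiable_chart he).symm_comp_deriv hx) X

theorem mfderiv_mfderiv_symm (he : e ∈ IsManifold.maximalAtlas (𝓡 2) ∞ M) {y : Plane}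
    (hy : y ∈ e.target) (ξ : Plane) :
    (mfderiv (𝓡 2) (𝓡 2) e (e.symm y) (mfderiv (𝓡 2) (𝓡 2) e.symm y ξ) : Plane) = ξ :=
  DFunLike.congr_fun ((mdifferentiable_chart he).comp_symm_deriv hy) ξ

/-- The tangent vector at `e.symm y` with coordinates `ξ`. -/
def coordTangent (e : OpenPartialHomeomorph M Plane) (y ξ : Plane) :
    TangentSpace (𝓡 2) (e.symm y) :=
  mfderiv (𝓡 2) (𝓡 2) e.symm y ξ

theorem mfderiv_coordTangent (he : e ∈ IsManifold.maximalAtlas (𝓡 2) ∞ M) {y : Plane}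
    (hy : y ∈ e.target) (ξ : Plane) :
    (mfderiv (𝓡 2) (𝓡 2) e (e.symm y) (coordTangent e y ξ) : Plane) = ξ :=
  mfderiv_mfderiv_symm he hy ξ

theorem exists_coordTangent (he : e ∈ IsManifold.maximalAtlas (𝓡 2) ∞ M) {y : Plane}
    (hy : y ∈ e.target) (X : TangentSpace (𝓡 2) (e.symm y)) :
    ∃ ξ, coordTangent e y ξ = X := by
  refine ⟨mfderiv (𝓡 2) (𝓡 2) e (e.symm y) X, ?_⟩
  have := mfderiv_symm_mfderiv he (e.map_target hy) X
  rw [e.right_inv hy] at this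
  exact this

theorem coordTangent_add (y ξ η : Plane) :
    coordTangent e y (ξ + η) = coordTangent e y ξ + coordTangent e y η :=
  map_add (mfderiv (𝓡 2) (𝓡 2) e.symm y) ξ η

theorem coordTangent_smul (y ξ : Plane) (c : ℝ) :
    coordTangent e y (c • ξ) = c • coordTangent e y ξ :=
  map_smul (mfderiv (𝓡 2) (𝓡 2) e.symm y) c ξ

theorem coordTangent_eq_zero (he : e ∈ IsManifold.maximalAtlas (𝓡 2) ∞ M) {y : Plane}
    (hy : y ∈ e.target) {ξ : Plane} : coordTangent e y ξ = 0 ↔ ξ = 0 := by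
  constructor
  · intro h
    rw [← mfderiv_coordTangent he hy ξ, h]
    exact map_zero (mfderiv (𝓡 2) (𝓡 2) e (e.symm y))
  · rintro rfl
    exact map_zero (mfderiv (𝓡 2) (𝓡 2) e.symm y)

variable (g : Metric M)

theorem coordMetric_symm (y : Plane) : coordMetric g e y 1 0 = coordMetric g e y 0 1 :=
  g.symm _ _ _

theorem inner_coordTangent (y ξ η : Plane) :
    g.inner (e.symm y) (coordTangent e y ξ) (coordTangent e y η) =
      lower (coordMetric g e) y ξ 0 * η 0 + lower (coordMetric g e) y ξ 1 * η 1 := by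
  have expand : ∀ ξ, coordTangent e y ξ = ξ 0 • coordVec e 0 y + ξ 1 • coordVec e 1 y := by
    intro ξ
    conv_lhs => rw [plane_eq ξ, coordTangent_add, coordTangent_smul, coordTangent_smul]
    rfl
  have hs : g.inner (e.symm y) (coordVec e 1 y) (coordVec e 0 y) =
    g.inner (e.symm y) (coordVec e 0 y) (coordVec e 1 y) := g.symm _ _ _
  rw [expand ξ, expand η]
  simp only [map_add, map_smul, add_apply, smul_apply, smul_eq_mul, lower_zero, lower_one,
    coordMetric, Matrix.of_apply, hs]
  ring

theorem coordMetric_pos (he : e ∈ IsManifold.maximalAtlas (𝓡 2) ∞ M) {y : Plane}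
    (hy : y ∈ e.target) {ξ : Plane} (hξ : ξ ≠ 0) :
    0 < lower (coordMetric g e) y ξ 0 * ξ 0 + lower (coordMetric g e) y ξ 1 * ξ 1 := by
  rw [← inner_coordTangent]
  exact g.pos _ _ (mt (coordTangent_eq_zero he hy).1 hξ)

theorem coordMetric_zero_zero_pos (he : e ∈ IsManifold.maximalAtlas (𝓡 2) ∞ M) {y : Plane}
    (hy : y ∈ e.target) : 0 < coordMetric g e y 0 0 := by
  have h := coordMetric_pos g he hy (ξ := basisVec 0) (by
    intro h; simpa using congrArg (fun v : Plane => v 0) h)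
  simpa using h

/-- The vector `(-F, E)` has squared length `E (E G - F²)`, and `E` is positive. -/
theorem coordMetric_det_pos (he : e ∈ IsManifold.maximalAtlas (𝓡 2) ∞ M) {y : Plane}
    (hy : y ∈ e.target) : 0 < (coordMetric g e y).det := by
  have h0 := coordMetric_zero_zero_pos g he hy
  have h := coordMetric_pos g he hy (ξ := !₂[-coordMetric g e y 0 1, coordMetric g e y 0 0]) (by
    intro h; exact h0.ne' (by simpa using congrArg (fun v : Plane => v 1) h))
  simp only [lower_zero, lower_one, Matrix.cons_val_zero, Matrix.cons_val_one,
    coordMetric_symm] at h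
  rw [Matrix.det_fin_two, coordMetric_symm]
  refine pos_of_mul_pos_right (a := coordMetric g e y 0 0) ?_ h0.le
  linarith

/-- The coordinate momentum of the covector `g(ξ, ·)` is the lowered vector. This is the bridge
between intrinsic statements about `I` and computations with matrices. -/
theorem inChart_lower (he : e ∈ IsManifold.maximalAtlas (𝓡 2) ∞ M) {y : Plane}
    (hy : y ∈ e.target) (I : (x : M) → Covector x → ℝ) (ξ : Plane) :
    inChart I e y (lower (coordMetric g e) y ξ) =
      I (e.symm y) (g.inner (e.symm y) (coordTangent e y ξ)) := by
  rw [inChart]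
  congr 1
  ext X
  obtain ⟨η, rfl⟩ := exists_coordTangent he hy X
  rw [inner_coordTangent]
  change inner ℝ (lower (coordMetric g e) y ξ)
    (mfderiv (𝓡 2) (𝓡 2) e (e.symm y) (coordTangent e y η) : Plane) = _
  rw [mfderiv_coordTangent he hy]
  simp [PiLp.inner_apply, Fin.sum_univ_two]
  ring

/-- The coordinate fields are smooth because the tangent map of the inverse chart carries constant
fields to them; contracting the smooth section `g` with two smooth fields is smooth. -/
theorem contDiffOn_coordMetric (he : e ∈ IsManifold.maximalAtlas (𝓡 2) ∞ M) (i j : Fin 2) :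
    ContDiffOn ℝ ∞ (fun y => coordMetric g e y i j) e.target := by
  have hsymm := contMDiffOn_symm_of_mem_maximalAtlas he
  have hvec : ∀ i, ContMDiffOn (𝓡 2) ((𝓡 2).prod (𝓡 2)) ∞
      (fun y => Bundle.TotalSpace.mk' Plane (E := fun x : M => TangentSpace (𝓡 2) x) (e.symm y)
        (coordVec e i y)) e.target := by
    intro i
    have h1 := hsymm.contMDiffOn_tangentMapWithin (m := ∞) (by simp)
      e.open_target.uniqueMDiffOn
    have h2 : ContMDiff (𝓡 2) (𝓡 2).tangent ∞
        (fun y : Plane => (⟨y, basisVec i⟩ : TangentBundle (𝓡 2) Plane)) :=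
      contMDiff_vectorSpace_iff_contDiff.2 (contDiff_const (c := basisVec i))
    refine (h1.comp h2.contMDiffOn fun y hy => hy).congr fun y hy => ?_
    simp only [Function.comp, tangentMapWithin, coordVec]
    rw [mfderivWithin_of_isOpen e.open_target hy]
  have hg : ContMDiffOn (𝓡 2) ((𝓡 2).prod 𝓘(ℝ, Plane →L[ℝ] Plane →L[ℝ] ℝ)) ∞
      (fun y => Bundle.TotalSpace.mk' (Plane →L[ℝ] Plane →L[ℝ] ℝ)
        (E := fun x : M => TangentSpace (𝓡 2) x →L[ℝ] TangentSpace (𝓡 2) x →L[ℝ] ℝ) (e.symm y)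
        (g.inner (e.symm y))) e.target :=
    g.contMDiff.comp_contMDiffOn hsymm
  rw [← contMDiffOn_iff_contDiffOn]
  intro y hy
  have h : ContMDiffWithinAt (𝓡 2) ((𝓡 2).prod 𝓘(ℝ)) ∞
      (fun y ↦ Bundle.TotalSpace.mk' ℝ (E := Bundle.Trivial M ℝ) (e.symm y)
        (g.inner (e.symm y) (coordVec e i y) (coordVec e j y))) e.target y := by
    apply ContMDiffWithinAt.clm_bundle_apply₂ (F₁ := Plane) (F₂ := Plane)
    · exact hg y hy
    · exact hvec i y hy
    · exact hvec j y hy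
  rw [Bundle.contMDiffWithinAt_totalSpace] at h
  exact h.2

end Charts
end GeodesicWeb

/-! ### Functions with independent differentials as coordinates -/

namespace GeodesicWeb

open scoped Topology

variable {M : Type*} [TopologicalSpace M] [ChartedSpace Plane M] [IsManifold (𝓡 2) ∞ M]

section Functions

variable {e : OpenPartialHomeomorph M Plane}

theorem contDiffOn_comp_symm (he : e ∈ IsManifold.maximalAtlas (𝓡 2) ∞ M) {u : M → ℝ} {N : Set M}
    (hu : ContMDiffOn (𝓡 2) 𝓘(ℝ, ℝ) ∞ u N) :
    ContDiffOn ℝ ∞ (fun y => u (e.symm y)) (e.target ∩ e.symm ⁻¹' N) := by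
  rw [← contMDiffOn_iff_contDiffOn]
  exact hu.comp ((contMDiffOn_symm_of_mem_maximalAtlas he).mono Set.inter_subset_left)
    fun y hy => hy.2

theorem fderiv_comp_symm (he : e ∈ IsManifold.maximalAtlas (𝓡 2) ∞ M) {u : M → ℝ} {y : Plane}
    (hy : y ∈ e.target) (hu : MDifferentiableAt (𝓡 2) 𝓘(ℝ, ℝ) u (e.symm y)) (ξ : Plane) :
    fderiv ℝ (fun y => u (e.symm y)) y ξ =
      (mfderiv (𝓡 2) 𝓘(ℝ, ℝ) u (e.symm y) (coordTangent e y ξ) : ℝ) := by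
  have h1 := (mdifferentiable_chart he).mdifferentiableAt_symm hy
  have h2 := mfderiv_comp (I := 𝓡 2) (I' := 𝓡 2) (I'' := 𝓘(ℝ, ℝ)) y hu h1
  rw [← mfderiv_eq_fderiv]
  change mfderiv (𝓡 2) 𝓘(ℝ, ℝ) (u ∘ e.symm) y ξ = _
  rw [h2]
  rfl

theorem mdifferentiableAt_of_contMDiffOn {u : M → ℝ} {N : Set M} (hN : IsOpen N)
    (hu : ContMDiffOn (𝓡 2) 𝓘(ℝ, ℝ) ∞ u N) {x : M} (hx : x ∈ N) :
    MDifferentiableAt (𝓡 2) 𝓘(ℝ, ℝ) u x :=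
  (hu.contMDiffAt (hN.mem_nhds hx)).mdifferentiableAt (by simp)

theorem fderiv_pair {E : Type*} [NormedAddCommGroup E] [NormedSpace ℝ E] {a b : E → ℝ} {y : E}
    (ha : DifferentiableAt ℝ a y) (hb : DifferentiableAt ℝ b y) (ξ : E) :
    fderiv ℝ (fun z => (!₂[a z, b z] : Plane)) y ξ = !₂[fderiv ℝ a y ξ, fderiv ℝ b y ξ] := by
  have h : HasFDerivAt (fun z => ![a z, b z])
      (ContinuousLinearMap.pi ![fderiv ℝ a y, fderiv ℝ b y]) y := by
    rw [hasFDerivAt_pi]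
    intro i
    fin_cases i
    · exact ha.hasFDerivAt
    · exact hb.hasFDerivAt
  have h2 := ((EuclideanSpace.equiv (Fin 2) ℝ).symm : (Fin 2 → ℝ) →L[ℝ] Plane).hasFDerivAt.comp y h
  have h3 : fderiv ℝ (fun z => (!₂[a z, b z] : Plane)) y = _ := h2.fderiv
  rw [h3]
  ext i
  fin_cases i <;> rfl

/-- Two functions with independent differentials at a point are coordinates of a chart around that
point, with a disc as its image. -/
theorem exists_chart_of_functions {U V : M → ℝ} {N : Set M} (hN : IsOpen N)
    (hU : ContMDiffOn (𝓡 2) 𝓘(ℝ, ℝ) ∞ U N) (hV : ContMDiffOn (𝓡 2) 𝓘(ℝ, ℝ) ∞ V N) {p : M}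
    (hp : p ∈ N) (hind : ∀ X : TangentSpace (𝓡 2) p, (mfderiv (𝓡 2) 𝓘(ℝ, ℝ) U p X : ℝ) = 0 →
      (mfderiv (𝓡 2) 𝓘(ℝ, ℝ) V p X : ℝ) = 0 → X = 0) :
    ∃ e ∈ IsManifold.maximalAtlas (𝓡 2) ∞ M, p ∈ e.source ∧ e.source ⊆ N ∧
      (∀ x ∈ e.source, e x = !₂[U x, V x]) ∧ ∃ r > 0, e.target = Metric.ball (e p) r := by
  set e₀ := chartAt Plane p with he₀
  have hm : e₀ ∈ IsManifold.maximalAtlas (𝓡 2) ∞ M := IsManifold.chart_mem_maximalAtlas p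
  have hps : p ∈ e₀.source := mem_chart_source Plane p
  set O : Set Plane := e₀.target ∩ e₀.symm ⁻¹' N with hO
  have hOo : IsOpen O := e₀.isOpen_inter_preimage_symm hN
  set Ψ : Plane → Plane := fun y => !₂[U (e₀.symm y), V (e₀.symm y)] with hΨ
  have hUs := contDiffOn_comp_symm hm hU
  have hVs := contDiffOn_comp_symm hm hV
  have hΨs : ContDiffOn ℝ ∞ Ψ O := contDiffOn_pair hUs hVs
  have hy₀ : e₀ p ∈ O := ⟨e₀.map_source hps, by
    change e₀.symm (e₀ p) ∈ N; rwa [e₀.left_inv hps]⟩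
  have hinj : Function.Injective (fderiv ℝ Ψ (e₀ p)) := by
    rw [injective_iff_map_eq_zero]
    intro ξ hξ
    rw [hΨ, fderiv_pair (differentiableAt_of_contDiffOn hOo hUs hy₀)
      (differentiableAt_of_contDiffOn hOo hVs hy₀),
      fderiv_comp_symm hm hy₀.1 (mdifferentiableAt_of_contMDiffOn hN hU hy₀.2),
      fderiv_comp_symm hm hy₀.1 (mdifferentiableAt_of_contMDiffOn hN hV hy₀.2)] at hξ
    rw [← coordTangent_eq_zero hm hy₀.1]
    have hsym := e₀.left_inv hps
    have hind' : ∀ X : TangentSpace (𝓡 2) (e₀.symm (e₀ p)),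
        (mfderiv (𝓡 2) 𝓘(ℝ, ℝ) U (e₀.symm (e₀ p)) X : ℝ) = 0 →
        (mfderiv (𝓡 2) 𝓘(ℝ, ℝ) V (e₀.symm (e₀ p)) X : ℝ) = 0 → X = 0 := by
      rw [hsym]; exact hind
    exact hind' _ (congrArg (fun v : Plane => v 0) hξ) (congrArg (fun v : Plane => v 1) hξ)
  set R : Set (Plane →L[ℝ] Plane) :=
    Set.range ((↑) : (Plane ≃L[ℝ] Plane) → (Plane →L[ℝ] Plane)) with hR
  have hRo : IsOpen R := ContinuousLinearEquiv.isOpen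
  -- The inverse function theorem at `e₀ p` gives smoothness of the inverse at one point.
  -- Restricting to points with invertible derivative makes it smooth on the whole image.
  set O' : Set Plane := O ∩ (fderiv ℝ Ψ) ⁻¹' R with hO'
  have hO'o : IsOpen O' :=
    (hΨs.continuousOn_fderiv_of_isOpen hOo (by simp)).isOpen_inter_preimage hOo hRo
  have hy₀' : e₀ p ∈ O' := by
    refine ⟨hy₀, (LinearEquiv.ofInjectiveEndo (fderiv ℝ Ψ (e₀ p) : Plane →ₗ[ℝ] Plane)
      hinj).toContinuousLinearEquiv, ?_⟩
    ext v : 1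
    rfl
  obtain ⟨L, hL⟩ := hy₀'.2
  have hΨat : ContDiffAt ℝ ∞ Ψ (e₀ p) := hΨs.contDiffAt (hOo.mem_nhds hy₀)
  have hΨL : HasFDerivAt Ψ (L : Plane →L[ℝ] Plane) (e₀ p) := by
    rw [hL]; exact (hΨat.differentiableAt (by simp)).hasFDerivAt
  set Φ := (hΨat.toOpenPartialHomeomorph Ψ hΨL (by simp)).restrOpen O' hO'o with hΦ
  have hΦs : e₀ p ∈ Φ.source :=
    ⟨hΨat.mem_toOpenPartialHomeomorph_source hΨL (by simp), hy₀'⟩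
  have hΦO : Φ.source ⊆ O' := fun y hy => hy.2
  -- The image is cut down to a disc; its convexity is used later for integration along segments.
  obtain ⟨r, hr, hball⟩ := Metric.isOpen_iff.1 Φ.open_target _ (Φ.map_source hΦs)
  set Φ' := (Φ.symm.restrOpen (Metric.ball (Φ (e₀ p)) r) Metric.isOpen_ball).symm with hΦ'
  have hΦ't : Φ'.target = Metric.ball (Φ (e₀ p)) r := by
    change Φ.target ∩ _ = _
    exact Set.inter_eq_right.2 hball
  have hΦ's : Φ'.source ⊆ O' := fun y hy => hΦO (by
    have h1 : y ∈ Φ'.source := hy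
    have h2 : Φ' y ∈ Φ'.target := Φ'.map_source h1
    have h3 : Φ'.symm (Φ' y) = y := Φ'.left_inv h1
    have h4 : Φ.symm (Φ' y) ∈ Φ.source := Φ.map_target (by rw [hΦ't] at h2; exact hball h2)
    change Φ.symm (Φ' y) = y at h3
    rwa [h3] at h4)
  have hpΦ' : e₀ p ∈ Φ'.source := by
    have h1 : Φ (e₀ p) ∈ Φ'.target := by rw [hΦ't]; exact Metric.mem_ball_self hr
    have h2 := Φ'.map_target h1
    change Φ.symm (Φ (e₀ p)) ∈ _ at h2
    rwa [Φ.left_inv hΦs] at h2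
  set e := e₀.trans Φ' with he
  have hes : ∀ x, x ∈ e.source ↔ x ∈ e₀.source ∧ e₀ x ∈ Φ'.source := fun x => by
    rw [he, OpenPartialHomeomorph.trans_source]; rfl
  have hsub : e.source ⊆ N := fun x hx => by
    have h1 := (hΦ's ((hes x).1 hx).2).1.2
    change e₀.symm (e₀ x) ∈ N at h1
    rwa [e₀.left_inv ((hes x).1 hx).1] at h1
  have hval : ∀ x ∈ e.source, e x = !₂[U x, V x] := fun x hx => by
    change (!₂[U (e₀.symm (e₀ x)), V (e₀.symm (e₀ x))] : Plane) = _
    rw [e₀.left_inv ((hes x).1 hx).1]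
  have hpe : p ∈ e.source := (hes p).2 ⟨hps, hpΦ'⟩
  have htar : e.target = Metric.ball (e p) r := by
    rw [he, OpenPartialHomeomorph.trans_target, hΦ't]
    refine Set.inter_eq_left.2 fun y hy => ?_
    exact (hΦ's (Φ'.map_target (by rw [hΦ't]; exact hy))).1.1
  refine ⟨e, ?_, hpe, hsub, hval, r, hr, htar⟩
  refine e.mem_maximalAtlas_of_contMDiffOn ?_ ?_
  · have h1 : ContMDiffOn (𝓡 2) (𝓡 2) ∞ Ψ Φ'.source :=
      (contMDiffOn_iff_contDiffOn.2 (hΨs.mono fun y hy => (hΦ's hy).1))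
    exact h1.comp ((contMDiffOn_of_mem_maximalAtlas hm).mono fun x hx => ((hes x).1 hx).1)
      fun x hx => ((hes x).1 hx).2
  · have h1 : ContDiffOn ℝ ∞ Φ'.symm Φ'.target := fun a ha => by
      have h2 : Φ'.symm a ∈ O' := hΦ's (Φ'.map_target ha)
      obtain ⟨L', hL'⟩ := h2.2
      have h3 : ContDiffAt ℝ ∞ Ψ (Φ'.symm a) := hΨs.contDiffAt (hOo.mem_nhds h2.1)
      refine (Φ'.contDiffAt_symm (f₀' := L') ha ?_ h3).contDiffWithinAt
      rw [hL']
      exact (h3.differentiableAt (by simp)).hasFDerivAt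
    have hsub' : e.target ⊆ Φ'.target := by
      rw [he, OpenPartialHomeomorph.trans_target]; exact Set.inter_subset_left
    exact (contMDiffOn_symm_of_mem_maximalAtlas hm).comp
      ((contMDiffOn_iff_contDiffOn.2 h1).mono hsub')
      fun y hy => (hΦ's (Φ'.map_target (hsub' hy))).1.1

end Functions
end GeodesicWeb

/-! ### Polynomial coefficients, three real roots and the cubic of a chart -/

namespace GeodesicWeb

open scoped Topology

section CubicCoefficients

variable {I : Plane → Plane → ℝ} {Ω : Set Plane}

theorem differentiableAt_of_cubic (hΩ : IsOpen Ω) {a : Fin 4 → Plane → ℝ}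
    (ha : ∀ k, ContDiffOn ℝ ∞ (a k) Ω) (hI : ∀ y ∈ Ω, ∀ p, I y p = cubicForm (fun k => a k y) p)
    {y : Plane} (hy : y ∈ Ω) (p : Plane) :
    DifferentiableAt ℝ (fun z : Plane × Plane => I z.1 z.2) (y, p) := by
  have hev : (fun z : Plane × Plane => I z.1 z.2) =ᶠ[𝓝 (y, p)]
      fun z => cubicForm (fun k => a k z.1) z.2 := by
    filter_upwards [(hΩ.preimage continuous_fst).mem_nhds (show (y, p) ∈ Prod.fst ⁻¹' Ω from hy)]
      with z hz using hI z.1 hz z.2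
  refine DifferentiableAt.congr_of_eventuallyEq ?_ hev
  have h : ∀ k, DifferentiableAt ℝ (fun z : Plane × Plane => a k z.1) (y, p) := fun k =>
    DifferentiableAt.comp (y, p) (differentiableAt_of_contDiffOn hΩ (ha k) hy)
      differentiableAt_fst
  have c : ∀ i : Fin 2, DifferentiableAt ℝ (fun z : Plane × Plane => z.2 i) (y, p) := fun i =>
    (EuclideanSpace.proj i : Plane →L[ℝ] ℝ).differentiableAt.comp (y, p) differentiableAt_snd
  simp only [cubicForm_eq]
  exact ((((h 0).mul ((c 0).pow 3)).add (((h 1).mul ((c 0).pow 2)).mul (c 1))).add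
    (((h 2).mul (c 0)).mul ((c 1).pow 2))).add ((h 3).mul ((c 1).pow 3))

/-- Raising the index turns each form into a linear form in the momentum with smooth coefficients,
since `det G` does not vanish; the product of three such forms is then expanded. -/
theorem exists_cubic_coefficients {G : Plane → Matrix (Fin 2) (Fin 2) ℝ}
    {θ₁ θ₂ : Plane → Plane →L[ℝ] ℝ} (hG : ∀ i j, ContDiffOn ℝ ∞ (fun y => G y i j) Ω)
    (hdet : ∀ y ∈ Ω, (G y).det ≠ 0)
    (h₁ : ContDiffOn ℝ ∞ θ₁ Ω) (h₂ : ContDiffOn ℝ ∞ θ₂ Ω)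
    (hw : ∀ y ∈ Ω, wedge (θ₁ y) (θ₂ y) ≠ 0)
    (hI : ∀ y ∈ Ω, ∀ ξ, I y (lower G y ξ) = normalCubic (G y).det (θ₁ y) (θ₂ y) ξ) :
    ∃ a : Fin 4 → Plane → ℝ, (∀ k, ContDiffOn ℝ ∞ (a k) Ω) ∧
      ∀ y ∈ Ω, ∀ p, I y p = cubicForm (fun k => a k y) p := by
  have hb : ∀ {θ : Plane → Plane →L[ℝ] ℝ}, ContDiffOn ℝ ∞ θ Ω → ∀ i,
      ContDiffOn ℝ ∞ (fun y => θ y (basisVec i)) Ω := fun hθ i => hθ.clm_apply contDiffOn_const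
  have hdets : ContDiffOn ℝ ∞ (fun y => (G y).det) Ω := by
    simp only [Matrix.det_fin_two]
    exact ((hG 0 0).mul (hG 1 1)).sub ((hG 0 1).mul (hG 1 0))
  have hws : ContDiffOn ℝ ∞ (fun y => wedge (θ₁ y) (θ₂ y)) Ω :=
    ((hb h₁ 0).mul (hb h₂ 1)).sub ((hb h₁ 1).mul (hb h₂ 0))
  set A : (Plane → Plane →L[ℝ] ℝ) → Plane → ℝ := fun θ y =>
    (θ y (basisVec 0) * G y 1 1 - θ y (basisVec 1) * G y 1 0) / (G y).det with hA
  set B : (Plane → Plane →L[ℝ] ℝ) → Plane → ℝ := fun θ y =>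
    (θ y (basisVec 1) * G y 0 0 - θ y (basisVec 0) * G y 0 1) / (G y).det with hB
  have hAs : ∀ {θ : Plane → Plane →L[ℝ] ℝ}, ContDiffOn ℝ ∞ θ Ω → ContDiffOn ℝ ∞ (A θ) Ω :=
    fun hθ => (((hb hθ 0).mul (hG 1 1)).sub ((hb hθ 1).mul (hG 1 0))).div hdets hdet
  have hBs : ∀ {θ : Plane → Plane →L[ℝ] ℝ}, ContDiffOn ℝ ∞ θ Ω → ContDiffOn ℝ ∞ (B θ) Ω :=
    fun hθ => (((hb hθ 1).mul (hG 0 0)).sub ((hb hθ 0).mul (hG 0 1))).div hdets hdet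
  have hval : ∀ (θ : Plane → Plane →L[ℝ] ℝ), ∀ y ∈ Ω, ∀ ξ,
      θ y ξ = A θ y * lower G y ξ 0 + B θ y * lower G y ξ 1 := by
    intro θ y hy ξ
    have hd := hdet y hy
    have hD : (G y).det = G y 0 0 * G y 1 1 - G y 0 1 * G y 1 0 := Matrix.det_fin_two _
    rw [clm_apply_plane (θ y) ξ]
    simp only [hA, hB, lower_zero, lower_one, smul_eq_mul]
    generalize (G y).det = D at *
    field_simp
    rw [hD]
    ring
  set K : Plane → ℝ := fun y => (G y).det / wedge (θ₁ y) (θ₂ y) ^ 2 with hK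
  have hKs : ContDiffOn ℝ ∞ K Ω := hdets.div (hws.pow 2) fun y hy => pow_ne_zero 2 (hw y hy)
  have hA₁ := hAs h₁
  have hA₂ := hAs h₂
  have hB₁ := hBs h₁
  have hB₂ := hBs h₂
  refine ⟨![fun y => K y * (A θ₁ y * A θ₂ y * (A θ₁ y + A θ₂ y)),
    fun y => K y * (A θ₁ y * A θ₂ y * (B θ₁ y + B θ₂ y)
      + (A θ₁ y * B θ₂ y + B θ₁ y * A θ₂ y) * (A θ₁ y + A θ₂ y)),
    fun y => K y * (B θ₁ y * B θ₂ y * (A θ₁ y + A θ₂ y)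
      + (A θ₁ y * B θ₂ y + B θ₁ y * A θ₂ y) * (B θ₁ y + B θ₂ y)),
    fun y => K y * (B θ₁ y * B θ₂ y * (B θ₁ y + B θ₂ y))], ?_, ?_⟩
  · intro k
    fin_cases k
    · exact hKs.mul ((hA₁.mul hA₂).mul (hA₁.add hA₂))
    · exact hKs.mul (((hA₁.mul hA₂).mul (hB₁.add hB₂)).add
        (((hA₁.mul hB₂).add (hB₁.mul hA₂)).mul (hA₁.add hA₂)))
    · exact hKs.mul (((hB₁.mul hB₂).mul (hA₁.add hA₂)).add
        (((hA₁.mul hB₂).add (hB₁.mul hA₂)).mul (hB₁.add hB₂)))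
    · exact hKs.mul ((hB₁.mul hB₂).mul (hB₁.add hB₂))
  · intro y hy p
    obtain ⟨ξ, rfl⟩ := exists_lower_eq (hdet y hy) p
    rw [hI y hy, normalCubic, hval θ₁ y hy, hval θ₂ y hy, cubicForm_eq]
    simp only [Matrix.cons_val]
    ring

end CubicCoefficients

variable {M : Type*} [TopologicalSpace M] [ChartedSpace Plane M] [IsManifold (𝓡 2) ∞ M]

section ThreeLines

variable (g : Metric M) {e : OpenPartialHomeomorph M Plane}

theorem exists_eq_symm (e : OpenPartialHomeomorph M Plane) {x : M} (hx : x ∈ e.source) :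
    ∃ y ∈ e.target, e.symm y = x := ⟨e x, e.map_source hx, e.left_inv hx⟩

theorem exists_inner_eq (he : e ∈ IsManifold.maximalAtlas (𝓡 2) ∞ M) {x : M} (hx : x ∈ e.source)
    (α : Covector x) : ∃ X : TangentSpace (𝓡 2) x, g.inner x X = α := by
  obtain ⟨y, hy, rfl⟩ := exists_eq_symm e hx
  obtain ⟨ξ, hξ⟩ := exists_lower_eq (coordMetric_det_pos g he hy).ne'
    !₂[α (coordVec e 0 y), α (coordVec e 1 y)]
  refine ⟨coordTangent e y ξ, ?_⟩
  ext X
  obtain ⟨η, rfl⟩ := exists_coordTangent he hy X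
  rw [inner_coordTangent, hξ]
  have expand : coordTangent e y η = η 0 • coordVec e 0 y + η 1 • coordVec e 1 y := by
    conv_lhs => rw [plane_eq η, coordTangent_add, coordTangent_smul, coordTangent_smul]
    rfl
  rw [expand, map_add, map_smul, map_smul]
  simp
  ring

theorem inner_injective (x : M) : Function.Injective (g.inner x) := by
  rw [injective_iff_map_eq_zero]
  intro X hX
  by_contra h
  have := g.pos x X h
  rw [hX] at this
  simp at this

theorem span_singleton_smul {E : Type*} [AddCommGroup E] [Module ℝ E] {c : ℝ} (hc : c ≠ 0) (v : E) :
    Submodule.span ℝ {c • v} = Submodule.span ℝ {v} :=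
  Submodule.span_singleton_smul_eq (IsUnit.mk0 c hc) v

/-- A nonzero multiple of `η⁰ η¹ (η⁰ + η¹)` has three distinct real roots. -/
theorem ncard_realRoots (he : e ∈ IsManifold.maximalAtlas (𝓡 2) ∞ M) {x : M} (hx : x ∈ e.source)
    {I : (x : M) → Covector x → ℝ} {K : ℝ} (hK : K ≠ 0)
    (hI : ∀ X : TangentSpace (𝓡 2) x, ∀ η : Plane, η = mfderiv (𝓡 2) (𝓡 2) e x X →
      I x (g.inner x X) = K * (η 0 * η 1 * (η 0 + η 1))) :
    (realRoots I x).ncard = 3 := by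
  obtain ⟨y, hy, rfl⟩ := exists_eq_symm e hx
  have hI' : ∀ η, I (e.symm y) (g.inner _ (coordTangent e y η)) =
      K * (η 0 * η 1 * (η 0 + η 1)) := fun η =>
    hI _ η (mfderiv_coordTangent he hy η).symm
  set A : Plane → Covector (e.symm y) := fun η => g.inner _ (coordTangent e y η) with hA
  have hAs : ∀ (c : ℝ) (η : Plane), A (c • η) = c • A η := fun c η => by
    simp only [hA, coordTangent_smul, map_smul]
  have hAi : Function.Injective A := fun η η' h => by
    have h1 := inner_injective g _ h
    rw [← mfderiv_coordTangent he hy η, ← mfderiv_coordTangent he hy η', h1]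
  have hA0 : A 0 = 0 := by simpa using hAs 0 0
  have hmem : ∀ η : Plane, η ≠ 0 → η 0 * η 1 * (η 0 + η 1) = 0 →
      Submodule.span ℝ {A η} ∈ realRoots I (e.symm y) := fun η h0 h =>
    ⟨A η, fun h => h0 (hAi (h.trans hA0.symm)), by rw [hI', h, mul_zero], rfl⟩
  have hne : ∀ η η' : Plane, η 0 * η' 1 ≠ η 1 * η' 0 →
      Submodule.span ℝ {A η} ≠ Submodule.span ℝ {A η'} := fun η η' h hs => by
    have h1 : A η ∈ Submodule.span ℝ {A η'} := hs ▸ Submodule.mem_span_singleton_self _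
    obtain ⟨c, hc⟩ := Submodule.mem_span_singleton.1 h1
    rw [← hAs] at hc
    apply h
    rw [← hAi hc]
    simp
    ring
  -- The roots come from the solutions `(0, 1)`, `(1, 0)`, `(1, -1)` of `η⁰ = 0`, `η¹ = 0`, `η⁰ + η¹
  -- = 0`.
  rw [Set.ncard_eq_three]
  refine ⟨Submodule.span ℝ {A !₂[0, 1]}, Submodule.span ℝ {A !₂[1, 0]},
    Submodule.span ℝ {A !₂[1, -1]}, hne _ _ (by simp), hne _ _ (by simp), hne _ _ (by simp), ?_⟩
  ext l
  simp only [Set.mem_insert_iff, Set.mem_singleton_iff]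
  constructor
  · rintro ⟨α, h0, hα, rfl⟩
    obtain ⟨X, rfl⟩ := exists_inner_eq g he (e.map_target hy) α
    obtain ⟨η, rfl⟩ := exists_coordTangent he hy X
    change I (e.symm y) (A η) = 0 at hα
    change A η ≠ 0 at h0
    change Submodule.span ℝ {A η} = _ ∨ Submodule.span ℝ {A η} = _ ∨ Submodule.span ℝ {A η} = _
    rw [hI'] at hα
    have hη : η ≠ 0 := fun h => h0 (h ▸ hA0)
    have key : ∀ (c : ℝ) (v : Plane), η = c • v → Submodule.span ℝ {A η} = Submodule.span ℝ {A v} :=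
      fun c v h => by
        have hc : c ≠ 0 := by rintro rfl; exact hη (by simpa using h)
        rw [h, hAs, span_singleton_smul hc]
    rcases mul_eq_zero.1 ((mul_eq_zero.1 hα).resolve_left hK) with h | h
    · rcases mul_eq_zero.1 h with h | h
      · left
        exact key (η 1) _ (by ext i; fin_cases i <;> simp [h])
      · right; left
        exact key (η 0) _ (by ext i; fin_cases i <;> simp [h])
    · right; right
      exact key (η 0) _ (by ext i; fin_cases i <;> simp; linarith)
  · have nz : ∀ (η : Plane) (i : Fin 2), η i ≠ 0 → η ≠ 0 := fun η i h h' => h (by simp [h'])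
    rintro (rfl | rfl | rfl)
    · exact hmem _ (nz _ 1 (by simp)) (by simp)
    · exact hmem _ (nz _ 0 (by simp)) (by simp)
    · exact hmem _ (nz _ 0 (by simp)) (by simp)

end ThreeLines

section ChartCubic

variable (g : Metric M) {e : OpenPartialHomeomorph M Plane}

/-- Each of the three linear factors in the momenta equals `det G` times the corresponding linear
form in the velocity, so two of the three determinants cancel against the denominator. -/
theorem chartCubic_inner (he : e ∈ IsManifold.maximalAtlas (𝓡 2) ∞ M) {x : M} (hx : x ∈ e.source)
    (X : TangentSpace (𝓡 2) x) (η : Plane) (hη : η = mfderiv (𝓡 2) (𝓡 2) e x X) :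
    chartCubic g e x (g.inner x X) =
      (coordMetric g e (e x)).det * (η 0 * η 1 * (η 0 + η 1)) := by
  obtain ⟨y, hy, rfl⟩ := exists_eq_symm e hx
  obtain ⟨ξ, rfl⟩ := exists_coordTangent he hy X
  rw [mfderiv_coordTangent he hy] at hη
  subst hη
  have hq : ∀ i, g.inner (e.symm y) (coordTangent e y η)
      ((mfderiv (𝓡 2) (𝓡 2) e.symm (e (e.symm y)) (basisVec i) : Plane) :
        TangentSpace (𝓡 2) (e.symm y)) =
      lower (coordMetric g e) y η i := by
    intro i
    rw [e.right_inv hy]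
    refine (inner_coordTangent g y η (basisVec i)).trans ?_
    fin_cases i <;> simp
  rw [chartCubic]
  simp only [hq]
  rw [e.right_inv hy]
  have hd := (coordMetric_det_pos g he hy).ne'
  have hD : (coordMetric g e y).det = coordMetric g e y 0 0 * coordMetric g e y 1 1 -
      coordMetric g e y 0 1 ^ 2 := by
    rw [Matrix.det_fin_two, coordMetric_symm]; ring
  rw [← hD]
  generalize (coordMetric g e y).det = D at *
  simp only [lower_zero, lower_one, coordMetric_symm]
  field_simp
  rw [hD]
  ring

theorem zeroDirections_eq_chartWeb {x : M} {I : (x : M) → Covector x → ℝ} {K : ℝ} (hK : K ≠ 0)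
    (hI : ∀ X : TangentSpace (𝓡 2) x, ∀ η : Plane, η = mfderiv (𝓡 2) (𝓡 2) e x X →
      I x (g.inner x X) = K * (η 0 * η 1 * (η 0 + η 1))) :
    zeroDirections g I x = chartWeb e x := by
  ext L
  constructor
  · rintro ⟨ξ, h0, hξ, hL⟩
    rw [hI ξ _ rfl] at hξ
    exact ⟨ξ, h0, hL, _, rfl, (mul_eq_zero.1 hξ).resolve_left hK⟩
  · rintro ⟨ξ, h0, hL, η, hη, h⟩
    exact ⟨ξ, h0, by rw [hI ξ η hη, h, mul_zero], hL⟩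

theorem zeroDirections_chartCubic (he : e ∈ IsManifold.maximalAtlas (𝓡 2) ∞ M) {x : M}
    (hx : x ∈ e.source) : zeroDirections g (chartCubic g e) x = chartWeb e x :=
  zeroDirections_eq_chartWeb g (coordMetric_det_pos g he (e.map_source hx)).ne'
    fun X η hη => chartCubic_inner g he hx X η hη

theorem hasThreeRealRoots_chartCubic (he : e ∈ IsManifold.maximalAtlas (𝓡 2) ∞ M) :
    HasThreeRealRoots (chartCubic g e) e.source := fun _ hx =>
  ncard_realRoots g he hx (coordMetric_det_pos g he (e.map_source hx)).ne'
    fun X η hη => chartCubic_inner g he hx X η hη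

end ChartCubic
end GeodesicWeb

/-! ### Geodesic leaves, changes of chart and the integral of a flat geodesic web -/

namespace GeodesicWeb

open scoped Topology

theorem covAccel_eq (G : Plane → Matrix (Fin 2) (Fin 2) ℝ) (c : ℝ → Plane) (t : ℝ) (k : Fin 2) :
    covAccel G c t k = (deriv (deriv c) t + christoffelQuad G (c t) (deriv c t)) k := by
  fin_cases k <;> simp [covAccel, christoffelQuad]

theorem hasDerivAt_of_contDiffOn_Ioo {c : ℝ → Plane} {a b t : ℝ}
    (hc : ContDiffOn ℝ ∞ c (Set.Ioo a b)) (ht : t ∈ Set.Ioo a b) :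
    HasDerivAt c (deriv c t) t ∧ HasDerivAt (deriv c) (deriv (deriv c) t) t := by
  have h := hc.contDiffAt (isOpen_Ioo.mem_nhds ht)
  refine ⟨(h.differentiableAt (by simp)).hasDerivAt, ?_⟩
  have h2 : ContDiffOn ℝ ∞ (deriv c) (Set.Ioo a b) :=
    ((contDiffOn_infty_iff_deriv_of_isOpen isOpen_Ioo).1 hc).2
  exact ((h2.contDiffAt (isOpen_Ioo.mem_nhds ht)).differentiableAt (by simp)).hasDerivAt

/-- A form vanishing along an unparametrized geodesic. -/
theorem covDiag_eq_zero_of_curve {G : Plane → Matrix (Fin 2) (Fin 2) ℝ}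
    {θ : Plane → Plane →L[ℝ] ℝ} {c : ℝ → Plane} {a b t r : ℝ}
    (hc : ContDiffOn ℝ ∞ c (Set.Ioo a b)) (ht : t ∈ Set.Ioo a b)
    (hθ : DifferentiableAt ℝ θ (c t)) (h0 : ∀ s ∈ Set.Ioo a b, θ (c s) (deriv c s) = 0)
    (hr : ∀ k, covAccel G c t k = r * deriv c t k) : covDiag G θ (c t) (deriv c t) = 0 := by
  obtain ⟨h1, h2⟩ := hasDerivAt_of_contDiffOn_Ioo hc ht
  have h3 : HasDerivAt (fun s => θ (c s)) (fderiv ℝ θ (c t) (deriv c t)) t :=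
    hθ.hasFDerivAt.comp_hasDerivAt t h1
  have h4 := h3.clm_apply h2
  have h5 : HasDerivAt (fun s => θ (c s) (deriv c s)) 0 t :=
    (hasDerivAt_const t (0 : ℝ)).congr_of_eventuallyEq
      (Filter.eventuallyEq_of_mem (isOpen_Ioo.mem_nhds ht) h0)
  have h6 := h4.unique h5
  have h7 : deriv (deriv c) t = r • deriv c t - christoffelQuad G (c t) (deriv c t) := by
    rw [eq_sub_iff_add_eq]
    ext k
    rw [← covAccel_eq, hr]
    rfl
  rw [h7, map_sub, map_smul, h0 t ht] at h6
  rw [covDiag]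
  simpa [sub_eq_add_neg] using h6

variable {M : Type*} [TopologicalSpace M] [ChartedSpace Plane M] [IsManifold (𝓡 2) ∞ M]

section Transition

variable {e e' : OpenPartialHomeomorph M Plane}

theorem contDiffOn_transition (he : e ∈ IsManifold.maximalAtlas (𝓡 2) ∞ M)
    (he' : e' ∈ IsManifold.maximalAtlas (𝓡 2) ∞ M) :
    ContDiffOn ℝ ∞ (fun y => e (e'.symm y)) (e'.target ∩ e'.symm ⁻¹' e.source) := by
  rw [← contMDiffOn_iff_contDiffOn]
  exact (contMDiffOn_of_mem_maximalAtlas he).comp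
    ((contMDiffOn_symm_of_mem_maximalAtlas he').mono Set.inter_subset_left) fun y hy => hy.2

theorem fderiv_transition (he : e ∈ IsManifold.maximalAtlas (𝓡 2) ∞ M)
    (he' : e' ∈ IsManifold.maximalAtlas (𝓡 2) ∞ M) {y : Plane} (hy : y ∈ e'.target)
    (hy' : e'.symm y ∈ e.source) (ξ : Plane) :
    fderiv ℝ (fun y => e (e'.symm y)) y ξ =
      mfderiv (𝓡 2) (𝓡 2) e (e'.symm y) (coordTangent e' y ξ) := by
  have h1 := (mdifferentiable_chart he').mdifferentiableAt_symm hy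
  have h2 := (mdifferentiable_chart he).mdifferentiableAt hy'
  have h3 := mfderiv_comp (I := 𝓡 2) (I' := 𝓡 2) (I'' := 𝓡 2) y h2 h1
  rw [← mfderiv_eq_fderiv]
  change mfderiv (𝓡 2) (𝓡 2) (e ∘ e'.symm) y ξ = _
  rw [h3]
  rfl

theorem fderiv_transition_eq_zero (he : e ∈ IsManifold.maximalAtlas (𝓡 2) ∞ M)
    (he' : e' ∈ IsManifold.maximalAtlas (𝓡 2) ∞ M) {y : Plane} (hy : y ∈ e'.target)
    (hy' : e'.symm y ∈ e.source) {ξ : Plane} (h : fderiv ℝ (fun y => e (e'.symm y)) y ξ = 0) :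
    ξ = 0 := by
  rw [fderiv_transition he he' hy hy'] at h
  rw [← coordTangent_eq_zero he' hy, ← mfderiv_symm_mfderiv he hy' (coordTangent e' y ξ)]
  exact (congrArg _ h).trans (map_zero (mfderiv (𝓡 2) (𝓡 2) e.symm (e (e'.symm y))))

theorem fderiv_transition_apply (he : e ∈ IsManifold.maximalAtlas (𝓡 2) ∞ M)
    (he' : e' ∈ IsManifold.maximalAtlas (𝓡 2) ∞ M) {y : Plane} (hy : y ∈ e'.target)
    (hy' : e'.symm y ∈ e.source) (ξ : Plane) (i : Fin 2) :
    fderiv ℝ (fun y => e (e'.symm y) i) y ξ = fderiv ℝ (fun y => e (e'.symm y)) y ξ i := by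
  have hΩ : IsOpen (e'.target ∩ e'.symm ⁻¹' e.source) := e'.isOpen_inter_preimage_symm e.open_source
  have h := (differentiableAt_of_contDiffOn hΩ (contDiffOn_transition he he') ⟨hy, hy'⟩).hasFDerivAt
  have h2 := (EuclideanSpace.proj i : Plane →L[ℝ] ℝ).hasFDerivAt.comp y h
  exact DFunLike.congr_fun h2.fderiv ξ

theorem inner_eq_lower (g : Metric M) (he : e ∈ IsManifold.maximalAtlas (𝓡 2) ∞ M) {x : M}
    (hx : x ∈ e.source) (X Y : TangentSpace (𝓡 2) x) (ξ η : Plane)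
    (hξ : ξ = mfderiv (𝓡 2) (𝓡 2) e x X) (hη : η = mfderiv (𝓡 2) (𝓡 2) e x Y) :
    g.inner x X Y = lower (coordMetric g e) (e x) ξ 0 * η 0 +
      lower (coordMetric g e) (e x) ξ 1 * η 1 := by
  obtain ⟨y, hy, rfl⟩ := exists_eq_symm e hx
  obtain ⟨ξ', rfl⟩ := exists_coordTangent he hy X
  obtain ⟨η', rfl⟩ := exists_coordTangent he hy Y
  rw [mfderiv_coordTangent he hy] at hξ hη
  subst hξ hη
  rw [e.right_inv hy, inner_coordTangent]

/-- The differential of the `i`-th coordinate of the chart `e`, in the chart `e'`. -/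
def coordForm (e e' : OpenPartialHomeomorph M Plane) (i : Fin 2) (y : Plane) : Plane →L[ℝ] ℝ :=
  fderiv ℝ (fun y => e (e'.symm y) i) y

theorem coordForm_apply (he : e ∈ IsManifold.maximalAtlas (𝓡 2) ∞ M)
    (he' : e' ∈ IsManifold.maximalAtlas (𝓡 2) ∞ M) {y : Plane} (hy : y ∈ e'.target)
    (hy' : e'.symm y ∈ e.source) (ξ : Plane) (i : Fin 2) :
    coordForm e e' i y ξ = fderiv ℝ (fun y => e (e'.symm y)) y ξ i :=
  fderiv_transition_apply he he' hy hy' ξ i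

theorem contDiffOn_coordForm (he : e ∈ IsManifold.maximalAtlas (𝓡 2) ∞ M)
    (he' : e' ∈ IsManifold.maximalAtlas (𝓡 2) ∞ M) (i : Fin 2) :
    ContDiffOn ℝ ∞ (coordForm e e' i) (e'.target ∩ e'.symm ⁻¹' e.source) := by
  have hΩ : IsOpen (e'.target ∩ e'.symm ⁻¹' e.source) := e'.isOpen_inter_preimage_symm e.open_source
  exact ((contDiff_coord i).comp_contDiffOn (contDiffOn_transition he he')).fderiv_of_isOpen hΩ
    (by simp)

theorem curl_coordForm (he : e ∈ IsManifold.maximalAtlas (𝓡 2) ∞ M)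
    (he' : e' ∈ IsManifold.maximalAtlas (𝓡 2) ∞ M) {y : Plane} (hy : y ∈ e'.target)
    (hy' : e'.symm y ∈ e.source) (i : Fin 2) : curl (coordForm e e' i) y = 0 := by
  have hΩ : IsOpen (e'.target ∩ e'.symm ⁻¹' e.source) := e'.isOpen_inter_preimage_symm e.open_source
  have h := ((contDiff_coord i).comp_contDiffOn (contDiffOn_transition he he')).contDiffAt
    (hΩ.mem_nhds ⟨hy, hy'⟩)
  exact sub_eq_zero.2 ((h.isSymmSndFDerivAt
    (by rw [minSmoothness_of_isRCLikeNormedField]; exact WithTop.coe_le_coe.2 (le_top (a := (2 : ℕ∞))))).eq _ _)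

/-- The wedge of the differentials of the coordinates of `e` is the Jacobian determinant of the
transition, and Gram determinants scale with its square. -/
theorem det_coordMetric_transition (g : Metric M) (he : e ∈ IsManifold.maximalAtlas (𝓡 2) ∞ M)
    (he' : e' ∈ IsManifold.maximalAtlas (𝓡 2) ∞ M) {y : Plane} (hy : y ∈ e'.target)
    (hy' : e'.symm y ∈ e.source) :
    (coordMetric g e' y).det = (coordMetric g e (e (e'.symm y))).det *
      wedge (coordForm e e' 0 y) (coordForm e e' 1 y) ^ 2 := by
  have h : ∀ i j, coordMetric g e' y i j = _ := fun i j =>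
    inner_eq_lower g he hy' (coordVec e' i y) (coordVec e' j y) _ _
      (fderiv_transition he he' hy hy' _) (fderiv_transition he he' hy hy' _)
  rw [Matrix.det_fin_two, Matrix.det_fin_two, h, h, h, h]
  simp only [wedge, coordForm_apply he he' hy hy', lower_zero, lower_one, coordMetric_symm]
  ring

/-- The prefactor `det / wedge²` in the chart `e'` is exactly the metric determinant in `e`, so the
cubic of `e` has normal form with the closed forms `du` and `dv` in every chart. -/
theorem inChart_chartCubic_lower (g : Metric M) (he : e ∈ IsManifold.maximalAtlas (𝓡 2) ∞ M)
    (he' : e' ∈ IsManifold.maximalAtlas (𝓡 2) ∞ M) {y : Plane} (hy : y ∈ e'.target)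
    (hy' : e'.symm y ∈ e.source) (ξ : Plane) :
    inChart (chartCubic g e) e' y (lower (coordMetric g e') y ξ) =
      normalCubic (coordMetric g e' y).det (coordForm e e' 0 y) (coordForm e e' 1 y) ξ := by
  have hd := det_coordMetric_transition g he he' hy hy'
  have hd' := coordMetric_det_pos g he' hy
  have hw : wedge (coordForm e e' 0 y) (coordForm e e' 1 y) ≠ 0 := by
    intro h; rw [hd, h] at hd'; simp at hd'
  rw [inChart_lower g he' hy,
    chartCubic_inner g he hy' _ _ (fderiv_transition he he' hy hy' ξ), normalCubic, hd,
    coordForm_apply he he' hy hy', coordForm_apply he he' hy hy']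
  field_simp

/-- If the web of `e` is geodesic, the forms `du`, `dv`, `du + dv` defining it have no geodesic
defect along their kernels, in every chart `e'`. -/
theorem covDiag_eq_zero_of_isGeodesic {g : Metric M}
    (he : e ∈ IsManifold.maximalAtlas (𝓡 2) ∞ M)
    (hgeo : IsGeodesic g (chartWeb e) e.source)
    (he' : e' ∈ IsManifold.maximalAtlas (𝓡 2) ∞ M) {y : Plane} (hy : y ∈ e'.target)
    (hy' : e'.symm y ∈ e.source) {θ : Plane → Plane →L[ℝ] ℝ} (hθd : DifferentiableAt ℝ θ y)
    (s t : ℝ) (hθ : ∀ z ∈ e'.target ∩ e'.symm ⁻¹' e.source, ∀ ξ,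
      θ z ξ = s * coordForm e e' 0 z ξ + t * coordForm e e' 1 z ξ)
    (hst : ∀ η : Plane, s * η 0 + t * η 1 = 0 → η 0 * η 1 * (η 0 + η 1) = 0)
    {ξ : Plane} (h0 : θ y ξ = 0) : covDiag (coordMetric g e') θ y ξ = 0 := by
  -- The geodesic hypothesis speaks of regular curves only, so the zero vector is treated
  -- separately.
  by_cases hξ : ξ = 0
  · rw [hξ, covDiag]
    have : christoffelQuad (coordMetric g e') y 0 = 0 := by
      ext i; fin_cases i <;> simp [christoffelQuad]
    simp [this]
  set φ : Plane → Plane := fun y => e (e'.symm y) with hφ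
  set ψ : Plane → Plane := fun y => e' (e.symm y) with hψ
  set Ω := e'.target ∩ e'.symm ⁻¹' e.source with hΩ
  set Ω' := e.target ∩ e.symm ⁻¹' e'.source with hΩ'
  have hΩo : IsOpen Ω := e'.isOpen_inter_preimage_symm e.open_source
  have hΩ'o : IsOpen Ω' := e.isOpen_inter_preimage_symm e'.open_source
  have hφs := contDiffOn_transition he he'
  have hψs := contDiffOn_transition he' he
  have hψΩ : ∀ z ∈ Ω', ψ z ∈ Ω := fun z hz => by
    have h1 : e.symm z ∈ e'.source := hz.2
    refine ⟨e'.map_source h1, ?_⟩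
    change e'.symm (e' (e.symm z)) ∈ e.source
    rw [e'.left_inv h1]
    exact e.map_target hz.1
  have hφψ : ∀ z ∈ Ω', φ (ψ z) = z := fun z hz => by
    have h1 : e.symm z ∈ e'.source := hz.2
    change e (e'.symm (e' (e.symm z))) = z
    rw [e'.left_inv h1, e.right_inv hz.1]
  have hψφ : ψ (φ y) = y := by
    change e' (e.symm (e (e'.symm y))) = y
    rw [e.left_inv hy', e'.right_inv hy]
  have hφy : φ y ∈ Ω' := ⟨e.map_source hy', by
    change e.symm (e (e'.symm y)) ∈ e'.source
    rw [e.left_inv hy']; exact e'.map_target hy⟩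
  set η := fderiv ℝ φ y ξ with hη
  have hη0 : η ≠ 0 := fun h => hξ (fderiv_transition_eq_zero he he' hy hy' h)
  have hsη : s * η 0 + t * η 1 = 0 := by
    rw [hθ y ⟨hy, hy'⟩, coordForm_apply he he' hy hy', coordForm_apply he he' hy hy'] at h0
    exact h0
  -- In the chart `e` the web has constant coefficients, so the straight line with direction `η` is
  -- a leaf. Its image in `e'` is the curve to which the geodesic hypothesis is applied.
  set l : ℝ → Plane := fun τ => φ y + τ • η with hl
  have hls : ContDiff ℝ ∞ l := contDiff_const.add (contDiff_id.smul contDiff_const)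
  have hld : ∀ τ, HasDerivAt l η τ := fun τ => by
    have h := ((hasDerivAt_id τ).smul_const η).const_add (φ y)
    rwa [one_smul] at h
  have hl0 : l 0 = φ y := by simp [hl]
  obtain ⟨ε, hε, hball⟩ := Metric.isOpen_iff.1 (hΩ'o.preimage hls.continuous) 0
    (show l 0 ∈ Ω' from hl0 ▸ hφy)
  have hlΩ : ∀ τ ∈ Set.Ioo (-ε) ε, l τ ∈ Ω' := fun τ hτ => hball (by
    rw [Metric.mem_ball, Real.dist_eq, sub_zero, abs_lt]; exact hτ)
  set c : ℝ → Plane := fun τ => ψ (l τ) with hc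
  have hcs : ContDiffOn ℝ ∞ c (Set.Ioo (-ε) ε) := hψs.comp hls.contDiffOn hlΩ
  have hc0 : c 0 = y := by rw [hc]; change ψ (l 0) = y; rw [hl0, hψφ]
  have hcd : ∀ τ ∈ Set.Ioo (-ε) ε, fderiv ℝ φ (c τ) (deriv c τ) = η := fun τ hτ => by
    have h1 := (hasDerivAt_of_contDiffOn_Ioo hcs hτ).1
    have h2 := (differentiableAt_of_contDiffOn hΩo hφs
      (hψΩ _ (hlΩ τ hτ))).hasFDerivAt.comp_hasDerivAt τ h1
    have h3 : HasDerivAt (φ ∘ c) η τ := (hld τ).congr_of_eventuallyEq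
      (Filter.eventuallyEq_of_mem (isOpen_Ioo.mem_nhds hτ) fun σ hσ => hφψ _ (hlΩ σ hσ))
    exact h2.unique h3
  have h00 : (0 : ℝ) ∈ Set.Ioo (-ε) ε := ⟨by linarith, hε⟩
  have hc0d : deriv c 0 = ξ := by
    have h1 := hcd 0 h00
    rw [hc0] at h1
    rw [← sub_eq_zero]
    apply fderiv_transition_eq_zero he he' hy hy'
    rw [map_sub, ← hφ, h1, ← hη, sub_self]
  obtain ⟨r, hr⟩ := hgeo e' he' (-ε) ε c hcs (fun τ hτ => by
    have hm := hψΩ _ (hlΩ τ hτ)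
    have hne : deriv c τ ≠ 0 := fun h => hη0 (by rw [← hcd τ hτ, h, map_zero])
    exact ⟨hm, hne, coordTangent e' (c τ) (deriv c τ),
      mt (coordTangent_eq_zero he' hm.1).1 hne, rfl, η,
      (hcd τ hτ).symm.trans (fderiv_transition he he' hm.1 hm.2 _), hst η hsη⟩) 0 h00
  have key := covDiag_eq_zero_of_curve (G := coordMetric g e') (θ := θ) hcs h00
    (by rw [hc0]; exact hθd) (fun τ hτ => by
      have hm := hψΩ _ (hlΩ τ hτ)
      rw [hθ _ hm, coordForm_apply he he' hm.1 hm.2, coordForm_apply he he' hm.1 hm.2,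
        ← hφ, hcd τ hτ, hsη]) hr
  rwa [hc0, hc0d] at key

/-- In any chart the forms `du`, `dv` are closed as differentials, and the geodesic web removes the
three defects, for `du`, `dv` and `du + dv`; the bracket identity then has no term left. -/
theorem isCubicIntegral_chartCubic (g : Metric M) (he : e ∈ IsManifold.maximalAtlas (𝓡 2) ∞ M)
    (hgeo : IsGeodesic g (chartWeb e) e.source) :
    IsCubicIntegral g (chartCubic g e) e.source := by
  have hw : ∀ e' ∈ IsManifold.maximalAtlas (𝓡 2) ∞ M,
      ∀ y ∈ e'.target ∩ e'.symm ⁻¹' e.source,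
      wedge (coordForm e e' 0 y) (coordForm e e' 1 y) ≠ 0 := fun e' he' y hy h => by
    have hd' := coordMetric_det_pos g he' hy.1
    rw [det_coordMetric_transition g he he' hy.1 hy.2, h] at hd'
    simp at hd'
  have hco : ∀ e' ∈ IsManifold.maximalAtlas (𝓡 2) ∞ M, ∃ a : Fin 4 → Plane → ℝ,
    (∀ k, ContDiffOn ℝ ∞ (a k) (e'.target ∩ e'.symm ⁻¹' e.source)) ∧
    ∀ y ∈ e'.target ∩ e'.symm ⁻¹' e.source, ∀ p : Plane,
      inChart (chartCubic g e) e' y p = cubicForm (fun k => a k y) p := fun e' he' =>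
    exists_cubic_coefficients (G := coordMetric g e')
      (fun i j => (contDiffOn_coordMetric g he' i j).mono Set.inter_subset_left)
      (fun y hy => (coordMetric_det_pos g he' hy.1).ne')
      (contDiffOn_coordForm he he' 0) (contDiffOn_coordForm he he' 1) (hw e' he')
      fun y hy ξ => inChart_chartCubic_lower g he he' hy.1 hy.2 ξ
  refine ⟨hco, fun e' he' y hy p => ?_⟩
  obtain ⟨a, ha, hI⟩ := hco e' he'
  have hΩo : IsOpen (e'.target ∩ e'.symm ⁻¹' e.source) :=
    e'.isOpen_inter_preimage_symm e.open_source
  have h₁ := differentiableAt_of_contDiffOn hΩo (contDiffOn_coordForm he he' 0) hy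
  have h₂ := differentiableAt_of_contDiffOn hΩo (contDiffOn_coordForm he he' 1) hy
  exact commutes_of_closed_of_geodesic
    (fun i j => differentiableAt_of_contDiffOn e'.open_target
      (contDiffOn_coordMetric g he' i j) hy.1)
    (coordMetric_det_pos g he' hy.1).ne' (fun z => coordMetric_symm g z) h₁ h₂ (hw e' he' y hy)
    (Filter.mem_of_superset (hΩo.mem_nhds hy) fun z hz ξ =>
      inChart_chartCubic_lower g he he' hz.1 hz.2 ξ)
    (differentiableAt_of_cubic hΩo ha hI hy)
    (curl_coordForm he he' hy.1 hy.2 0) (curl_coordForm he he' hy.1 hy.2 1)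
    (covDiag_eq_zero_of_isGeodesic he hgeo he' hy.1 hy.2 h₁ 1 0 (fun z _ ξ => by ring)
      (fun η h => by rw [show η 0 = 0 by linarith]; ring) (apply_kerVec_self _))
    (covDiag_eq_zero_of_isGeodesic he hgeo he' hy.1 hy.2 h₂ 0 1 (fun z _ ξ => by ring)
      (fun η h => by rw [show η 1 = 0 by linarith]; ring) (apply_kerVec_self _))
    (covDiag_eq_zero_of_isGeodesic he hgeo he' hy.1 hy.2 (h₁.add h₂) 1 1
      (fun z _ ξ => by simp)
      (fun η h => by rw [show η 0 + η 1 = 0 by linarith]; ring) (apply_kerVec_self _)) p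

end Transition
end GeodesicWeb

/-! ### Simple roots of binary cubics and the normal form -/

namespace GeodesicWeb

open scoped Topology

section Roots

theorem exists_smul_of_cross_eq_zero {p q : Plane} (hq : q ≠ 0) (h : cross p q = 0) :
    ∃ c : ℝ, p = c • q := by
  rw [cross] at h
  by_cases h0 : q 0 = 0
  · have h1 : q 1 ≠ 0 := fun h1 => hq (by ext i; fin_cases i <;> simp [h0, h1])
    have : p 0 = 0 := by simpa [h0, h1] using h
    exact ⟨p 1 / q 1, by ext i; fin_cases i <;> simp [h0, h1, this]⟩
  · refine ⟨p 0 / q 0, ?_⟩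
    ext i
    fin_cases i
    · simp [h0]
    · simp
      field_simp
      linarith

theorem cross_smul_left (c : ℝ) (p q : Plane) : cross (c • p) q = c * cross p q := by
  simp [cross]; ring

theorem cross_comm (p q : Plane) : cross p q = -cross q p := by
  simp only [cross]; ring

theorem cubicForm_smul (a : Fin 4 → ℝ) (c : ℝ) (p : Plane) :
    cubicForm a (c • p) = c ^ 3 * cubicForm a p := by
  simp only [cubicForm_eq, PiLp.smul_apply, smul_eq_mul]; ring

variable {a : Fin 4 → ℝ}

theorem cross_ne_zero_of_root {m α : Plane} (hm : cubicForm a m ≠ 0) (hα : cubicForm a α = 0)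
    (h0 : α ≠ 0) : cross m α ≠ 0 := by
  intro h
  obtain ⟨c, rfl⟩ := exists_smul_of_cross_eq_zero h0 h
  rw [cubicForm_smul, hα, mul_zero] at hm
  exact hm rfl

theorem ne_zero_of_cross_left {p q : Plane} (h : cross p q ≠ 0) : p ≠ 0 := by
  rintro rfl; simp [cross] at h

theorem ne_zero_of_cross_right {p q : Plane} (h : cross p q ≠ 0) : q ≠ 0 := by
  rintro rfl; simp [cross] at h

/-- The roots of a cubic form with three distinct roots are simple. -/
theorem hasDerivAt_cubicForm_root {α β γ : Plane} (hα : cubicForm a α = 0)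
    (hβ : cubicForm a β = 0) (hγ : cubicForm a γ = 0) (hαβ : cross α β ≠ 0) (hβγ : cross β γ ≠ 0)
    (hαγ : cross α γ ≠ 0) {m : Plane} (hm : cubicForm a m ≠ 0) :
    ∃ K : ℝ, K ≠ 0 ∧ ∀ v, HasDerivAt (fun t : ℝ => cubicForm a (α + t • v)) (K * cross v α) 0 := by
  have h1 := cross_ne_zero_of_root hm hα (ne_zero_of_cross_left hαβ)
  have h2 := cross_ne_zero_of_root hm hβ (ne_zero_of_cross_left hβγ)
  have h3 := cross_ne_zero_of_root hm hγ (ne_zero_of_cross_right hβγ)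
  set C := cross m α * cross m β * cross m γ with hC
  have hC0 : C ≠ 0 := mul_ne_zero (mul_ne_zero h1 h2) h3
  refine ⟨cubicForm a m / C * (cross α β * cross α γ),
    mul_ne_zero (div_ne_zero hm hC0) (mul_ne_zero hαβ hαγ), fun v => ?_⟩
  -- On a line through `α` the factor belonging to `α` is `t` times a constant, so the derivative at
  -- `0` is that constant times the other two factors at `α`.
  have hF : (fun t : ℝ => cubicForm a (α + t • v)) = fun t : ℝ => cubicForm a m / C *
      (t * cross v α * (cross α β + t * cross v β) * (cross α γ + t * cross v γ)) := by
    funext t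
    have h := cubicForm_factor hα hβ hγ hαβ hβγ hαγ m (α + t • v)
    rw [← hC] at h
    rw [div_mul_eq_mul_div, eq_div_iff hC0, h]
    congr 1
    simp only [cross, PiLp.add_apply, PiLp.smul_apply, smul_eq_mul]
    ring
  rw [hF]
  have ht := hasDerivAt_id (0 : ℝ)
  have hd := ((((ht.mul_const (cross v α)).mul ((ht.mul_const (cross v β)).const_add
    (cross α β))).mul ((ht.mul_const (cross v γ)).const_add (cross α γ)))).const_mul
    (cubicForm a m / C)
  refine hd.congr_deriv ?_
  simp
  ring

/-- Each nonzero root of a cubic form with three distinct roots is accompanied by two others. -/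
theorem exists_other_roots {α β γ : Plane} (hα : cubicForm a α = 0)
    (hβ : cubicForm a β = 0) (hγ : cubicForm a γ = 0) (hαβ : cross α β ≠ 0) (hβγ : cross β γ ≠ 0)
    (hαγ : cross α γ ≠ 0) {m : Plane} (hm : cubicForm a m ≠ 0) {p : Plane} (hp : p ≠ 0)
    (h : cubicForm a p = 0) :
    ∃ β' γ', cubicForm a β' = 0 ∧ cubicForm a γ' = 0 ∧ cross p β' ≠ 0 ∧ cross β' γ' ≠ 0 ∧
      cross p γ' ≠ 0 := by
  have hf := cubicForm_factor hα hβ hγ hαβ hβγ hαγ m p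
  rw [h, zero_mul] at hf
  have hf' := (mul_eq_zero.1 hf.symm).resolve_left hm
  have hne : ∀ {δ}, δ ≠ 0 → cross p δ = 0 → ∀ ε, cross δ ε ≠ 0 → cross p ε ≠ 0 := by
    intro δ hδ hpδ ε hδε
    obtain ⟨c, rfl⟩ := exists_smul_of_cross_eq_zero hδ hpδ
    rw [cross_smul_left]
    exact mul_ne_zero (by rintro rfl; simp at hp) hδε
  have hsw : ∀ {δ ε : Plane}, cross δ ε ≠ 0 → cross ε δ ≠ 0 := fun {δ ε} h => by
    rw [cross_comm]; exact neg_ne_zero.2 h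
  rcases mul_eq_zero.1 hf' with hf' | hf'
  · rcases mul_eq_zero.1 hf' with hf' | hf'
    · have := hne (ne_zero_of_cross_left hαβ) hf'
      exact ⟨β, γ, hβ, hγ, this _ hαβ, hβγ, this _ hαγ⟩
    · have := hne (ne_zero_of_cross_left hβγ) hf'
      exact ⟨α, γ, hα, hγ, this _ (hsw hαβ), hαγ, this _ hβγ⟩
  · have := hne (ne_zero_of_cross_right hβγ) hf'
    exact ⟨α, β, hα, hβ, this _ (hsw hαγ), hαβ, this _ (hsw hβγ)⟩

theorem contDiff_cubicForm : ContDiff ℝ ∞ (cubicForm a) := by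
  have h : cubicForm a = fun p => a 0 * p 0 ^ 3 + a 1 * p 0 ^ 2 * p 1 + a 2 * p 0 * p 1 ^ 2
      + a 3 * p 1 ^ 3 := funext (cubicForm_eq a)
  rw [h]
  have h0 := contDiff_coord 0
  have h1 := contDiff_coord 1
  exact (((contDiff_const.mul (h0.pow 3)).add ((contDiff_const.mul (h0.pow 2)).mul h1)).add
    ((contDiff_const.mul h0).mul (h1.pow 2))).add (contDiff_const.mul (h1.pow 3))

/-- The differential of a cubic form at a simple root vanishes only along that root. -/
theorem cross_eq_zero_of_fderiv_eq_zero {p β γ : Plane} (hp : cubicForm a p = 0)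
    (hβ : cubicForm a β = 0) (hγ : cubicForm a γ = 0) (hpβ : cross p β ≠ 0) (hβγ : cross β γ ≠ 0)
    (hpγ : cross p γ ≠ 0) {m : Plane} (hm : cubicForm a m ≠ 0) {v : Plane}
    (hv : fderiv ℝ (cubicForm a) p v = 0) : cross v p = 0 := by
  obtain ⟨K, hK, hd⟩ := hasDerivAt_cubicForm_root hp hβ hγ hpβ hβγ hpγ hm
  have h1 : HasDerivAt (fun t : ℝ => p + t • v) v 0 := by
    have h := ((hasDerivAt_id (0 : ℝ)).smul_const v).const_add p
    rwa [one_smul] at h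
  have h2 : HasFDerivAt (cubicForm a) (fderiv ℝ (cubicForm a) p) (p + (0 : ℝ) • v) := by
    rw [zero_smul, add_zero]
    exact (contDiff_cubicForm.contDiffAt.differentiableAt (by simp)).hasFDerivAt
  have h3 := h2.comp_hasDerivAt (0 : ℝ) h1
  rw [hv] at h3
  exact (mul_eq_zero.1 ((hd v).unique h3)).resolve_left hK

end Roots

section SmoothRoots

variable {a : Fin 4 → Plane → ℝ} {Ω : Set Plane} {y₀ : Plane}

theorem exists_smooth_cubic_root (hΩ : IsOpen Ω) (ha : ∀ k, ContDiffOn ℝ ∞ (a k) Ω)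
    (hy₀ : y₀ ∈ Ω) {α β γ : Plane} (hα : cubicForm (fun k => a k y₀) α = 0)
    (hβ : cubicForm (fun k => a k y₀) β = 0) (hγ : cubicForm (fun k => a k y₀) γ = 0)
    (hαβ : cross α β ≠ 0) (hβγ : cross β γ ≠ 0)
    (hαγ : cross α γ ≠ 0) {m : Plane} (hm : cubicForm (fun k => a k y₀) m ≠ 0) :
    ∃ (U : Set Plane) (A : Plane → Plane), IsOpen U ∧ y₀ ∈ U ∧ ContDiffOn ℝ ∞ A U ∧ A y₀ = α ∧
      ∀ y ∈ U, cubicForm (fun k => a k y) (A y) = 0 := by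
  obtain ⟨K, hK, hd⟩ := hasDerivAt_cubicForm_root hα hβ hγ hαβ hβγ hαγ hm
  have hΩ' : IsOpen (Ω ×ˢ (Set.univ : Set ℝ)) := hΩ.prod isOpen_univ
  have hF : ContDiffOn ℝ ∞ (fun z : Plane × ℝ => cubicForm (fun k => a k z.1) (α + z.2 • β))
      (Ω ×ˢ Set.univ) := by
    have hc : ∀ k, ContDiffOn ℝ ∞ (fun z : Plane × ℝ => a k z.1) (Ω ×ˢ Set.univ) := fun k =>
      (ha k).comp contDiffOn_fst fun z hz => hz.1
    have hq : ∀ i, ContDiffOn ℝ ∞ (fun z : Plane × ℝ => (α + z.2 • β) i) (Ω ×ˢ Set.univ) :=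
      fun i => ((contDiff_coord i).comp
        (contDiff_const.add (contDiff_snd.smul contDiff_const))).contDiffOn
    simp only [cubicForm_eq]
    exact ((((hc 0).mul ((hq 0).pow 3)).add (((hc 1).mul ((hq 0).pow 2)).mul (hq 1))).add
      (((hc 2).mul (hq 0)).mul ((hq 1).pow 2))).add ((hc 3).mul ((hq 1).pow 3))
  -- The root is sought on the line through `α` in the direction of `β`. This is transverse to `α`,
  -- so the derivative in the parameter is nonzero.
  obtain ⟨U, ρ, hU, hyU, hρ, hρ0, hz⟩ := exists_smooth_root hΩ' hF (y₀ := y₀) (t₀ := 0)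
    ⟨hy₀, Set.mem_univ _⟩ (by simpa using hα) (hd β)
    (mul_ne_zero hK (by rw [cross_comm]; exact neg_ne_zero.2 hαβ))
  exact ⟨U, fun y => α + ρ y • β, hU, hyU, contDiffOn_const.add (hρ.smul contDiffOn_const),
    by simp [hρ0], hz⟩

theorem contDiffOn_cross {A B : Plane → Plane} {U : Set Plane} (hA : ContDiffOn ℝ ∞ A U)
    (hB : ContDiffOn ℝ ∞ B U) : ContDiffOn ℝ ∞ (fun y => cross (A y) (B y)) U := by
  have h : ∀ {C : Plane → Plane}, ContDiffOn ℝ ∞ C U → ∀ i, ContDiffOn ℝ ∞ (fun y => C y i) U :=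
    fun hC i => (contDiff_coord i).comp_contDiffOn hC
  exact ((h hA 0).mul (h hB 1)).sub ((h hA 1).mul (h hB 0))

theorem contDiffOn_cubicForm {Ω : Set Plane} (ha : ∀ k, ContDiffOn ℝ ∞ (a k) Ω) (m : Plane) :
    ContDiffOn ℝ ∞ (fun y => cubicForm (fun k => a k y) m) Ω := by
  simp only [cubicForm_eq]
  exact (((((ha 0).mul contDiffOn_const)).add
    (((ha 1).mul contDiffOn_const).mul contDiffOn_const)).add
    (((ha 2).mul contDiffOn_const).mul contDiffOn_const)).add ((ha 3).mul contDiffOn_const)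

theorem exists_smooth_cubic_roots (hΩ : IsOpen Ω) (ha : ∀ k, ContDiffOn ℝ ∞ (a k) Ω)
    (hy₀ : y₀ ∈ Ω) {α β γ : Plane} (hα : cubicForm (fun k => a k y₀) α = 0)
    (hβ : cubicForm (fun k => a k y₀) β = 0) (hγ : cubicForm (fun k => a k y₀) γ = 0)
    (hαβ : cross α β ≠ 0) (hβγ : cross β γ ≠ 0)
    (hαγ : cross α γ ≠ 0) {m : Plane} (hm : cubicForm (fun k => a k y₀) m ≠ 0) :
    ∃ (U : Set Plane) (A B C : Plane → Plane), IsOpen U ∧ y₀ ∈ U ∧ U ⊆ Ω ∧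
      ContDiffOn ℝ ∞ A U ∧ ContDiffOn ℝ ∞ B U ∧ ContDiffOn ℝ ∞ C U ∧
      ∀ y ∈ U, cubicForm (fun k => a k y) (A y) = 0 ∧ cubicForm (fun k => a k y) (B y) = 0 ∧
        cubicForm (fun k => a k y) (C y) = 0 ∧ cross (A y) (B y) ≠ 0 ∧ cross (B y) (C y) ≠ 0 ∧
        cross (A y) (C y) ≠ 0 ∧ cubicForm (fun k => a k y) m ≠ 0 := by
  have hsw : ∀ {δ ε : Plane}, cross δ ε ≠ 0 → cross ε δ ≠ 0 := fun {δ ε} h => by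
    rw [cross_comm]; exact neg_ne_zero.2 h
  obtain ⟨U₁, A, hU₁, hy₁, hA, hA0, hAz⟩ :=
    exists_smooth_cubic_root hΩ ha hy₀ hα hβ hγ hαβ hβγ hαγ hm
  obtain ⟨U₂, B, hU₂, hy₂, hB, hB0, hBz⟩ :=
    exists_smooth_cubic_root hΩ ha hy₀ hβ hα hγ (hsw hαβ) hαγ hβγ hm
  obtain ⟨U₃, C, hU₃, hy₃, hC, hC0, hCz⟩ :=
    exists_smooth_cubic_root hΩ ha hy₀ hγ hα hβ (hsw hαγ) hαβ (hsw hβγ) hm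
  set U₀ := Ω ∩ (U₁ ∩ (U₂ ∩ U₃)) with hU₀
  have hU₀o : IsOpen U₀ := hΩ.inter (hU₁.inter (hU₂.inter hU₃))
  have hA' := hA.mono (show U₀ ⊆ U₁ from fun y hy => hy.2.1)
  have hB' := hB.mono (show U₀ ⊆ U₂ from fun y hy => hy.2.2.1)
  have hC' := hC.mono (show U₀ ⊆ U₃ from fun y hy => hy.2.2.2)
  have hopen : ∀ {f : Plane → ℝ}, ContDiffOn ℝ ∞ f U₀ → IsOpen (U₀ ∩ f ⁻¹' {0}ᶜ) := fun hf =>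
    hf.continuousOn.isOpen_inter_preimage hU₀o isOpen_compl_singleton
  have hy : y₀ ∈ U₀ := ⟨hy₀, hy₁, hy₂, hy₃⟩
  refine ⟨_, A, B, C, (hopen (contDiffOn_cross hA' hB')).inter
    ((hopen (contDiffOn_cross hB' hC')).inter ((hopen (contDiffOn_cross hA' hC')).inter
      (hopen ((contDiffOn_cubicForm ha m).mono Set.inter_subset_left)))), ?_, ?_, ?_, ?_, ?_, ?_⟩
  · refine ⟨⟨hy, ?_⟩, ⟨hy, ?_⟩, ⟨hy, ?_⟩, hy, hm⟩
    · change cross (A y₀) (B y₀) ≠ 0; rwa [hA0, hB0]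
    · change cross (B y₀) (C y₀) ≠ 0; rwa [hB0, hC0]
    · change cross (A y₀) (C y₀) ≠ 0; rwa [hA0, hC0]
  · exact fun y hy => hy.1.1.1
  · exact hA'.mono fun y hy => hy.1.1
  · exact hB'.mono fun y hy => hy.1.1
  · exact hC'.mono fun y hy => hy.1.1
  · exact fun y hy => ⟨hAz y hy.1.1.2.1, hBz y hy.1.1.2.2.1, hCz y hy.1.1.2.2.2, hy.1.2, hy.2.1.2,
      hy.2.2.1.2, hy.2.2.2.2⟩

/-- The form `ξ ↦ cross (lower G y ξ) α`. -/
def crossForm (G : Plane → Matrix (Fin 2) (Fin 2) ℝ) (A : Plane → Plane) (y : Plane) :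
    Plane →L[ℝ] ℝ :=
  (G y 0 0 * A y 1 - G y 1 0 * A y 0) • (EuclideanSpace.proj 0 : Plane →L[ℝ] ℝ) +
    (G y 0 1 * A y 1 - G y 1 1 * A y 0) • (EuclideanSpace.proj 1 : Plane →L[ℝ] ℝ)

theorem crossForm_apply (G : Plane → Matrix (Fin 2) (Fin 2) ℝ) (A : Plane → Plane) (y ξ : Plane) :
    crossForm G A y ξ = cross (lower G y ξ) (A y) := by
  simp [crossForm, cross]; ring

theorem wedge_crossForm (G : Plane → Matrix (Fin 2) (Fin 2) ℝ) (A B : Plane → Plane) (y : Plane) :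
    wedge (crossForm G A y) (crossForm G B y) = (G y).det * cross (A y) (B y) := by
  rw [Matrix.det_fin_two]
  simp [wedge, crossForm, cross]; ring

theorem contDiffOn_crossForm {G : Plane → Matrix (Fin 2) (Fin 2) ℝ} {A : Plane → Plane}
    {U : Set Plane} (hG : ∀ i j, ContDiffOn ℝ ∞ (fun y => G y i j) U) (hA : ContDiffOn ℝ ∞ A U) :
    ContDiffOn ℝ ∞ (crossForm G A) U := by
  have h : ∀ i, ContDiffOn ℝ ∞ (fun y => A y i) U :=
    fun i => (contDiff_coord i).comp_contDiffOn hA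
  exact ((((hG 0 0).mul (h 1)).sub ((hG 1 0).mul (h 0))).smul contDiffOn_const).add
    ((((hG 0 1).mul (h 1)).sub ((hG 1 1).mul (h 0))).smul contDiffOn_const)

/-- The three roots move smoothly and give three linear factors. The relation between three vectors
of the plane makes the third factor a combination of the other two, and a common scale absorbs the
remaining coefficient. -/
theorem exists_normal_form (hΩ : IsOpen Ω) (ha : ∀ k, ContDiffOn ℝ ∞ (a k) Ω)
    (hy₀ : y₀ ∈ Ω) {α β γ : Plane} (hα : cubicForm (fun k => a k y₀) α = 0)
    (hβ : cubicForm (fun k => a k y₀) β = 0) (hγ : cubicForm (fun k => a k y₀) γ = 0)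
    (hαβ : cross α β ≠ 0) (hβγ : cross β γ ≠ 0)
    (hαγ : cross α γ ≠ 0) {m : Plane} (hm : cubicForm (fun k => a k y₀) m ≠ 0)
    {G : Plane → Matrix (Fin 2) (Fin 2) ℝ} (hG : ∀ i j, ContDiffOn ℝ ∞ (fun y => G y i j) Ω)
    (hdet : ∀ y ∈ Ω, (G y).det ≠ 0) :
    ∃ (U : Set Plane) (θ₁ θ₂ : Plane → Plane →L[ℝ] ℝ), IsOpen U ∧ y₀ ∈ U ∧ U ⊆ Ω ∧
      ContDiffOn ℝ ∞ θ₁ U ∧ ContDiffOn ℝ ∞ θ₂ U ∧ ∀ y ∈ U, wedge (θ₁ y) (θ₂ y) ≠ 0 ∧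
        ∀ ξ, cubicForm (fun k => a k y) (lower G y ξ) = normalCubic (G y).det (θ₁ y) (θ₂ y) ξ := by
  obtain ⟨U, A, B, C, hU, hyU, hUΩ, hA, hB, hC, h⟩ :=
    exists_smooth_cubic_roots hΩ ha hy₀ hα hβ hγ hαβ hβγ hαγ hm
  have hG' : ∀ i j, ContDiffOn ℝ ∞ (fun y => G y i j) U := fun i j => (hG i j).mono hUΩ
  have hdets : ContDiffOn ℝ ∞ (fun y => (G y).det) U := by
    simp only [Matrix.det_fin_two]
    exact ((hG' 0 0).mul (hG' 1 1)).sub ((hG' 0 1).mul (hG' 1 0))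
  have hcm : ContDiffOn ℝ ∞ (fun y => cubicForm (fun k => a k y) m) U :=
    (contDiffOn_cubicForm ha m).mono hUΩ
  have hAB := contDiffOn_cross hA hB
  have hCB := contDiffOn_cross hC hB
  have hAC := contDiffOn_cross hA hC
  have hM : ∀ {D : Plane → Plane}, ContDiffOn ℝ ∞ D U → ContDiffOn ℝ ∞ (fun y => cross m (D y)) U :=
    fun hD => contDiffOn_cross contDiffOn_const hD
  have hne : ∀ y ∈ U, cubicForm (fun k => a k y) m ≠ 0 ∧ (G y).det ≠ 0 ∧ cross (A y) (B y) ≠ 0 ∧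
      cross (C y) (B y) ≠ 0 ∧ cross (A y) (C y) ≠ 0 ∧ cross m (A y) ≠ 0 ∧ cross m (B y) ≠ 0 ∧
      cross m (C y) ≠ 0 := by
    intro y hy
    obtain ⟨h1, h2, h3, h4, h5, h6, h7⟩ := h y hy
    exact ⟨h7, hdet y (hUΩ hy), h4, by rw [cross_comm]; exact neg_ne_zero.2 h5, h6,
      cross_ne_zero_of_root h7 h1 (ne_zero_of_cross_left h4),
      cross_ne_zero_of_root h7 h2 (ne_zero_of_cross_left h5),
      cross_ne_zero_of_root h7 h3 (ne_zero_of_cross_right h5)⟩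
  -- With the scales `μ · (C × B) / (A × B)` and `μ · (A × C) / (A × B)` the two forms add up to `μ`
  -- times the factor of `C`. The normal form is then the product of the three factors divided by `μ
  -- · det G · (C × B) (A × C)`; comparison with `cubicForm_factor` determines `μ`.
  set μ : Plane → ℝ := fun y => cross m (A y) * cross m (B y) * cross m (C y) /
    (cubicForm (fun k => a k y) m * (G y).det * cross (C y) (B y) * cross (A y) (C y)) with hμ
  have hμs : ContDiffOn ℝ ∞ μ U := (((hM hA).mul (hM hB)).mul (hM hC)).div
    (((hcm.mul hdets).mul hCB).mul hAC) fun y hy => by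
      obtain ⟨h1, h2, h3, h4, h5, -⟩ := hne y hy
      exact mul_ne_zero (mul_ne_zero (mul_ne_zero h1 h2) h4) h5
  have hr : ContDiffOn ℝ ∞ (fun y => μ y * (cross (C y) (B y) / cross (A y) (B y))) U :=
    hμs.mul (hCB.div hAB fun y hy => (hne y hy).2.2.1)
  have hs : ContDiffOn ℝ ∞ (fun y => μ y * (cross (A y) (C y) / cross (A y) (B y))) U :=
    hμs.mul (hAC.div hAB fun y hy => (hne y hy).2.2.1)
  have hw : ∀ y, wedge ((μ y * (cross (C y) (B y) / cross (A y) (B y))) • crossForm G A y)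
      ((μ y * (cross (A y) (C y) / cross (A y) (B y))) • crossForm G B y) =
      μ y * (cross (C y) (B y) / cross (A y) (B y)) *
        (μ y * (cross (A y) (C y) / cross (A y) (B y))) * ((G y).det * cross (A y) (B y)) := by
    intro y
    rw [← wedge_crossForm]
    simp only [wedge, smul_apply, smul_eq_mul]
    ring
  have hμ0 : ∀ y ∈ U, μ y ≠ 0 := fun y hy => by
    obtain ⟨h1, h2, h3, h4, h5, h6, h7, h8⟩ := hne y hy
    exact div_ne_zero (mul_ne_zero (mul_ne_zero h6 h7) h8)
      (mul_ne_zero (mul_ne_zero (mul_ne_zero h1 h2) h4) h5)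
  refine ⟨U, fun y => (μ y * (cross (C y) (B y) / cross (A y) (B y))) • crossForm G A y,
    fun y => (μ y * (cross (A y) (C y) / cross (A y) (B y))) • crossForm G B y, hU, hyU, hUΩ,
    hr.smul (contDiffOn_crossForm hG' hA), hs.smul (contDiffOn_crossForm hG' hB),
    fun y hy => ⟨?_, fun ξ => ?_⟩⟩
  · obtain ⟨h1, h2, h3, h4, h5, -⟩ := hne y hy
    have h6 := hμ0 y hy
    rw [hw]
    positivity
  · obtain ⟨h1, h2, h3, h4, h5, h6, h7, h8⟩ := hne y hy
    obtain ⟨k1, k2, k3, k4, k5, k6, -⟩ := h y hy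
    have hμ0' := hμ0 y hy
    have hf := cubicForm_factor k1 k2 k3 k4 k5 k6 m (lower G y ξ)
    have hp : cross (lower G y ξ) (C y) * cross (A y) (B y) =
        cross (C y) (B y) * cross (lower G y ξ) (A y) +
          cross (A y) (C y) * cross (lower G y ξ) (B y) := by
      simp only [cross]; ring
    have hμy : μ y * (cubicForm (fun k => a k y) m * (G y).det * cross (C y) (B y) *
        cross (A y) (C y)) = cross m (A y) * cross m (B y) * cross m (C y) :=
      div_mul_cancel₀ _ (mul_ne_zero (mul_ne_zero (mul_ne_zero h1 h2) h4) h5)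
    rw [normalCubic, hw]
    simp only [smul_apply, smul_eq_mul, crossForm_apply]
    rw [← hμy] at hf
    generalize μ y = μ at *
    generalize cross (lower G y ξ) (A y) = pA at *
    generalize cross (lower G y ξ) (B y) = pB at *
    generalize cross (lower G y ξ) (C y) = pC at *
    generalize cross (A y) (B y) = AB at *
    generalize cross (C y) (B y) = CB at *
    generalize cross (A y) (C y) = AC at *
    generalize cubicForm (fun k => a k y) (lower G y ξ) = F at *
    generalize cubicForm (fun k => a k y) m = Fm at *
    generalize (G y).det = D at *
    field_simp
    rw [← hp]
    apply mul_left_cancel₀ h1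
    linear_combination AB * hf

end SmoothRoots

end GeodesicWeb

/-! ### From cubic integrals to hexagonal geodesic webs -/

namespace GeodesicWeb

open scoped Topology

theorem eq_zero_of_wedge_ne_zero {α β : Plane →L[ℝ] ℝ} (hw : wedge α β ≠ 0) {ξ : Plane}
    (h1 : α ξ = 0) (h2 : β ξ = 0) : ξ = 0 := by
  rw [clm_apply_plane] at h1 h2
  simp only [smul_eq_mul] at h1 h2
  rw [wedge] at hw
  ext i
  apply (mul_eq_zero.1 (?_ : _ * ξ i = 0)).resolve_left hw
  fin_cases i
  · change _ * ξ 0 = 0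
    linear_combination β (basisVec 1) * h1 - α (basisVec 1) * h2
  · change _ * ξ 1 = 0
    linear_combination α (basisVec 0) * h2 - β (basisVec 0) * h1

variable {M : Type*} [TopologicalSpace M] [ChartedSpace Plane M] [IsManifold (𝓡 2) ∞ M]
variable {e : OpenPartialHomeomorph M Plane}

section Covectors

theorem coordCovector_coordTangent (he : e ∈ IsManifold.maximalAtlas (𝓡 2) ∞ M) {y : Plane}
    (hy : y ∈ e.target) (p η : Plane) :
    coordCovector e (e.symm y) p (coordTangent e y η) = p 0 * η 0 + p 1 * η 1 := by
  change inner ℝ p (mfderiv (𝓡 2) (𝓡 2) e (e.symm y) (coordTangent e y η) : Plane) = _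
  rw [mfderiv_coordTangent he hy]
  simp [PiLp.inner_apply, Fin.sum_univ_two]
  ring

theorem exists_coordCovector (he : e ∈ IsManifold.maximalAtlas (𝓡 2) ∞ M) {y : Plane}
    (hy : y ∈ e.target) (A : Covector (e.symm y)) : ∃ p, coordCovector e (e.symm y) p = A := by
  refine ⟨!₂[A (coordVec e 0 y), A (coordVec e 1 y)], ?_⟩
  ext X
  obtain ⟨η, rfl⟩ := exists_coordTangent he hy X
  rw [coordCovector_coordTangent he hy]
  have expand : coordTangent e y η = η 0 • coordVec e 0 y + η 1 • coordVec e 1 y := by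
    conv_lhs => rw [plane_eq η, coordTangent_add, coordTangent_smul, coordTangent_smul]
    rfl
  rw [expand, map_add, map_smul, map_smul]
  simp
  ring

theorem coordCovector_smul (x : M) (c : ℝ) (p : Plane) :
    coordCovector e x (c • p) = c • coordCovector e x p := by
  ext X
  exact real_inner_smul_left p (mfderiv (𝓡 2) (𝓡 2) e x X : Plane) c

theorem coordCovector_injective (he : e ∈ IsManifold.maximalAtlas (𝓡 2) ∞ M) {y : Plane}
    (hy : y ∈ e.target) : Function.Injective (coordCovector e (e.symm y)) := by
  intro p q h
  have h' := fun η => (coordCovector_coordTangent he hy p η).symm.trans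
    ((DFunLike.congr_fun h _).trans (coordCovector_coordTangent he hy q η))
  ext i
  fin_cases i
  · simpa using h' !₂[1, 0]
  · simpa using h' !₂[0, 1]

theorem span_coordCovector_eq_iff (he : e ∈ IsManifold.maximalAtlas (𝓡 2) ∞ M) {y : Plane}
    (hy : y ∈ e.target) {p q : Plane} (hp : p ≠ 0) (hq : q ≠ 0) :
    Submodule.span ℝ {coordCovector e (e.symm y) p} =
      Submodule.span ℝ {coordCovector e (e.symm y) q} ↔ cross p q = 0 := by
  constructor
  · intro h
    have h1 : coordCovector e (e.symm y) p ∈ Submodule.span ℝ {coordCovector e (e.symm y) q} :=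
      h ▸ Submodule.mem_span_singleton_self _
    obtain ⟨c, hc⟩ := Submodule.mem_span_singleton.1 h1
    rw [← coordCovector_smul] at hc
    rw [← coordCovector_injective he hy hc]
    simp [cross]
    ring
  · intro h
    obtain ⟨c, rfl⟩ := exists_smul_of_cross_eq_zero hq h
    rw [coordCovector_smul, span_singleton_smul]
    rintro rfl
    simp at hp

theorem exists_roots_of_ncard (he : e ∈ IsManifold.maximalAtlas (𝓡 2) ∞ M) {y : Plane}
    (hy : y ∈ e.target) {I : (x : M) → Covector x → ℝ} {a : Fin 4 → ℝ}
    (hI : ∀ p, inChart I e y p = cubicForm a p) (h3 : (realRoots I (e.symm y)).ncard = 3) :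
    ∃ α β γ m : Plane, cubicForm a α = 0 ∧ cubicForm a β = 0 ∧ cubicForm a γ = 0 ∧
      cross α β ≠ 0 ∧ cross β γ ≠ 0 ∧ cross α γ ≠ 0 ∧ cubicForm a m ≠ 0 := by
  set l : Plane → Submodule ℝ (Covector (e.symm y)) := fun p =>
    Submodule.span ℝ {coordCovector e (e.symm y) p} with hl
  have hmem : ∀ {L}, L ∈ realRoots I (e.symm y) → ∃ p : Plane, p ≠ 0 ∧ cubicForm a p = 0 ∧
      L = l p := by
    rintro L ⟨A, h0, hA, rfl⟩
    obtain ⟨p, rfl⟩ := exists_coordCovector he hy A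
    refine ⟨p, ?_, by rw [← hI]; exact hA, rfl⟩
    rintro rfl
    apply h0
    simpa using coordCovector_smul (e := e) (e.symm y) 0 0
  have hmem' : ∀ p : Plane, p ≠ 0 → cubicForm a p = 0 → l p ∈ realRoots I (e.symm y) := by
    intro p h0 hp
    refine ⟨coordCovector e (e.symm y) p, fun h => h0 (coordCovector_injective he hy ?_),
      by rw [← hI] at hp; exact hp, rfl⟩
    rw [h]
    simpa using (coordCovector_smul (e := e) (e.symm y) 0 0).symm
  have hcr : ∀ {p q : Plane}, p ≠ 0 → q ≠ 0 → (l p = l q ↔ cross p q = 0) := fun hp hq =>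
    span_coordCovector_eq_iff he hy hp hq
  obtain ⟨L₁, L₂, L₃, h12, h13, h23, hL⟩ := Set.ncard_eq_three.1 h3
  obtain ⟨α, hα0, hα, rfl⟩ := hmem (L := L₁) (by rw [hL]; simp)
  obtain ⟨β, hβ0, hβ, rfl⟩ := hmem (L := L₂) (by rw [hL]; simp)
  obtain ⟨γ, hγ0, hγ, rfl⟩ := hmem (L := L₃) (by rw [hL]; simp)
  have hαβ : cross α β ≠ 0 := mt (hcr hα0 hβ0).2 h12
  have hαγ : cross α γ ≠ 0 := mt (hcr hα0 hγ0).2 h13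
  have hβγ : cross β γ ≠ 0 := mt (hcr hβ0 hγ0).2 h23
  -- If the form vanished identically, every line `α + t β` with `t ≠ 0` would be a root. Being
  -- different from `α` and `β`, it would equal `γ`, which is impossible for both `t = 1` and `t =
  -- 2`.
  have hm : ∃ m, cubicForm a m ≠ 0 := by
    by_contra hcon
    push Not at hcon
    have key : ∀ t : ℝ, t ≠ 0 → l (α + t • β) = l γ := by
      intro t ht
      have c1 : cross (α + t • β) α = -t * cross α β := by simp [cross]; ring
      have c2 : cross (α + t • β) β = cross α β := by simp [cross]; ring
      have h0 : α + t • β ≠ 0 := ne_zero_of_cross_left (c2.symm ▸ hαβ)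
      have := hmem' _ h0 (hcon _)
      rw [hL] at this
      rcases this with h | h | h
      · exact absurd ((hcr h0 hα0).1 h) (by rw [c1]; exact mul_ne_zero (neg_ne_zero.2 ht) hαβ)
      · exact absurd ((hcr h0 hβ0).1 h) (c2.symm ▸ hαβ)
      · exact h
    have c : ∀ t s : ℝ, cross (α + t • β) (α + s • β) = (s - t) * cross α β := fun t s => by
      simp [cross]; ring
    have h1 := (key 1 one_ne_zero).trans (key 2 two_ne_zero).symm
    have c12 : cross (α + (1 : ℝ) • β) (α + (2 : ℝ) • β) ≠ 0 := by
      rw [c]; norm_num; exact hαβ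
    exact c12 ((hcr (ne_zero_of_cross_left c12) (ne_zero_of_cross_right c12)).1 h1)
  obtain ⟨m, hm⟩ := hm
  exact ⟨α, β, γ, m, hα, hβ, hγ, hαβ, hβγ, hαγ, hm⟩

end Covectors

section GeodesicZeros

/-- Along a curve tangent to a zero direction, `I` of the momentum lift is constantly zero.
Differentiating and using the vanishing bracket, the fibre derivative of `I` annihilates the lowered
covariant acceleration. At a simple root that derivative vanishes only along the root, that is,
along the velocity. -/
theorem isGeodesic_zeroDirections {g : Metric M} {V : Set M} (hV : IsOpen V)
    {I : (x : M) → Covector x → ℝ} (hI : IsCubicIntegral g I V) (h3 : HasThreeRealRoots I V) :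
    IsGeodesic g (zeroDirections g I) V := by
  intro e he a b c hc h t ht
  obtain ⟨A, hA, hIA⟩ := hI.cubic e he
  set G := coordMetric g e with hG
  set Ω := e.target ∩ e.symm ⁻¹' V with hΩ
  have hΩo : IsOpen Ω := e.isOpen_inter_preimage_symm hV
  have hzero : ∀ s ∈ Set.Ioo a b, inChart I e (c s) (lower G (c s) (deriv c s)) = 0 := by
    intro s hs
    obtain ⟨hm, h0, X, hX0, hX, hspan⟩ := h s hs
    have h1 : coordTangent e (c s) (deriv c s) ∈ Submodule.span ℝ {X} :=
      hspan ▸ Submodule.mem_span_singleton_self _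
    obtain ⟨r, hr⟩ := Submodule.mem_span_singleton.1 h1
    obtain ⟨ξ, rfl⟩ := exists_coordTangent he hm.1 X
    rw [← inChart_lower g he hm.1 I, hIA _ hm] at hX
    rw [inChart_lower g he hm.1, ← hr, ← coordTangent_smul, ← inChart_lower g he hm.1 I, hIA _ hm]
    have : lower G (c s) (r • ξ) = r • lower G (c s) ξ := by
      ext i; fin_cases i <;> simp [lower] <;> ring
    rw [this]
    exact (cubicForm_smul _ r _).trans (by rw [cubicForm, hX, mul_zero])
  obtain ⟨hm, h0, -⟩ := h t ht
  obtain ⟨h1, h2⟩ := hasDerivAt_of_contDiffOn_Ioo hc ht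
  have hdet := (coordMetric_det_pos g he hm.1).ne'
  have key := hasDerivAt_comp_lower (G := G) (I := inChart I e) (c := c) (ξ := deriv c)
    (differentiableAt_of_cubic hΩo hA hIA hm _)
    (fun i j => differentiableAt_of_contDiffOn e.open_target (contDiffOn_coordMetric g he i j) hm.1)
    hdet (fun z => coordMetric_symm g z) h1 h2
  rw [hI.commutes e he _ hm, zero_add] at key
  have hconst : HasDerivAt (fun s => inChart I e (c s) (lower G (c s) (deriv c s))) 0 t :=
    (hasDerivAt_const t (0 : ℝ)).congr_of_eventuallyEq
      (Filter.eventuallyEq_of_mem (isOpen_Ioo.mem_nhds ht) hzero)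
  have hv := key.unique hconst
  have hfun : inChart I e (c t) = cubicForm (fun k => A k (c t)) := funext (hIA _ hm)
  obtain ⟨α, β, γ, m, hα, hβ, hγ, hαβ, hβγ, hαγ, hm'⟩ :=
    exists_roots_of_ncard he hm.1 (hIA _ hm) (h3 _ hm.2)
  have hcross : ∀ v w, cross (lower G (c t) v) (lower G (c t) w) = (G (c t)).det * cross v w := by
    intro v w
    rw [Matrix.det_fin_two]
    simp only [cross, lower_zero, lower_one]
    ring
  have hp0 : lower G (c t) (deriv c t) ≠ 0 := by
    intro h
    have hpos := coordMetric_pos g he hm.1 h0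
    rw [← hG, h] at hpos
    simp at hpos
  have hz := hzero t ht
  rw [hfun] at hv hz
  obtain ⟨β', γ', hβ', hγ', k1, k2, k3⟩ :=
    exists_other_roots hα hβ hγ hαβ hβγ hαγ hm' hp0 hz
  have hx := cross_eq_zero_of_fderiv_eq_zero hz hβ' hγ' k1 k2 k3 hm' hv
  rw [hcross] at hx
  obtain ⟨r, hr⟩ := exists_smul_of_cross_eq_zero h0 ((mul_eq_zero.1 hx).resolve_left hdet)
  exact ⟨r, fun k => by rw [covAccel_eq, hr]; rfl⟩

end GeodesicZeros

section ChartWeb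

theorem mfderiv_comp_chart (he : e ∈ IsManifold.maximalAtlas (𝓡 2) ∞ M) {x : M}
    (hx : x ∈ e.source) {f : Plane → ℝ} (hf : DifferentiableAt ℝ f (e x))
    (X : TangentSpace (𝓡 2) x) :
    (mfderiv (𝓡 2) 𝓘(ℝ, ℝ) (fun x => f (e x)) x X : ℝ) =
      fderiv ℝ f (e x) (mfderiv (𝓡 2) (𝓡 2) e x X : Plane) := by
  have h1 := (mdifferentiable_chart he).mdifferentiableAt hx
  have h2 := mfderiv_comp (I := 𝓡 2) (I' := 𝓡 2) (I'' := 𝓘(ℝ, ℝ)) x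
    hf.mdifferentiableAt h1
  change mfderiv (𝓡 2) 𝓘(ℝ, ℝ) (f ∘ e) x X = _
  rw [h2, ← mfderiv_eq_fderiv]
  rfl

/-- The linear forms `u, v, -(u + v)`. -/
def webForm : Fin 3 → Plane →L[ℝ] ℝ :=
  ![EuclideanSpace.proj 0, EuclideanSpace.proj 1, -(EuclideanSpace.proj 0 + EuclideanSpace.proj 1)]

theorem webForm_add {i j k : Fin 3} (hij : i ≠ j) (hjk : j ≠ k) (hik : i ≠ k) (η : Plane) :
    webForm i η + webForm j η + webForm k η = 0 := by
  fin_cases i <;> fin_cases j <;> fin_cases k <;> (simp_all [webForm]; try ring)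

/-- The functions `u, v, -(u + v)` whose level curves form the web of the chart. -/
def webFunction (e : OpenPartialHomeomorph M Plane) (i : Fin 3) (x : M) : ℝ := webForm i (e x)

/-- The three functions sum to zero, so adding the relations around the hexagon yields the last one.
No smallness is involved. -/
theorem hexagonsClose_webFunction (p : M) (N : Set M) : HexagonsClose (webFunction e) p N := by
  intro i j k hij hjk hik q _ h0 h1 h2 h3 h4 h5 k0 k1 k2 k3 k4
  have hs : ∀ x, webFunction e i x + webFunction e j x + webFunction e k x = 0 := fun x =>
    webForm_add hij hjk hik (e x)
  linarith [hs p, hs (q 0), hs (q 1), hs (q 2), hs (q 3), hs (q 4), hs (q 5)]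

theorem mem_levelDirection_webFunction (he : e ∈ IsManifold.maximalAtlas (𝓡 2) ∞ M) {x : M}
    (hx : x ∈ e.source) (i : Fin 3) (X : TangentSpace (𝓡 2) x) (η : Plane)
    (hη : η = mfderiv (𝓡 2) (𝓡 2) e x X) :
    X ∈ levelDirection (webFunction e i) x ↔ webForm i η = 0 := by
  have h := mfderiv_comp_chart he hx (f := webForm i) (webForm i).differentiableAt X
  rw [ContinuousLinearMap.fderiv, ← hη] at h
  exact ⟨fun hX => h.symm.trans hX, fun hX => h.trans hX⟩

theorem exists_mfderiv_chart_eq (he : e ∈ IsManifold.maximalAtlas (𝓡 2) ∞ M) {x : M}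
    (hx : x ∈ e.source) (η : Plane) :
    ∃ X : TangentSpace (𝓡 2) x, η = mfderiv (𝓡 2) (𝓡 2) e x X := by
  obtain ⟨y, hy, rfl⟩ := exists_eq_symm e hx
  exact ⟨coordTangent e y η, (mfderiv_coordTangent he hy η).symm⟩

theorem eq_zero_of_mfderiv_chart (he : e ∈ IsManifold.maximalAtlas (𝓡 2) ∞ M) {x : M}
    (hx : x ∈ e.source) {X : TangentSpace (𝓡 2) x}
    (h : (mfderiv (𝓡 2) (𝓡 2) e x X : Plane) = 0) : X = 0 := by
  rw [← mfderiv_symm_mfderiv he hx X]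
  exact (congrArg _ h).trans (map_zero (mfderiv (𝓡 2) (𝓡 2) e.symm (e x)))

theorem levelDirection_webFunction (he : e ∈ IsManifold.maximalAtlas (𝓡 2) ∞ M) {x : M}
    (hx : x ∈ e.source) (i : Fin 3) {X : TangentSpace (𝓡 2) x} (hX : X ≠ 0) (η : Plane)
    (hη : η = mfderiv (𝓡 2) (𝓡 2) e x X) (h0 : webForm i η = 0) :
    levelDirection (webFunction e i) x = Submodule.span ℝ {X} := by
  apply le_antisymm
  · intro Y hY
    rw [mem_levelDirection_webFunction he hx i Y _ rfl] at hY
    set ζ : Plane := mfderiv (𝓡 2) (𝓡 2) e x Y with hζ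
    have hc : cross ζ η = 0 := by
      fin_cases i <;> simp [webForm] at h0 hY
      · simp [cross, h0, hY]
      · simp [cross, h0, hY]
      · rw [cross, show η 1 = -η 0 by linarith, show ζ 1 = -ζ 0 by linarith]; ring
    obtain ⟨c, hc⟩ := exists_smul_of_cross_eq_zero
      (fun h => hX (eq_zero_of_mfderiv_chart he hx (hη.symm.trans h))) hc
    rw [Submodule.mem_span_singleton]
    refine ⟨c, sub_eq_zero.1 (eq_zero_of_mfderiv_chart he hx ?_)⟩
    have hsub : (mfderiv (𝓡 2) (𝓡 2) e x (c • X - Y) : Plane) = c • η - ζ := by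
      rw [map_sub, map_smul, ← hη, ← hζ]
      rfl
    exact hsub.trans (sub_eq_zero.2 hc.symm)
  · rw [Submodule.span_singleton_le_iff_mem]
    exact (mem_levelDirection_webFunction he hx i X η hη).2 h0

/-- A vector annihilated by the `i`-th web form. -/
def webVec : Fin 3 → Plane := ![!₂[0, 1], !₂[1, 0], !₂[1, -1]]

theorem webForm_webVec (i j : Fin 3) : webForm i (webVec j) = 0 ↔ i = j := by
  fin_cases i <;> fin_cases j <;> simp [webForm, webVec]

theorem range_levelDirection_webFunction (he : e ∈ IsManifold.maximalAtlas (𝓡 2) ∞ M) {x : M}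
    (hx : x ∈ e.source) :
    chartWeb e x = Set.range fun i => levelDirection (webFunction e i) x := by
  ext L
  constructor
  · rintro ⟨X, hX, rfl, η, hη, h⟩
    have : ∃ i, webForm i η = 0 := by
      rcases mul_eq_zero.1 h with h | h
      · rcases mul_eq_zero.1 h with h | h
        · exact ⟨0, h⟩
        · exact ⟨1, h⟩
      · exact ⟨2, by simp [webForm]; linarith⟩
    obtain ⟨i, hi⟩ := this
    exact ⟨i, levelDirection_webFunction he hx i hX η hη hi⟩
  · rintro ⟨i, rfl⟩
    obtain ⟨X, hX⟩ := exists_mfderiv_chart_eq he hx (webVec i)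
    have hX0 : X ≠ 0 := by
      rintro rfl
      have h1 : webVec i = 0 := hX.trans (map_zero (mfderiv (𝓡 2) (𝓡 2) e x))
      have h2 := (webForm_webVec (i + 1) i).1 (by rw [h1, map_zero])
      revert h2; fin_cases i <;> decide
    refine ⟨X, hX0, levelDirection_webFunction he hx i hX0 _ hX ((webForm_webVec i i).2 rfl), _,
      hX, ?_⟩
    fin_cases i <;> simp [webVec]

theorem areWebFunctions_chartWeb (he : e ∈ IsManifold.maximalAtlas (𝓡 2) ∞ M) :
    AreWebFunctions (chartWeb e) (webFunction e) e.source where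
  isOpen := e.open_source
  smooth i := (webForm i).contDiff.contMDiff.comp_contMDiffOn
    (contMDiffOn_of_mem_maximalAtlas he)
  submersion i x hx h := by
    obtain ⟨X, hX⟩ := exists_mfderiv_chart_eq he hx (webVec (i + 1))
    have h1 : X ∈ levelDirection (webFunction e i) x := DFunLike.congr_fun h X
    rw [mem_levelDirection_webFunction he hx i X _ hX, webForm_webVec] at h1
    revert h1; fin_cases i <;> decide
  transverse i j hij x hx h := by
    obtain ⟨X, hX⟩ := exists_mfderiv_chart_eq he hx (webVec i)
    have h1 : X ∈ levelDirection (webFunction e i) x :=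
      (mem_levelDirection_webFunction he hx i X _ hX).2 ((webForm_webVec i i).2 rfl)
    rw [h, mem_levelDirection_webFunction he hx j X _ hX, webForm_webVec] at h1
    exact hij h1.symm
  directions x hx := range_levelDirection_webFunction he hx

theorem AreWebFunctions.congr {W W' : (x : M) → Set (Submodule ℝ (TangentSpace (𝓡 2) x))}
    {u : Fin 3 → M → ℝ} {N : Set M} (h : AreWebFunctions W u N) (hW : ∀ x ∈ N, W' x = W x) :
    AreWebFunctions W' u N :=
  ⟨h.isOpen, h.smooth, h.submersion, h.transverse, fun x hx => (hW x hx).trans (h.directions x hx)⟩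

end ChartWeb

section ZeroWeb

/-- Around every point a cubic integral with three distinct real roots is, up to a factor, the
product `du dv (du + dv)` for suitable coordinates `(u, v)`. -/
theorem exists_chart_of_isCubicIntegral {g : Metric M} {V : Set M} (hV : IsOpen V)
    {I : (x : M) → Covector x → ℝ} (hI : IsCubicIntegral g I V) (h3 : HasThreeRealRoots I V)
    {p : M} (hp : p ∈ V) :
    ∃ e ∈ IsManifold.maximalAtlas (𝓡 2) ∞ M, p ∈ e.source ∧ e.source ⊆ V ∧
      ∀ x ∈ e.source, ∃ K : ℝ, K ≠ 0 ∧ ∀ X : TangentSpace (𝓡 2) x, ∀ η : Plane,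
        η = mfderiv (𝓡 2) (𝓡 2) e x X →
          I x (g.inner x X) = K * (η 0 * η 1 * (η 0 + η 1)) := by
  set e₀ := chartAt Plane p with he₀
  have hm : e₀ ∈ IsManifold.maximalAtlas (𝓡 2) ∞ M := IsManifold.chart_mem_maximalAtlas p
  have hps : p ∈ e₀.source := mem_chart_source Plane p
  obtain ⟨a, ha, hIa⟩ := hI.cubic e₀ hm
  set Ω : Set Plane := e₀.target ∩ e₀.symm ⁻¹' V with hΩ
  have hΩo : IsOpen Ω := e₀.isOpen_inter_preimage_symm hV
  have hy₀ : e₀ p ∈ Ω := ⟨e₀.map_source hps, by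
    change e₀.symm (e₀ p) ∈ V; rwa [e₀.left_inv hps]⟩
  obtain ⟨α, β, γ, m, hα, hβ, hγ, hαβ, hβγ, hαγ, hm'⟩ :=
    exists_roots_of_ncard hm hy₀.1 (hIa _ hy₀) (h3 _ hy₀.2)
  have hG : ∀ i j, ContDiffOn ℝ ∞ (fun y => coordMetric g e₀ y i j) Ω := fun i j =>
    (contDiffOn_coordMetric g hm i j).mono Set.inter_subset_left
  have hdet : ∀ y ∈ Ω, (coordMetric g e₀ y).det ≠ 0 := fun y hy =>
    (coordMetric_det_pos g hm hy.1).ne'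
  obtain ⟨U, θ₁, θ₂, hU, hyU, hUΩ, hθ₁, hθ₂, hθ⟩ :=
    exists_normal_form hΩo ha hy₀ hα hβ hγ hαβ hβγ hαγ hm' hG hdet
  have hnf : ∀ y ∈ U, ∀ ξ, inChart I e₀ y (lower (coordMetric g e₀) y ξ) =
      normalCubic (coordMetric g e₀ y).det (θ₁ y) (θ₂ y) ξ := fun y hy ξ =>
    (hIa y (hUΩ hy) _).trans ((hθ y hy).2 ξ)
  have hcurl : ∀ y ∈ U, curl θ₁ y = 0 ∧ curl θ₂ y = 0 := fun y hy =>
    curl_eq_zero_of_commutes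
      (fun i j => differentiableAt_of_contDiffOn hΩo (hG i j) (hUΩ hy)) (hdet y (hUΩ hy))
      (fun z => coordMetric_symm g z) (differentiableAt_of_contDiffOn hU hθ₁ hy)
      (differentiableAt_of_contDiffOn hU hθ₂ hy) (hθ y hy).1
      (Filter.mem_of_superset (hU.mem_nhds hy) hnf)
      (differentiableAt_of_cubic hΩo ha hIa (hUΩ hy)) (hI.commutes e₀ hm y (hUΩ hy))
  -- The closed forms need a disc to have primitives; these primitives become the coordinates `u`
  -- and `v`.
  obtain ⟨r, hr, hball⟩ := Metric.isOpen_iff.1 hU _ hyU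
  obtain ⟨f₁, hf₁, hd₁⟩ := exists_primitive (hθ₁.mono hball) fun y hy => (hcurl y (hball hy)).1
  obtain ⟨f₂, hf₂, hd₂⟩ := exists_primitive (hθ₂.mono hball) fun y hy => (hcurl y (hball hy)).2
  set N : Set M := e₀.source ∩ e₀ ⁻¹' Metric.ball (e₀ p) r with hN
  have hNo : IsOpen N := e₀.isOpen_inter_preimage Metric.isOpen_ball
  have hpN : p ∈ N := ⟨hps, Metric.mem_ball_self hr⟩
  have hsm : ∀ {f : Plane → ℝ}, ContDiffOn ℝ ∞ f (Metric.ball (e₀ p) r) →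
      ContMDiffOn (𝓡 2) 𝓘(ℝ, ℝ) ∞ (fun x => f (e₀ x)) N := fun hf =>
    (contMDiffOn_iff_contDiffOn.2 hf).comp
      ((contMDiffOn_of_mem_maximalAtlas hm).mono Set.inter_subset_left) fun x hx => hx.2
  have hmf : ∀ {f : Plane → ℝ} {θ : Plane → Plane →L[ℝ] ℝ},
      (∀ y ∈ Metric.ball (e₀ p) r, HasFDerivAt f (θ y) y) → ∀ x ∈ N, ∀ X,
      (mfderiv (𝓡 2) 𝓘(ℝ, ℝ) (fun x => f (e₀ x)) x X : ℝ) =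
        θ (e₀ x) (mfderiv (𝓡 2) (𝓡 2) e₀ x X : Plane) := fun hf x hx X => by
    rw [mfderiv_comp_chart hm hx.1 (hf _ hx.2).differentiableAt, (hf _ hx.2).fderiv]
  have hind : ∀ X : TangentSpace (𝓡 2) p,
      (mfderiv (𝓡 2) 𝓘(ℝ, ℝ) (fun x => f₁ (e₀ x)) p X : ℝ) = 0 →
      (mfderiv (𝓡 2) 𝓘(ℝ, ℝ) (fun x => f₂ (e₀ x)) p X : ℝ) = 0 → X = 0 := by
    intro X h1 h2
    rw [hmf hd₁ p hpN] at h1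
    rw [hmf hd₂ p hpN] at h2
    exact eq_zero_of_mfderiv_chart hm hps (eq_zero_of_wedge_ne_zero (hθ _ hyU).1 h1 h2)
  obtain ⟨e, he, hpe, heN, hex, -⟩ :=
    exists_chart_of_functions hNo (hsm hf₁) (hsm hf₂) hpN hind
  have heV : ∀ x ∈ e.source, e₀ x ∈ U := fun x hx => hball (heN hx).2
  refine ⟨e, he, hpe, fun x hx => ?_, fun x hx => ?_⟩
  · have h1 := (hUΩ (heV x hx)).2
    change e₀.symm (e₀ x) ∈ V at h1
    rwa [e₀.left_inv (heN hx).1] at h1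
  · have hcoord : ∀ X : TangentSpace (𝓡 2) x, ∀ η : Plane, η = mfderiv (𝓡 2) (𝓡 2) e x X → ∀ i,
        η i = ![θ₁, θ₂] i (e₀ x) (mfderiv (𝓡 2) (𝓡 2) e₀ x X : Plane) := by
      intro X η hη i
      subst hη
      have h1 := mfderiv_comp_chart he hx (f := (EuclideanSpace.proj i : Plane →L[ℝ] ℝ))
        (EuclideanSpace.proj i : Plane →L[ℝ] ℝ).differentiableAt X
      rw [ContinuousLinearMap.fderiv] at h1
      refine h1.symm.trans ?_
      have hev : (fun x => (EuclideanSpace.proj i : Plane →L[ℝ] ℝ) (e x)) =ᶠ[𝓝 x]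
          fun x => ![f₁, f₂] i (e₀ x) := by
        filter_upwards [e.open_source.mem_nhds hx] with z hz
        rw [hex z hz]
        fin_cases i <;> rfl
      rw [hev.mfderiv_eq]
      fin_cases i
      · exact hmf hd₁ x (heN hx) X
      · exact hmf hd₂ x (heN hx) X
    have hw := (hθ _ (heV x hx)).1
    refine ⟨(coordMetric g e₀ (e₀ x)).det / wedge (θ₁ (e₀ x)) (θ₂ (e₀ x)) ^ 2,
      div_ne_zero (hdet _ (hUΩ (heV x hx))) (pow_ne_zero 2 hw), fun X η hη => ?_⟩
    have h0 := hcoord X η hη 0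
    have h1 := hcoord X η hη 1
    rw [h0, h1]
    have hyU' := heV x hx
    have hxs := (heN hx).1
    clear h0 h1 hη hcoord hw
    clear_value N
    obtain ⟨y, hy, rfl⟩ := exists_eq_symm e₀ hxs
    obtain ⟨ξ, rfl⟩ := exists_coordTangent hm hy X
    rw [mfderiv_coordTangent hm hy]
    rw [e₀.right_inv hy] at hyU' ⊢
    rw [← inChart_lower g hm hy I, hnf y hyU', normalCubic]
    rfl

theorem isHexagonalGeodesicWeb_zeroDirections {g : Metric M} {V : Set M} (hV : IsOpen V)
    {I : (x : M) → Covector x → ℝ} (hI : IsCubicIntegral g I V) (h3 : HasThreeRealRoots I V) :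
    IsHexagonalGeodesicWeb g (zeroDirections g I) V := by
  have h : ∀ p ∈ V, ∃ (u : Fin 3 → M → ℝ) (N : Set M), p ∈ N ∧ N ⊆ V ∧
      AreWebFunctions (zeroDirections g I) u N ∧ HexagonsClose u p N := by
    intro p hp
    obtain ⟨e, he, hpe, heV, hK⟩ := exists_chart_of_isCubicIntegral hV hI h3 hp
    refine ⟨webFunction e, e.source, hpe, heV, (areWebFunctions_chartWeb he).congr fun x hx => ?_,
      hexagonsClose_webFunction p _⟩
    obtain ⟨K, hK0, hKI⟩ := hK x hx
    exact zeroDirections_eq_chartWeb g hK0 hKI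
  refine ⟨fun p hp => ?_, h, isGeodesic_zeroDirections hV hI h3⟩
  obtain ⟨u, N, h1, h2, h3, -⟩ := h p hp
  exact ⟨u, N, h1, h2, h3⟩

end ZeroWeb

end GeodesicWeb

/-! ### From hexagonal geodesic webs to cubic integrals -/

namespace GeodesicWeb

open scoped Topology

theorem ker_eq_span {φ : Plane →L[ℝ] ℝ} (hφ : φ ≠ 0) {ξ : Plane} (hξ : ξ ≠ 0) (h : φ ξ = 0) :
    LinearMap.ker φ.toLinearMap = Submodule.span ℝ {ξ} := by
  apply le_antisymm
  · intro ζ hζ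
    have hζ' : φ ζ = 0 := hζ
    rw [clm_apply_plane, smul_eq_mul, smul_eq_mul] at h hζ'
    have hc : cross ζ ξ = 0 := by
      by_contra hc
      have h0 : φ (basisVec 0) = 0 := (mul_eq_zero.1 (show cross ζ ξ * φ (basisVec 0) = 0 by
        rw [cross]; linear_combination ξ 1 * hζ' - ζ 1 * h)).resolve_left hc
      have h1 : φ (basisVec 1) = 0 := (mul_eq_zero.1 (show cross ζ ξ * φ (basisVec 1) = 0 by
        rw [cross]; linear_combination ζ 0 * h - ξ 0 * hζ')).resolve_left hc
      exact hφ (by ext v; rw [clm_apply_plane, h0, h1]; simp)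
    obtain ⟨c, rfl⟩ := exists_smul_of_cross_eq_zero hξ hc
    exact Submodule.smul_mem _ c (Submodule.mem_span_singleton_self _)
  · rw [Submodule.span_singleton_le_iff_mem]
    exact h

theorem kerVec_ne_zero {φ : Plane →L[ℝ] ℝ} (hφ : φ ≠ 0) : kerVec φ ≠ 0 := by
  intro h
  have h0 : φ (basisVec 1) = 0 := by simpa [kerVec] using congrArg (fun v : Plane => v 0) h
  have h1 : φ (basisVec 0) = 0 := by simpa [kerVec] using congrArg (fun v : Plane => v 1) h
  exact hφ (by ext v; rw [clm_apply_plane, h0, h1]; simp)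

variable {M : Type*} [TopologicalSpace M] [ChartedSpace Plane M] [IsManifold (𝓡 2) ∞ M]
variable {e : OpenPartialHomeomorph M Plane}

section LevelDirections

variable {f h : M → ℝ} {x : M}

theorem levelDirection_eq_span (hf : mfderiv (𝓡 2) 𝓘(ℝ, ℝ) f x ≠ 0) {X : TangentSpace (𝓡 2) x}
    (hX : X ≠ 0) (hfX : X ∈ levelDirection f x) : levelDirection f x = Submodule.span ℝ {X} :=
  ker_eq_span (φ := (mfderiv (𝓡 2) 𝓘(ℝ, ℝ) f x : Plane →L[ℝ] ℝ)) hf hX hfX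

theorem eq_zero_of_mem_levelDirection (hf : mfderiv (𝓡 2) 𝓘(ℝ, ℝ) f x ≠ 0)
    (hh : mfderiv (𝓡 2) 𝓘(ℝ, ℝ) h x ≠ 0) (hne : levelDirection f x ≠ levelDirection h x)
    {X : TangentSpace (𝓡 2) x} (h1 : X ∈ levelDirection f x) (h2 : X ∈ levelDirection h x) :
    X = 0 := by
  by_contra hX
  exact hne ((levelDirection_eq_span hf hX h1).trans (levelDirection_eq_span hh hX h2).symm)

theorem coordTangent_mem_levelDirection (he : e ∈ IsManifold.maximalAtlas (𝓡 2) ∞ M) {y : Plane}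
    (hy : y ∈ e.target) (hf : MDifferentiableAt (𝓡 2) 𝓘(ℝ, ℝ) f (e.symm y)) (ξ : Plane) :
    coordTangent e y ξ ∈ levelDirection f (e.symm y) ↔
      fderiv ℝ (fun y => f (e.symm y)) y ξ = 0 := by
  rw [fderiv_comp_symm he hy hf]
  rfl

/-- Transversality of level curves becomes the nonvanishing of a continuous function, hence an open
condition. -/
theorem levelDirection_ne_iff (he : e ∈ IsManifold.maximalAtlas (𝓡 2) ∞ M) {y : Plane}
    (hy : y ∈ e.target) (hf : MDifferentiableAt (𝓡 2) 𝓘(ℝ, ℝ) f (e.symm y))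
    (hh : MDifferentiableAt (𝓡 2) 𝓘(ℝ, ℝ) h (e.symm y))
    (hf0 : mfderiv (𝓡 2) 𝓘(ℝ, ℝ) f (e.symm y) ≠ 0)
    (hh0 : mfderiv (𝓡 2) 𝓘(ℝ, ℝ) h (e.symm y) ≠ 0) :
    levelDirection f (e.symm y) ≠ levelDirection h (e.symm y) ↔
      wedge (fderiv ℝ (fun y => f (e.symm y)) y) (fderiv ℝ (fun y => h (e.symm y)) y) ≠ 0 := by
  have hφ : fderiv ℝ (fun y => f (e.symm y)) y ≠ 0 := by
    intro h0
    apply hf0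
    ext X
    obtain ⟨ξ, rfl⟩ := exists_coordTangent he hy X
    refine (fderiv_comp_symm he hy hf ξ).symm.trans ?_
    rw [h0]; rfl
  have h1 := (coordTangent_mem_levelDirection he hy hf _).2 (apply_kerVec_self
    (fderiv ℝ (fun y => f (e.symm y)) y))
  have h2 := coordTangent_mem_levelDirection he hy hh
    (kerVec (fderiv ℝ (fun y => f (e.symm y)) y))
  rw [apply_kerVec] at h2
  constructor
  · intro hne hw
    have := eq_zero_of_mem_levelDirection hf0 hh0 hne h1 (h2.2 hw)
    rw [coordTangent_eq_zero he hy] at this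
    exact kerVec_ne_zero hφ this
  · intro hw heq
    exact hw (h2.1 (heq ▸ h1))

theorem eventually_levelDirection_ne {N : Set M} (hN : IsOpen N)
    (hf : ContMDiffOn (𝓡 2) 𝓘(ℝ, ℝ) ∞ f N) (hh : ContMDiffOn (𝓡 2) 𝓘(ℝ, ℝ) ∞ h N)
    (hf0 : ∀ z ∈ N, mfderiv (𝓡 2) 𝓘(ℝ, ℝ) f z ≠ 0) (hh0 : ∀ z ∈ N, mfderiv (𝓡 2) 𝓘(ℝ, ℝ) h z ≠ 0)
    (hx : x ∈ N) (hne : levelDirection f x ≠ levelDirection h x) :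
    ∀ᶠ z in 𝓝 x, levelDirection f z ≠ levelDirection h z := by
  set e := chartAt Plane x with he'
  have he : e ∈ IsManifold.maximalAtlas (𝓡 2) ∞ M := IsManifold.chart_mem_maximalAtlas x
  have hxe : x ∈ e.source := mem_chart_source Plane x
  set O := e.target ∩ e.symm ⁻¹' N with hO
  have hOo : IsOpen O := e.isOpen_inter_preimage_symm hN
  have hiff : ∀ z ∈ e.source, z ∈ N → (levelDirection f z ≠ levelDirection h z ↔
      wedge (fderiv ℝ (fun y => f (e.symm y)) (e z)) (fderiv ℝ (fun y => h (e.symm y)) (e z))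
        ≠ 0) := by
    intro z hz hzN
    obtain ⟨y, hy, rfl⟩ := exists_eq_symm e hz
    rw [e.right_inv hy]
    exact levelDirection_ne_iff he hy (mdifferentiableAt_of_contMDiffOn hN hf hzN)
      (mdifferentiableAt_of_contMDiffOn hN hh hzN) (hf0 _ hzN) (hh0 _ hzN)
  have hder : ∀ {u : M → ℝ}, ContMDiffOn (𝓡 2) 𝓘(ℝ, ℝ) ∞ u N → ∀ i,
      ContinuousOn (fun y => fderiv ℝ (fun y => u (e.symm y)) y (basisVec i)) O := fun hu i =>
    (((contDiffOn_comp_symm he hu).continuousOn_fderiv_of_isOpen hOo (by simp))).clm_apply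
      continuousOn_const
  have hxO : e x ∈ O := ⟨e.map_source hxe, by
    change e.symm (e x) ∈ N; rwa [e.left_inv hxe]⟩
  have hw : ContinuousAt (fun y => wedge (fderiv ℝ (fun y => f (e.symm y)) y)
      (fderiv ℝ (fun y => h (e.symm y)) y)) (e x) :=
    (((hder hf 0).mul (hder hh 1)).sub ((hder hf 1).mul (hder hh 0))).continuousAt
      (hOo.mem_nhds hxO)
  filter_upwards [e.open_source.mem_nhds hxe, hN.mem_nhds hx,
    (e.continuousAt hxe).eventually (hw.eventually_ne ((hiff x hxe hx).1 hne))] with z h1 h2 h3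
  exact (hiff z h1 h2).2 h3

/-- If the level curves of `f` are tangent to those of `h`, then `h` is locally a function of
`f`. -/
theorem exists_forall_eq_of_levelDirection_le {v : M → ℝ} {N : Set M} (hN : IsOpen N)
    (hf : ContMDiffOn (𝓡 2) 𝓘(ℝ, ℝ) ∞ f N) (hh : ContMDiffOn (𝓡 2) 𝓘(ℝ, ℝ) ∞ h N)
    (hv : ContMDiffOn (𝓡 2) 𝓘(ℝ, ℝ) ∞ v N) (hx : x ∈ N)
    (hf0 : mfderiv (𝓡 2) 𝓘(ℝ, ℝ) f x ≠ 0) (hv0 : mfderiv (𝓡 2) 𝓘(ℝ, ℝ) v x ≠ 0)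
    (hne : levelDirection f x ≠ levelDirection v x)
    (hle : ∀ z ∈ N, levelDirection f z ≤ levelDirection h z) :
    ∀ᶠ U in (𝓝 x).smallSets, ∀ a ∈ U, ∀ b ∈ U, f a = f b → h a = h b := by
  -- The function `v` serves only to complete `f` to coordinates with image a disc.
  obtain ⟨e, he, hxe, heN, hex, r, hr, htar⟩ := exists_chart_of_functions hN hf hv hx
    fun X h1 h2 => eq_zero_of_mem_levelDirection hf0 hv0 hne h1 h2
  rw [Filter.eventually_smallSets]
  refine ⟨e.source, e.open_source.mem_nhds hxe, fun U hU a ha b hb hab => ?_⟩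
  replace ha := hU ha
  replace hb := hU hb
  have hO : ∀ y ∈ e.target, e.symm y ∈ N := fun y hy => heN (e.map_target hy)
  have hval : ∀ y ∈ e.target, f (e.symm y) = y 0 := fun y hy => by
    have h1 := hex _ (e.map_target hy)
    rw [e.right_inv hy] at h1
    exact (congrArg (fun v : Plane => v 0) h1).symm
  have hfd : ∀ y ∈ e.target, ∀ ξ : Plane, ξ 0 = 0 → fderiv ℝ (fun y => h (e.symm y)) y ξ = 0 := by
    intro y hy ξ hξ
    rw [← coordTangent_mem_levelDirection he hy (mdifferentiableAt_of_contMDiffOn hN hh (hO y hy))]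
    apply hle _ (hO y hy)
    rw [coordTangent_mem_levelDirection he hy (mdifferentiableAt_of_contMDiffOn hN hf (hO y hy))]
    have hev : (fun y => f (e.symm y)) =ᶠ[𝓝 y] fun y => (EuclideanSpace.proj 0 : Plane →L[ℝ] ℝ) y :=
      Filter.eventuallyEq_of_mem (e.open_target.mem_nhds hy) hval
    rw [hev.fderiv_eq, ContinuousLinearMap.fderiv]
    exact hξ
  have ha' := e.map_source ha
  have hb' := e.map_source hb
  -- Two points with the same value of `f` are joined in the disc by a segment of constant first
  -- coordinate, along which `h` has zero derivative.
  have hseg : ∀ t ∈ Set.uIcc (0 : ℝ) 1, e a + t • (e b - e a) ∈ e.target := by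
    intro t ht
    rw [Set.uIcc_of_le zero_le_one] at ht
    have hc : Convex ℝ e.target := htar ▸ convex_ball _ _
    exact hc.add_smul_sub_mem ha' hb' ht
  have h0 : (e b - e a) 0 = 0 := by
    rw [hex a ha, hex b hb]
    exact sub_eq_zero.2 hab.symm
  have hconst := eq_of_hasDerivAt_zero (φ := fun t => h (e.symm (e a + t • (e b - e a))))
    (a := 0) (b := 1) fun t ht => by
      have hy := hseg t ht
      have hdiff : DifferentiableAt ℝ (fun y => h (e.symm y)) (e a + t • (e b - e a)) :=
        differentiableAt_of_contDiffOn (e.isOpen_inter_preimage_symm hN)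
          (contDiffOn_comp_symm he hh) ⟨hy, hO _ hy⟩
      have hl : HasDerivAt (fun t : ℝ => e a + t • (e b - e a)) (e b - e a) t := by
        have h := ((hasDerivAt_id t).smul_const (e b - e a)).const_add (e a)
        rwa [one_smul] at h
      have h2 := hdiff.hasFDerivAt.comp_hasDerivAt t hl
      rwa [hfd _ hy _ h0] at h2
  simp only [zero_smul, add_zero, one_smul, add_sub_cancel, e.left_inv ha, e.left_inv hb] at hconst
  exact hconst.symm

end LevelDirections

section Matching

variable {W : (x : M) → Set (Submodule ℝ (TangentSpace (𝓡 2) x))} {u u' : Fin 3 → M → ℝ}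
  {N N' : Set M} {x : M}

/-- Both triples have the same three tangent lines, which fixes a matching of labels at `x`. Lines
that differ at `x` differ nearby, so the matching persists, and functions with the same level
directions have locally the same level sets. -/
theorem AreWebFunctions.eventually_level_iff (hu : AreWebFunctions W u N)
    (hu' : AreWebFunctions W u' N') (hx : x ∈ N) (hx' : x ∈ N') :
    ∃ σ : Fin 3 → Fin 3, Function.Injective σ ∧ ∀ᶠ U in (𝓝 x).smallSets, ∀ i, ∀ a ∈ U, ∀ b ∈ U,
      u i a = u i b ↔ u' (σ i) a = u' (σ i) b := by
  have hσ : ∀ i, ∃ j, levelDirection (u' j) x = levelDirection (u i) x := fun i => by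
    have h1 : levelDirection (u i) x ∈ W x := by rw [hu.directions x hx]; exact ⟨i, rfl⟩
    rw [hu'.directions x hx'] at h1
    exact h1
  choose σ hσ using hσ
  have hinj : Function.Injective σ := fun i j hij => by
    by_contra hne
    exact hu.transverse i j hne x hx (by rw [← hσ i, ← hσ j, hij])
  refine ⟨σ, hinj, ?_⟩
  have hopen := hu.isOpen.inter hu'.isOpen
  have hs : ∀ i, ContMDiffOn (𝓡 2) 𝓘(ℝ, ℝ) ∞ (u i) (N ∩ N') := fun i =>
    (hu.smooth i).mono Set.inter_subset_left
  have hs' : ∀ i, ContMDiffOn (𝓡 2) 𝓘(ℝ, ℝ) ∞ (u' i) (N ∩ N') := fun i =>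
    (hu'.smooth i).mono Set.inter_subset_right
  have hne : ∀ᶠ z in 𝓝 x, ∀ i j, j ≠ σ i → levelDirection (u i) z ≠ levelDirection (u' j) z := by
    simp only [Filter.eventually_all]
    intro i j hij
    refine eventually_levelDirection_ne hopen (hs i) (hs' j) (fun z hz => hu.submersion i z hz.1)
      (fun z hz => hu'.submersion j z hz.2) ⟨hx, hx'⟩ ?_
    rw [← hσ i]
    exact hu'.transverse _ _ hij.symm x hx'
  obtain ⟨N₁, hN₁, hN₁o, hxN₁⟩ := eventually_nhds_iff.1 hne
  have hopen₁ := hopen.inter hN₁o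
  have heq : ∀ z ∈ N ∩ N' ∩ N₁, ∀ i, levelDirection (u i) z = levelDirection (u' (σ i)) z := by
    intro z hz i
    have h1 : levelDirection (u i) z ∈ W z := by rw [hu.directions z hz.1.1]; exact ⟨i, rfl⟩
    rw [hu'.directions z hz.1.2] at h1
    obtain ⟨j, hj⟩ := h1
    by_cases hji : j = σ i
    · rw [← hji]; exact hj.symm
    · exact absurd hj.symm (hN₁ z hz.2 i j hji)
  have hsucc : ∀ i : Fin 3, i ≠ i + 1 := by decide
  rw [Filter.eventually_all]
  intro i
  have h1 := exists_forall_eq_of_levelDirection_le hopen₁ ((hs i).mono Set.inter_subset_left)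
    ((hs' (σ i)).mono Set.inter_subset_left) ((hs (i + 1)).mono Set.inter_subset_left)
    ⟨⟨hx, hx'⟩, hxN₁⟩ (hu.submersion _ x hx) (hu.submersion _ x hx)
    (hu.transverse _ _ (hsucc i) x hx) fun z hz => (heq z hz i).le
  have h2 := exists_forall_eq_of_levelDirection_le hopen₁
    ((hs' (σ i)).mono Set.inter_subset_left) ((hs i).mono Set.inter_subset_left)
    ((hs' (σ i + 1)).mono Set.inter_subset_left)
    ⟨⟨hx, hx'⟩, hxN₁⟩ (hu'.submersion _ x hx') (hu'.submersion _ x hx')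
    (hu'.transverse _ _ (hsucc _) x hx') fun z hz => (heq z hz i).ge
  filter_upwards [h1, h2] with U h1 h2 a ha b hb
  exact ⟨h1 a ha b hb, h2 a ha b hb⟩

/-- Closing of the hexagons does not depend on the functions that define the web. -/
theorem HexagonsClose.congr_webFunctions (hu : AreWebFunctions W u N)
    (hu' : AreWebFunctions W u' N') (hx : x ∈ N) (hx' : x ∈ N') (hclose : HexagonsClose u' x N') :
    ∀ᶠ U in (𝓝 x).smallSets, x ∈ U → HexagonsClose u x U := by
  obtain ⟨σ, hσ, hev⟩ := hu.eventually_level_iff hu' hx hx'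
  have hN' : ∀ᶠ U in (𝓝 x).smallSets, U ⊆ N' :=
    Filter.eventually_smallSets_subset.2 (hu'.isOpen.mem_nhds hx')
  filter_upwards [hev, hN'] with U hU hUN' hxU i j k hij hjk hik q hq h0 h1 h2 h3 h4 h5 k0 k1 k2 k3 k4
  have T : ∀ {l a b}, a ∈ U → b ∈ U → u l a = u l b → u' (σ l) a = u' (σ l) b :=
    fun {l a b} ha hb => (hU l a ha b hb).1
  refine (hU j _ (hq 5) _ (hq 0)).2 (hclose (σ i) (σ j) (σ k) (hσ.ne hij) (hσ.ne hjk) (hσ.ne hik) q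
    (fun n => hUN' (hq n)) (T (hq _) hxU h0) (T (hq _) hxU h1) (T (hq _) hxU h2) (T (hq _) hxU h3)
    (T (hq _) hxU h4) (T (hq _) hxU h5) (T (hq _) (hq _) k0) (T (hq _) (hq _) k1)
    (T (hq _) (hq _) k2) (T (hq _) (hq _) k3) (T (hq _) (hq _) k4))

end Matching

section FlatChart

theorem IsGeodesic.congr {g : Metric M} {W W' : (x : M) → Set (Submodule ℝ (TangentSpace (𝓡 2) x))}
    {V V' : Set M} (hW : IsGeodesic g W V) (hV : V' ⊆ V) (h : ∀ x ∈ V', W' x = W x) :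
    IsGeodesic g W' V' := fun e he a b c hc ht =>
  hW e he a b c hc fun t hmem => by
    obtain ⟨h1, h2, h3⟩ := ht t hmem
    exact ⟨⟨h1.1, hV h1.2⟩, h2, h _ h1.2 ▸ h3⟩

theorem mem_levelDirection_of_eventuallyEq (he : e ∈ IsManifold.maximalAtlas (𝓡 2) ∞ M) {x : M}
    (hx : x ∈ e.source) {u : M → ℝ} {F : Plane → ℝ} {L : Plane →L[ℝ] ℝ}
    (hu : u =ᶠ[𝓝 x] fun z => F (e z)) (hF : HasFDerivAt F L (e x)) (X : TangentSpace (𝓡 2) x)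
    (ξ : Plane) (hξ : ξ = mfderiv (𝓡 2) (𝓡 2) e x X) : X ∈ levelDirection u x ↔ L ξ = 0 := by
  have h1 := mfderiv_comp_chart he hx hF.differentiableAt X
  rw [← hu.mfderiv_eq, hF.fderiv, ← hξ] at h1
  exact ⟨fun h => h1.symm.trans h, fun h => h1.trans h⟩

/-- A hexagonal web is locally the web of a chart. -/
theorem exists_chartWeb_eq {W : (x : M) → Set (Submodule ℝ (TangentSpace (𝓡 2) x))} {V : Set M}
    (hW : IsHexagonal W V) {p : M} (hp : p ∈ V) :
    ∃ e ∈ IsManifold.maximalAtlas (𝓡 2) ∞ M, p ∈ e.source ∧ e.source ⊆ V ∧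
      ∀ x ∈ e.source, chartWeb e x = W x := by
  obtain ⟨u, N, hpN, hNV, hu, -⟩ := hW p hp
  obtain ⟨e₀, he₀, hpe₀, he₀N, hex, r, hr, htar⟩ := exists_chart_of_functions hu.isOpen
    (hu.smooth 0) (hu.smooth 1) hpN fun X h1 h2 => eq_zero_of_mem_levelDirection
      (hu.submersion 0 p hpN) (hu.submersion 1 p hpN) (hu.transverse 0 1 (by decide) p hpN) h1 h2
  set f : Plane → ℝ := fun y => u 2 (e₀.symm y) with hf
  have hO : ∀ y ∈ e₀.target, e₀.symm y ∈ N := fun y hy => he₀N (e₀.map_target hy)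
  have hfs : ContDiffOn ℝ ∞ f e₀.target :=
    (contDiffOn_comp_symm he₀ (hu.smooth 2)).mono fun y hy => ⟨hy, hO y hy⟩
  have hval : ∀ y ∈ e₀.target, u 0 (e₀.symm y) = y 0 ∧ u 1 (e₀.symm y) = y 1 := fun y hy => by
    have h1 := hex _ (e₀.map_target hy)
    rw [e₀.right_inv hy] at h1
    exact ⟨(congrArg (fun v : Plane => v 0) h1).symm, (congrArg (fun v : Plane => v 1) h1).symm⟩
  set F : Fin 3 → Plane → ℝ := ![fun y => y 0, fun y => y 1, f] with hF
  set L : Plane → Fin 3 → Plane →L[ℝ] ℝ := fun y =>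
    ![EuclideanSpace.proj 0, EuclideanSpace.proj 1, fderiv ℝ f y] with hL
  have hFL : ∀ y ∈ e₀.target, ∀ i, HasFDerivAt (F i) (L y i) y := by
    intro y hy i
    fin_cases i
    · exact (EuclideanSpace.proj 0 : Plane →L[ℝ] ℝ).hasFDerivAt
    · exact (EuclideanSpace.proj 1 : Plane →L[ℝ] ℝ).hasFDerivAt
    · exact (differentiableAt_of_contDiffOn e₀.open_target hfs hy).hasFDerivAt
  have huF : ∀ x ∈ e₀.source, ∀ i, u i =ᶠ[𝓝 x] fun z => F i (e₀ z) := by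
    intro x hx i
    filter_upwards [e₀.open_source.mem_nhds hx] with z hz
    fin_cases i
    · change u 0 z = (e₀ z) 0
      rw [hex z hz]; rfl
    · change u 1 z = (e₀ z) 1
      rw [hex z hz]; rfl
    · change u 2 z = u 2 (e₀.symm (e₀ z))
      rw [e₀.left_inv hz]
  have hmem : ∀ x (hx : x ∈ e₀.source) (i : Fin 3) (X : TangentSpace (𝓡 2) x) (ξ : Plane),
      ξ = mfderiv (𝓡 2) (𝓡 2) e₀ x X → (X ∈ levelDirection (u i) x ↔ L (e₀ x) i ξ = 0) :=
    fun x hx i X ξ hξ => mem_levelDirection_of_eventuallyEq he₀ hx (huF x hx i)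
      (hFL _ (e₀.map_source hx) i) X ξ hξ
  have hnz : ∀ y ∈ e₀.target, ∀ i j : Fin 3, i ≠ j → ∀ ξ : Plane, ξ ≠ 0 → L y i ξ = 0 →
      L y j ξ ≠ 0 := by
    intro y hy i j hij ξ hξ hi hj
    have hx := e₀.map_target hy
    obtain ⟨X, hX⟩ := exists_mfderiv_chart_eq he₀ hx ξ
    have hX0 := eq_zero_of_mem_levelDirection (hu.submersion i _ (hO y hy))
      (hu.submersion j _ (hO y hy)) (hu.transverse i j hij _ (hO y hy))
      ((hmem _ hx i X ξ hX).2 (by rwa [e₀.right_inv hy]))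
      ((hmem _ hx j X ξ hX).2 (by rwa [e₀.right_inv hy]))
    rw [hX0] at hX
    exact hξ (hX.trans (map_zero (mfderiv (𝓡 2) (𝓡 2) e₀ _)))
  have hb : ∀ i, basisVec i ≠ 0 := fun i h => by
    simpa using congrArg (fun v : Plane => v i) h
  have hf0 : ∀ y ∈ e₀.target, partialDeriv f 0 y ≠ 0 := fun y hy =>
    hnz y hy 1 2 (by decide) (basisVec 0) (hb 0) (by simp [hL])
  have hf1 : ∀ y ∈ e₀.target, partialDeriv f 1 y ≠ 0 := fun y hy =>
    hnz y hy 0 2 (by decide) (basisVec 1) (hb 1) (by simp [hL])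
  -- The hexagons around each point close for web functions that may depend on the point. They are
  -- first transferred to the fixed functions `u`, two of which are the coordinates of `e₀`.
  have hcurv : ∀ y ∈ e₀.target, webCurvature f y = 0 := by
    intro y hy
    obtain ⟨u', N', hx', -, hu', hclose⟩ := hW (e₀.symm y) (hNV (hO y hy))
    have hev := hclose.congr_webFunctions hu hu' (hO y hy) hx'
    obtain ⟨U, hU, hUc⟩ := Filter.eventually_smallSets.1 hev
    have hUc := hUc U subset_rfl (mem_of_mem_nhds hU)
    obtain ⟨ρ, hρ, hbox⟩ := exists_box (P := fun z => z ∈ e₀.target ∧ e₀.symm z ∈ U)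
      (Filter.Eventually.and (e₀.open_target.mem_nhds hy)
        ((e₀.continuousAt_symm hy).eventually_mem hU))
    refine webCurvature_eq_zero_of_closing e₀.open_target hfs hy (hf0 y hy) (hf1 y hy) hρ ?_
    intro x x' t t' t'' hx hx' ht ht' ht'' E1 E2 E3 E4
    have z0 : |y 0 - y 0| < ρ := by simpa using hρ
    have z1 : |y 1 - y 1| < ρ := by simpa using hρ
    have b0 := hbox (y 0) t z0 ht
    have b1 := hbox x (y 1) hx z1
    have b2 := hbox x t' hx ht'
    have b3 := hbox (y 0) t' z0 ht'
    have b4 := hbox x' (y 1) hx' z1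
    have b5 := hbox x' t'' hx' ht''
    have c : ∀ {s τ : ℝ}, (!₂[s, τ] : Plane) ∈ e₀.target →
      u 0 (e₀.symm !₂[s, τ]) = s ∧ u 1 (e₀.symm !₂[s, τ]) = τ := fun h => hval _ h
    -- The vertices lie in turn on the leaves `y⁰ = const`, `y¹ = const`, `f = const` through the
    -- centre. The side from the last vertex to the first is a leaf `y¹ = const`, which is the
    -- wanted equality `t'' = t`.
    have key := hUc 0 1 2 (by decide) (by decide) (by decide)
      ![e₀.symm !₂[y 0, t], e₀.symm !₂[x, y 1], e₀.symm !₂[x, t'], e₀.symm !₂[y 0, t'],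
        e₀.symm !₂[x', y 1], e₀.symm !₂[x', t'']] (by
          intro n
          fin_cases n
          exacts [b0.2, b1.2, b2.2, b3.2, b4.2, b5.2])
      ((c b0.1).1.trans (hval y hy).1.symm) ((c b1.1).2.trans (hval y hy).2.symm) E2
      ((c b3.1).1.trans (hval y hy).1.symm) ((c b4.1).2.trans (hval y hy).2.symm) E4
      E1.symm ((c b1.1).1.trans (c b2.1).1.symm) ((c b2.1).2.trans (c b3.1).2.symm)
      E3.symm ((c b4.1).1.trans (c b5.1).1.symm)
    exact (c b5.1).2.symm.trans (key.trans (c b0.1).2)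
  -- Here the disc shape of the image is used. The functions `A` and `B` have the level curves of `u
  -- 0` and `u 1`, and `A + B` has those of `u 2`.
  obtain ⟨A, B, α, β, hA, hB, hAB⟩ := exists_flat_functions hr (htar ▸ hfs) (htar ▸ hf0)
    (htar ▸ hf1) (htar ▸ hcurv)
  rw [← htar] at hA hB hAB
  have hsm : ∀ {f : Plane → ℝ}, ContDiffOn ℝ ∞ f e₀.target →
      ContMDiffOn (𝓡 2) 𝓘(ℝ, ℝ) ∞ (fun x => f (e₀ x)) e₀.source := fun hf =>
    (contMDiffOn_iff_contDiffOn.2 hf).comp (contMDiffOn_of_mem_maximalAtlas he₀) e₀.mapsTo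
  obtain ⟨e, he, hpe, hee₀, hexe, -⟩ := exists_chart_of_functions e₀.open_source (hsm hA) (hsm hB)
    hpe₀ fun X h1 h2 => by
      obtain ⟨hα, hβ, -, hA', hB'⟩ := hAB _ (e₀.map_source hpe₀)
      have h1' := (mem_levelDirection_of_eventuallyEq he₀ hpe₀ Filter.EventuallyEq.rfl hA' X _ rfl).1 h1
      have h2' := (mem_levelDirection_of_eventuallyEq he₀ hpe₀ Filter.EventuallyEq.rfl hB' X _ rfl).1 h2
      set ξ : Plane := mfderiv (𝓡 2) (𝓡 2) e₀ p X with hξ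
      suffices h : ξ = 0 from eq_zero_of_mfderiv_chart he₀ hpe₀ h
      ext i
      fin_cases i
      · exact (mul_eq_zero.1 h1').resolve_left hα
      · exact (mul_eq_zero.1 h2').resolve_left hβ
  refine ⟨e, he, hpe, fun x hx => hNV (he₀N (hee₀ hx)), fun x hx => ?_⟩
  have hx₀ := hee₀ hx
  rw [hu.directions x (he₀N hx₀), range_levelDirection_webFunction he hx]
  congr 1
  funext i
  obtain ⟨hα, hβ, hαβ, hA', hB'⟩ := hAB _ (e₀.map_source hx₀)
  set P : Fin 3 → Plane → ℝ := ![A, B, fun y => -(A y + B y)] with hP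
  set Q : Fin 3 → Plane →L[ℝ] ℝ := ![α (e₀ x) • EuclideanSpace.proj 0,
    β (e₀ x) • EuclideanSpace.proj 1,
    -(α (e₀ x) • EuclideanSpace.proj 0 + β (e₀ x) • EuclideanSpace.proj 1)] with hQ
  have hPQ : HasFDerivAt (P i) (Q i) (e₀ x) := by
    fin_cases i
    · exact hA'
    · exact hB'
    · exact (hA'.add hB').neg
  have hweb : webFunction e i =ᶠ[𝓝 x] fun z => P i (e₀ z) := by
    filter_upwards [e.open_source.mem_nhds hx] with z hz
    rw [webFunction, hexe z hz]
    fin_cases i <;> simp [webForm, hP]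
  ext X
  rw [mem_levelDirection_of_eventuallyEq he₀ hx₀ hweb hPQ X _ rfl, hmem x hx₀ i X _ rfl]
  set ξ : Plane := mfderiv (𝓡 2) (𝓡 2) e₀ x X with hξ
  fin_cases i
  · change α (e₀ x) * ξ 0 = 0 ↔ ξ 0 = 0
    simp [hα]
  · change β (e₀ x) * ξ 1 = 0 ↔ ξ 1 = 0
    simp [hβ]
  · change -(α (e₀ x) * ξ 0 + β (e₀ x) * ξ 1) = 0 ↔ fderiv ℝ f (e₀ x) ξ = 0
    have hf0' := hf0 _ (e₀.map_source hx₀)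
    rw [clm_apply_plane]
    change -(α (e₀ x) * ξ 0 + β (e₀ x) * ξ 1) = 0 ↔
      ξ 0 * partialDeriv f 0 (e₀ x) + ξ 1 * partialDeriv f 1 (e₀ x) = 0
    constructor
    -- The coefficient pairs `(α, β)` and `(∂₀ f, ∂₁ f)` are proportional by `hαβ`, so their kernels
    -- coincide.
    · intro h
      apply (mul_eq_zero.1 (?_ : α (e₀ x) * _ = 0)).resolve_left hα
      linear_combination (-partialDeriv f 0 (e₀ x)) * h + ξ 1 * hαβ
    · intro h
      apply (mul_eq_zero.1 (?_ : partialDeriv f 0 (e₀ x) * _ = 0)).resolve_left hf0'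
      linear_combination (-α (e₀ x)) * h + ξ 1 * hαβ

theorem exists_isCubicIntegral_of_isHexagonalGeodesicWeb {g : Metric M}
    {W : (x : M) → Set (Submodule ℝ (TangentSpace (𝓡 2) x))} {V : Set M}
    (hW : IsHexagonalGeodesicWeb g W V) {p : M} (hp : p ∈ V) :
    ∃ V' : Set M, IsOpen V' ∧ p ∈ V' ∧ V' ⊆ V ∧
      ∃ I, IsCubicIntegral g I V' ∧ HasThreeRealRoots I V' ∧
        ∀ x ∈ V', zeroDirections g I x = W x := by
  obtain ⟨e, he, hpe, heV, hWe⟩ := exists_chartWeb_eq hW.hexagonal hp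
  exact ⟨e.source, e.open_source, hpe, heV, chartCubic g e,
    isCubicIntegral_chartCubic g he (hW.geodesic.congr heV hWe),
    hasThreeRealRoots_chartCubic g he,
    fun x hx => (zeroDirections_chartCubic g he hx).trans (hWe x hx)⟩

end FlatChart

end GeodesicWeb
end

/-! ### The theorem -/

open scoped Manifold ContDiff in
theorem mainTheorem1 {M : Type*} [TopologicalSpace M] [ChartedSpace GeodesicWeb.Plane M]
    [IsManifold (𝓡 2) ∞ M] (g : GeodesicWeb.Metric M) :
    (∀ p : M,
      (∃ V : Set M, IsOpen V ∧ p ∈ V ∧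
        ∃ W, GeodesicWeb.IsHexagonalGeodesicWeb g W V) ↔
      (∃ V : Set M, IsOpen V ∧ p ∈ V ∧
        ∃ I, GeodesicWeb.IsCubicIntegral g I V ∧ GeodesicWeb.HasThreeRealRoots I V)) ∧
    (∀ V : Set M, IsOpen V → ∀ I, GeodesicWeb.IsCubicIntegral g I V →
      GeodesicWeb.HasThreeRealRoots I V →
      GeodesicWeb.IsHexagonalGeodesicWeb g (GeodesicWeb.zeroDirections g I) V) ∧
    (∀ V : Set M, IsOpen V → ∀ W, GeodesicWeb.IsHexagonalGeodesicWeb g W V →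
      ∀ p ∈ V, ∃ V' : Set M, IsOpen V' ∧ p ∈ V' ∧ V' ⊆ V ∧
        ∃ I, GeodesicWeb.IsCubicIntegral g I V' ∧ GeodesicWeb.HasThreeRealRoots I V' ∧
          ∀ x ∈ V', GeodesicWeb.zeroDirections g I x = W x) ∧
    (∀ e ∈ IsManifold.maximalAtlas (𝓡 2) ∞ M,
      GeodesicWeb.IsGeodesic g (GeodesicWeb.chartWeb e) e.source →
      GeodesicWeb.IsCubicIntegral g (GeodesicWeb.chartCubic g e) e.source ∧
        GeodesicWeb.HasThreeRealRoots (GeodesicWeb.chartCubic g e) e.source ∧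
        ∀ x ∈ e.source,
          GeodesicWeb.zeroDirections g (GeodesicWeb.chartCubic g e) x =
            GeodesicWeb.chartWeb e x) := by
  refine ⟨fun p => ⟨?_, ?_⟩, fun V hV I hI h3 =>
      GeodesicWeb.isHexagonalGeodesicWeb_zeroDirections hV hI h3,
    fun V _ W hW p hp => GeodesicWeb.exists_isCubicIntegral_of_isHexagonalGeodesicWeb hW hp,
    fun e he hgeo => ⟨GeodesicWeb.isCubicIntegral_chartCubic g he hgeo,
      GeodesicWeb.hasThreeRealRoots_chartCubic g he,
      fun x hx => GeodesicWeb.zeroDirections_chartCubic g he hx⟩⟩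
  · rintro ⟨V, _, hp, W, hW⟩
    obtain ⟨V', hV', hp', -, I, hI, h3, -⟩ :=
      GeodesicWeb.exists_isCubicIntegral_of_isHexagonalGeodesicWeb hW hp
    exact ⟨V', hV', hp', I, hI, h3⟩
  · rintro ⟨V, hV, hp, I, hI, h3⟩
    exact ⟨V, hV, hp, _, GeodesicWeb.isHexagonalGeodesicWeb_zeroDirections hV hI h3⟩
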